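/- **Setting.** For $L>0$ let $\Omega=(0,L)\times(0,\infty)$ with coordinates $(x,Y)$. Let $u^0_e\in C^\infty([0,\infty))$ satisfy $c_0\le u^0_e\le C_0$ for some constants $0<c_0<C_0$, with all derivatives $\partial_Y^k u^0_e$, $k\ge 1$, decaying faster than any power of $Y$. Fix one of the two weight families $w_m(Y)=(1+Y)^m$ or $w_m(Y)=e^{mY}$ ($m\in\mathbb R$), let $m_i,l_i>0$ and put $m_i'=\min\{m_i,l_i\}$. The data of the $i$-th Euler layer are: forcing terms $f^i_{E,1},f^i_{E,2}\in C^\infty(\overline\Omega)$; the wall trace $a(x)=v^{i-1}_p|_{y=0}$ of the previous Prandtl corrector, $a\in C^\infty([0,L])$; and functions $U^i_E,V^i_{E,0},V^i_{E,L}\in C^\infty([0,\infty))$. Put $F^{(i)}=\partial_Y f^i_{E,1}-\partial_x f^i_{E,2}$. For a sequence $B=(B_k)_{k\ge0}$, the data are called admissible with bounds $B$ if for all $j,k\ge 0$, on $\overline\Omega$ and its sides: * $|\partial_x^k a|\le B_k$, $\;|\partial_x^j\partial_Y^kF^{(i)}|\le B_{j+k}w_{l_i}^{-1}$, $\;|\partial_Y^kV^i_{E,0}|,|\partial_Y^kV^i_{E,L}|\le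 B_kw_{m_i}^{-1}$, $\;|\partial_Y^kU^i_E|\le B_kw_{m_i'}^{-1}$; * $|\partial_Y^k(V^i_{E,0}-V^i_{E,L})|\le B_k\,L\,w_{m_i'}^{-1}$; * at both corners $(0,0)$ and $(L,0)$ the boundary data are well-prepared to order $2n$ for every $n\ge 0$: there are numbers $c_{p,q}$ (candidates for $\partial_x^p\partial_Y^qv$ at the corner) such that $c_{0,q}$, $q\le 2n$, are the derivatives $\partial_Y^qV$ at $Y=0$ of the datum $V$ on the adjacent vertical side, $c_{p,0}$, $p\le 2n$, are the derivatives of $-a$ at the corner, and $\partial_x^p\partial_Y^q$ of the equation $-u^0_e\Delta v+u^0_{eYY}v=F^{(i)}$ holds at the corner with these values whenever $p+q+2\le 2n$. **Proposition.** There is $n_0>0$ such that for every choice of weight family, $u^0_e$, $m_i$, $l_i$ as above there is $L_0>0$ such that for every sequence $B$ there are constants $C_{k,M}$ ($k\in\mathbb N$, $M\in\mathbb R$) for which the following holds for all $0<L<L_0$ and all admissible data with bounds $B$. 1. The Dirichlet problem $$-u^0_e\Delta v+u^0_{eYY}v=F^{(i)}\ \text{ in }\Omega,\qquad v|_{Y=0}=-a,\quad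 v|_{x=0}=V^i_{E,0},\quad v|_{x=L}=V^i_{E,L}$$ has a unique bounded solution $v=v^i_e\in C^2(\Omega)\cap C(\overline\Omega)$. 2. Put $u^i_e(x,Y)=U^i_E(Y)-\int_0^x\partial_Yv^i_e(x',Y)\,dx'$. Then $u^i_e,v^i_e\in C^\infty(\overline\Omega)$, and there is $P^i_e\in C^\infty(\overline\Omega)$ such that $$u^0_e\partial_xu^i_e+\partial_Yu^0_e\,v^i_e+\partial_xP^i_e=f^i_{E,1},\qquad u^0_e\partial_xv^i_e+\partial_YP^i_e=f^i_{E,2},\qquad \partial_xu^i_e+\partial_Yv^i_e=0,$$ $$v^i_e|_{Y=0}=-a,\qquad v^i_e|_{x=0}=V^i_{E,0},\qquad v^i_e|_{x=L}=V^i_{E,L},\qquad u^i_e|_{x=0}=U^i_E.$$ 3. For every integer $k\ge0$ and every real $M\le m_i'-n_0$, $$\|u^i_e\,w_M\|_{H^k(\Omega)}+\|v^i_e\,w_M\|_{H^k(\Omega)}\le C_{k,M}.$$ -/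

import Mathlib

open Set MeasureTheory
open scoped ENNReal ContDiff

noncomputable section

namespace EulerLayer

/-- The open half-strip `Ω = (0, L) × (0, ∞)`, with coordinates `(x, Y)`. -/
def strip (L : ℝ) : Set (ℝ × ℝ) := Ioo 0 L ×ˢ Ioi 0

/-- The closed half-strip `[0, L] × [0, ∞)`. -/
def closedStrip (L : ℝ) : Set (ℝ × ℝ) := Icc 0 L ×ˢ Ici 0

/-- The partial derivative `∂ₓ f` on `[0, L] × [0, ∞)` (one-sided at `x = 0` and `x = L`). -/
def dx (L : ℝ) (f : ℝ × ℝ → ℝ) (p : ℝ × ℝ) : ℝ :=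
  derivWithin (fun s => f (s, p.2)) (Icc 0 L) p.1

/-- The partial derivative `∂_Y f` on `[0, L] × [0, ∞)` (one-sided at `Y = 0`). -/
def dY (f : ℝ × ℝ → ℝ) (p : ℝ × ℝ) : ℝ :=
  derivWithin (fun t => f (p.1, t)) (Ici 0) p.2

/-- The Laplacian `∂ₓₓ f + ∂_YY f`. -/
def laplacian (L : ℝ) (f : ℝ × ℝ → ℝ) (p : ℝ × ℝ) : ℝ :=
  dx L (dx L f) p + dY (dY f) p

/-- The `k`-th derivative of a function of `Y ∈ [0, ∞)`. -/
def dHalf (k : ℕ) (g : ℝ → ℝ) (Y : ℝ) : ℝ := iteratedDerivWithin k g (Ici 0) Y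

/-- Whether decay is measured on the polynomial or on the exponential scale. -/
inductive WeightKind
  | poly
  | expo

/-- The weight `w_m(Y)`, equal to `(1 + Y) ^ m` or to `exp (m Y)`. -/
def weight : WeightKind → ℝ → ℝ → ℝ
  | .poly, m, Y => (1 + Y) ^ m
  | .expo, m, Y => Real.exp (m * Y)

/-- A smooth shear profile `u⁰ₑ` on `[0, ∞)`, bounded above and bounded below by a positive
constant, all of whose derivatives decay rapidly. -/
structure IsShearFlow (u0 : ℝ → ℝ) : Prop where
  smooth : ContDiffOn ℝ ∞ u0 (Ici 0)
  bounds : ∃ c₀ C₀ : ℝ, 0 < c₀ ∧ ∀ Y, 0 ≤ Y → c₀ ≤ u0 Y ∧ u0 Y ≤ C₀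
  decay : ∀ k : ℕ, 1 ≤ k → ∀ N : ℕ, ∃ C : ℝ, ∀ Y, 0 ≤ Y → |dHalf k u0 Y| * (1 + Y) ^ N ≤ C

/-- The given data of one Euler layer: the forcing `(f₁, f₂)`, the wall trace `a` of the previous
Prandtl corrector (`a x = v_p^{i-1}(x, 0)`), the datum `U` for `u` at `x = 0`, and the data
`V₀`, `V₁` for `v` at `x = 0` and at `x = L`. -/
structure LayerData where
  f₁ : ℝ × ℝ → ℝ
  f₂ : ℝ × ℝ → ℝ
  a : ℝ → ℝ
  U : ℝ → ℝ
  V₀ : ℝ → ℝ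
  V₁ : ℝ → ℝ

/-- The vorticity forcing `F = ∂_Y f₁ - ∂ₓ f₂`. -/
def LayerData.F (d : LayerData) (L : ℝ) (p : ℝ × ℝ) : ℝ := dY d.f₁ p - dx L d.f₂ p

/-- The boundary data are well-prepared to order `2 n` at the corner `(x₀, 0)`, where `V` is the
datum for `v` on the side `x = x₀` and `-a` is the datum for `v` on the side `Y = 0`.

There have to be values `c p q` of the derivatives `∂ₓ^p ∂_Y^q v` at the corner, up to total order
`2 n`, that agree with the derivatives of `V` along the side `x = x₀`, with those of `-a` along the
side `Y = 0`, and with the equation `-u⁰ₑ Δv + u⁰ₑ'' v = F` differentiated `p` times in `x` and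
`q` times in `Y` (expanded by the Leibniz rule, as `u⁰ₑ` depends on `Y` alone).
For `n = 1` this reads `V(0) = -a(x₀)` and
`V''(0) = a''(x₀) - (u⁰ₑ''(0) a(x₀) + F(x₀, 0)) / u⁰ₑ(0)`. -/
def WellPreparedAt (L : ℝ) (u0 a V : ℝ → ℝ) (F : ℝ × ℝ → ℝ) (x₀ : ℝ) (n : ℕ) : Prop :=
  ∃ c : ℕ → ℕ → ℝ,
    (∀ q, q ≤ 2 * n → c 0 q = dHalf q V 0) ∧
    (∀ p, p ≤ 2 * n → c p 0 = -iteratedDerivWithin p a (Icc 0 L) x₀) ∧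
    (∀ p q, p + q + 2 ≤ 2 * n →
      ∑ i ∈ Finset.range (q + 1), (q.choose i : ℝ) *
        (-(dHalf i u0 0) * (c (p + 2) (q - i) + c p (q - i + 2))
          + dHalf (i + 2) u0 0 * c p (q - i))
        = (dx L)^[p] (dY^[q] F) (x₀, 0))

/-- The standing assumptions on the data on the strip of width `L`: smoothness, decay at the rates
`m` (side data) and `l` (forcing), closeness of the two side data, and compatibility to every order
at both corners. The sequence `B` records the size of the data. -/
structure Admissible (κ : WeightKind) (m l : ℝ) (B : ℕ → ℝ) (L : ℝ) (u0 : ℝ → ℝ)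
    (d : LayerData) : Prop where
  smooth_f₁ : ContDiffOn ℝ ∞ d.f₁ (closedStrip L)
  smooth_f₂ : ContDiffOn ℝ ∞ d.f₂ (closedStrip L)
  smooth_a : ContDiffOn ℝ ∞ d.a (Icc 0 L)
  smooth_U : ContDiffOn ℝ ∞ d.U (Ici 0)
  smooth_V₀ : ContDiffOn ℝ ∞ d.V₀ (Ici 0)
  smooth_V₁ : ContDiffOn ℝ ∞ d.V₁ (Ici 0)
  bound_a : ∀ k : ℕ, ∀ x ∈ Icc 0 L, |iteratedDerivWithin k d.a (Icc 0 L) x| ≤ B k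
  decay_F : ∀ j k : ℕ, ∀ p ∈ closedStrip L,
    |(dx L)^[j] (dY^[k] (d.F L)) p| ≤ B (j + k) * (weight κ l p.2)⁻¹
  decay_V₀ : ∀ k : ℕ, ∀ Y, 0 ≤ Y → |dHalf k d.V₀ Y| ≤ B k * (weight κ m Y)⁻¹
  decay_V₁ : ∀ k : ℕ, ∀ Y, 0 ≤ Y → |dHalf k d.V₁ Y| ≤ B k * (weight κ m Y)⁻¹
  decay_U : ∀ k : ℕ, ∀ Y, 0 ≤ Y → |dHalf k d.U Y| ≤ B k * (weight κ (min m l) Y)⁻¹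
  close : ∀ k : ℕ, ∀ Y, 0 ≤ Y →
    |dHalf k d.V₀ Y - dHalf k d.V₁ Y| ≤ B k * L * (weight κ (min m l) Y)⁻¹
  corner_left : ∀ n : ℕ, WellPreparedAt L u0 d.a d.V₀ (d.F L) 0 n
  corner_right : ∀ n : ℕ, WellPreparedAt L u0 d.a d.V₁ (d.F L) L n

/-- `v` is a bounded classical solution of the Dirichlet problem
`-u⁰ₑ Δv + u⁰ₑ'' v = F` on the strip, `v = -a` on `Y = 0`, `v = V₀` on `x = 0`, `v = V₁` on
`x = L`. -/
structure IsVorticitySolution (L : ℝ) (u0 : ℝ → ℝ) (d : LayerData) (v : ℝ × ℝ → ℝ) : Prop where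
  regular : ContDiffOn ℝ 2 v (strip L)
  cont : ContinuousOn v (closedStrip L)
  bounded : ∃ K : ℝ, ∀ p ∈ closedStrip L, |v p| ≤ K
  equation : ∀ p ∈ strip L, -u0 p.2 * laplacian L v p + dHalf 2 u0 p.2 * v p = d.F L p
  bottom : ∀ x ∈ Icc 0 L, v (x, 0) = -d.a x
  left : ∀ Y, 0 ≤ Y → v (0, Y) = d.V₀ Y
  right : ∀ Y, 0 ≤ Y → v (L, Y) = d.V₁ Y

/-- The horizontal component `u(x, Y) = U(Y) - ∫₀ˣ ∂_Y v(s, Y) ds`. -/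
def recoveredU (U : ℝ → ℝ) (v : ℝ × ℝ → ℝ) (p : ℝ × ℝ) : ℝ :=
  U p.2 - ∫ s in (0 : ℝ)..p.1, dY v (s, p.2)

/-- `(u, v, P)`, smooth up to the boundary, solves the Euler layer system. -/
structure SolvesEulerLayer (L : ℝ) (u0 : ℝ → ℝ) (d : LayerData) (u v P : ℝ × ℝ → ℝ) : Prop where
  smooth_u : ContDiffOn ℝ ∞ u (closedStrip L)
  smooth_v : ContDiffOn ℝ ∞ v (closedStrip L)
  smooth_P : ContDiffOn ℝ ∞ P (closedStrip L)
  momentum_x : ∀ p ∈ closedStrip L,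
    u0 p.2 * dx L u p + dHalf 1 u0 p.2 * v p + dx L P p = d.f₁ p
  momentum_Y : ∀ p ∈ closedStrip L, u0 p.2 * dx L v p + dY P p = d.f₂ p
  divergence_free : ∀ p ∈ closedStrip L, dx L u p + dY v p = 0
  bottom : ∀ x ∈ Icc 0 L, v (x, 0) = -d.a x
  left : ∀ Y, 0 ≤ Y → v (0, Y) = d.V₀ Y
  right : ∀ Y, 0 ≤ Y → v (L, Y) = d.V₁ Y
  left_u : ∀ Y, 0 ≤ Y → u (0, Y) = d.U Y

/-- The Sobolev norm `‖f‖_{H^k(Ω)} = (∑_{j + l ≤ k} ‖∂ₓ^j ∂_Y^l f‖²_{L²(Ω)})^{1/2}`, for `f` smooth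
on the strip. -/
def hkNorm (L : ℝ) (k : ℕ) (f : ℝ × ℝ → ℝ) : ℝ≥0∞ :=
  (∑ j ∈ Finset.range (k + 1), ∑ l ∈ Finset.range (k + 1 - j),
    eLpNorm ((dx L)^[j] (dY^[l] f)) 2 (volume.restrict (strip L)) ^ 2) ^ (1 / 2 : ℝ)

end EulerLayer

end

open EulerLayer

noncomputable section

namespace EulerLayer

open Filter Topology

/-! Division by `u0` gives (-Δ + q) v = F / u⁰, where q = u⁰'' / u⁰ is bounded by some Q but has no
sign. Thinness of the strip compensates for this: if K L² ≤ 1, the function 2 - K x² lies between 1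
and 2 on [0, L], and its second derivative -2K beats the potential once K > Q. With an extra factor
1 + Y, which handles infinity, this yields a minimum principle for functions bounded below
(`nonneg_of_supersolution`), hence uniqueness; with a weight W(Y) in place of 1 + Y it yields
weighted bounds (`abs_le_of_weighted_bounds`).

Existence and smoothness up to the corners avoid elliptic regularity theory. Formally, every even
derivative ∂ₓ^{2j} v solves a Dirichlet problem of the same type: the source and the bottom datum
are differentiated 2j times in x, and the side data are found recursively by solving the equation
for ∂ₓ² (`sideFun`). Well-preparedness makes these data continuous at the corners
(`sideFun_corner`). The whole tower of problems is solved by sine series in x. The coefficients are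
bounded solutions of half-line equations (`exists_bounded_ode_solution`), and two consecutive levels
are related as the coefficients of a function and of its second derivative must be: the discrepancy
is a bounded homogeneous solution that vanishes at Y = 0 (`IsCoefTower.succ_eq`). This makes the
series of level j, after subtraction of an affine interpolation, absolutely convergent. Derivatives
are identified by comparing sine coefficients of Taylor formulas with integral remainder, through
completeness of the sine system.

Write E for a level of the tower, X and D for its x- and Y-derivatives and M for its mixed
derivative. All first partials of these four families are again expressed by them and the data, so
smoothness follows by induction (`IsTowerSolution.smooth`). The same closed system propagates
estimates (`tame_of_isTowerSolution`): the weighted maximum principle bounds E, interpolation in x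
bounds X and M because the side data differ by O(L), and interpolation in Y bounds D. Uniformity in
the width and the data is obtained by treating all admissible data as one family (`Tame`).

Finally u is a primitive in x, and the pressure is the potential of a form whose closedness is the
vorticity equation. One power of the weight is lost in passing from pointwise to L² bounds, so n₀ =
1. -/

/-! ### Calculus of one-sided partial derivatives on the closed strip -/

/-- `g` is the `x`-derivative of `f` on the closed strip. -/
def HasDx (L : ℝ) (f g : ℝ × ℝ → ℝ) : Prop :=
  ∀ p ∈ closedStrip L, HasDerivWithinAt (fun s => f (s, p.2)) (g p) (Icc 0 L) p.1

/-- `g` is the `Y`-derivative of `f` on the closed strip. -/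
def HasDY (L : ℝ) (f g : ℝ × ℝ → ℝ) : Prop :=
  ∀ p ∈ closedStrip L, HasDerivWithinAt (fun t => f (p.1, t)) (g p) (Ici 0) p.2

/-- Smoothness up to the boundary of the strip. -/
def SmoothStrip (L : ℝ) (f : ℝ × ℝ → ℝ) : Prop := ContDiffOn ℝ ∞ f (closedStrip L)

theorem uniqueDiffOn_closedStrip {L : ℝ} (hL : 0 < L) : UniqueDiffOn ℝ (closedStrip L) :=
  (uniqueDiffOn_Icc hL).prod (uniqueDiffOn_Ici 0)

theorem strip_subset_closedStrip (L : ℝ) : strip L ⊆ closedStrip L :=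
  prod_mono Ioo_subset_Icc_self Ioi_subset_Ici_self

theorem isOpen_strip (L : ℝ) : IsOpen (strip L) := isOpen_Ioo.prod isOpen_Ioi

theorem interior_closedStrip (L : ℝ) : interior (closedStrip L) = strip L := by
  simp [closedStrip, strip, interior_prod_eq, interior_Icc]

theorem closure_strip {L : ℝ} (hL : 0 < L) : closure (strip L) = closedStrip L := by
  simp [closedStrip, strip, closure_prod_eq, closure_Ioo hL.ne, closure_Ioi]

theorem HasDx.eq {L : ℝ} (hL : 0 < L) {f g : ℝ × ℝ → ℝ} (h : HasDx L f g) {p : ℝ × ℝ}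
    (hp : p ∈ closedStrip L) : dx L f p = g p :=
  (h p hp).derivWithin (uniqueDiffOn_Icc hL _ hp.1)

theorem HasDY.eq {L : ℝ} {f g : ℝ × ℝ → ℝ} (h : HasDY L f g) {p : ℝ × ℝ}
    (hp : p ∈ closedStrip L) : dY f p = g p :=
  (h p hp).derivWithin (uniqueDiffOn_Ici 0 _ hp.2)

theorem HasDx.congr {L : ℝ} {f f' g g' : ℝ × ℝ → ℝ} (h : HasDx L f g)
    (hf : EqOn f' f (closedStrip L)) (hg : EqOn g' g (closedStrip L)) : HasDx L f' g' := by
  intro p hp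
  rw [hg hp]
  exact (h p hp).congr (fun s hs => hf (show (s, p.2) ∈ closedStrip L from ⟨hs, hp.2⟩)) (hf hp)

theorem HasDY.congr {L : ℝ} {f f' g g' : ℝ × ℝ → ℝ} (h : HasDY L f g)
    (hf : EqOn f' f (closedStrip L)) (hg : EqOn g' g (closedStrip L)) : HasDY L f' g' := by
  intro p hp
  rw [hg hp]
  exact (h p hp).congr (fun s hs => hf (show (p.1, s) ∈ closedStrip L from ⟨hp.1, hs⟩)) (hf hp)

theorem dx_congr {L : ℝ} {f g : ℝ × ℝ → ℝ} (h : EqOn f g (closedStrip L)) :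
    EqOn (dx L f) (dx L g) (closedStrip L) := fun p hp =>
  derivWithin_congr (fun s hs => h (show (s, p.2) ∈ closedStrip L from ⟨hs, hp.2⟩)) (h hp)

theorem dY_congr {L : ℝ} {f g : ℝ × ℝ → ℝ} (h : EqOn f g (closedStrip L)) :
    EqOn (dY f) (dY g) (closedStrip L) := fun p hp =>
  derivWithin_congr (fun s hs => h (show (p.1, s) ∈ closedStrip L from ⟨hp.1, hs⟩)) (h hp)

theorem hasDerivWithinAt_horizontal {L : ℝ} {f : ℝ × ℝ → ℝ} {f' : ℝ × ℝ →L[ℝ] ℝ} {p : ℝ × ℝ}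
    (hp : p ∈ closedStrip L) (h : HasFDerivWithinAt f f' (closedStrip L) p) :
    HasDerivWithinAt (fun s => f (s, p.2)) (f' (1, 0)) (Icc 0 L) p.1 := by
  have h1 : HasDerivWithinAt (fun s : ℝ => (s, p.2)) ((1 : ℝ), (0 : ℝ)) (Icc 0 L) p.1 :=
    (hasDerivWithinAt_id _ _).prodMk (hasDerivWithinAt_const _ _ _)
  exact HasFDerivWithinAt.comp_hasDerivWithinAt (x := p.1) (t := closedStrip L) h h1
    (fun s hs => ⟨hs, hp.2⟩)

theorem hasDerivWithinAt_vertical {L : ℝ} {f : ℝ × ℝ → ℝ} {f' : ℝ × ℝ →L[ℝ] ℝ} {p : ℝ × ℝ}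
    (hp : p ∈ closedStrip L) (h : HasFDerivWithinAt f f' (closedStrip L) p) :
    HasDerivWithinAt (fun t => f (p.1, t)) (f' (0, 1)) (Ici 0) p.2 := by
  have h1 : HasDerivWithinAt (fun s : ℝ => (p.1, s)) ((0 : ℝ), (1 : ℝ)) (Ici 0) p.2 :=
    (hasDerivWithinAt_const _ _ _).prodMk (hasDerivWithinAt_id _ _)
  exact HasFDerivWithinAt.comp_hasDerivWithinAt (x := p.2) (t := closedStrip L) h h1
    (fun s hs => ⟨hp.1, hs⟩)

theorem SmoothStrip.hasFDerivWithinAt {L : ℝ} {f : ℝ × ℝ → ℝ}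
    (hf : SmoothStrip L f) {p : ℝ × ℝ} (hp : p ∈ closedStrip L) :
    HasFDerivWithinAt f (fderivWithin ℝ f (closedStrip L) p) (closedStrip L) p :=
  ((hf p hp).differentiableWithinAt (by simp)).hasFDerivWithinAt

theorem SmoothStrip.dx_eq_fderivWithin {L : ℝ} (hL : 0 < L) {f : ℝ × ℝ → ℝ}
    (hf : SmoothStrip L f) {p : ℝ × ℝ} (hp : p ∈ closedStrip L) :
    dx L f p = fderivWithin ℝ f (closedStrip L) p (1, 0) :=
  (hasDerivWithinAt_horizontal hp (hf.hasFDerivWithinAt hp)).derivWithin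
    (uniqueDiffOn_Icc hL _ hp.1)

theorem SmoothStrip.dY_eq_fderivWithin {L : ℝ} {f : ℝ × ℝ → ℝ}
    (hf : SmoothStrip L f) {p : ℝ × ℝ} (hp : p ∈ closedStrip L) :
    dY f p = fderivWithin ℝ f (closedStrip L) p (0, 1) :=
  (hasDerivWithinAt_vertical hp (hf.hasFDerivWithinAt hp)).derivWithin (uniqueDiffOn_Ici 0 _ hp.2)

theorem SmoothStrip.hasDx {L : ℝ} (hL : 0 < L) {f : ℝ × ℝ → ℝ} (hf : SmoothStrip L f) :
    HasDx L f (dx L f) := fun p hp => by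
  rw [hf.dx_eq_fderivWithin hL hp]
  exact hasDerivWithinAt_horizontal hp (hf.hasFDerivWithinAt hp)

theorem SmoothStrip.hasDY {L : ℝ} {f : ℝ × ℝ → ℝ} (hf : SmoothStrip L f) :
    HasDY L f (dY f) := fun p hp => by
  rw [hf.dY_eq_fderivWithin hp]
  exact hasDerivWithinAt_vertical hp (hf.hasFDerivWithinAt hp)

theorem SmoothStrip.fderivWithin_apply {L : ℝ} (hL : 0 < L) {f : ℝ × ℝ → ℝ}
    (hf : SmoothStrip L f) (v : ℝ × ℝ) :
    SmoothStrip L (fun p => fderivWithin ℝ f (closedStrip L) p v) :=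
  (hf.fderivWithin (m := ∞) (uniqueDiffOn_closedStrip hL) (by simp)).clm_apply contDiffOn_const

theorem SmoothStrip.congr {L : ℝ} {f g : ℝ × ℝ → ℝ} (hf : SmoothStrip L f)
    (h : EqOn g f (closedStrip L)) : SmoothStrip L g := ContDiffOn.congr hf h

theorem SmoothStrip.dx {L : ℝ} (hL : 0 < L) {f : ℝ × ℝ → ℝ} (hf : SmoothStrip L f) :
    SmoothStrip L (dx L f) :=
  (hf.fderivWithin_apply hL (1, 0)).congr fun _ hp => hf.dx_eq_fderivWithin hL hp

theorem SmoothStrip.dY {L : ℝ} (hL : 0 < L) {f : ℝ × ℝ → ℝ} (hf : SmoothStrip L f) :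
    SmoothStrip L (dY f) :=
  (hf.fderivWithin_apply hL (0, 1)).congr fun _ hp => hf.dY_eq_fderivWithin hp

theorem SmoothStrip.dx_iterate {L : ℝ} (hL : 0 < L) {f : ℝ × ℝ → ℝ} (hf : SmoothStrip L f)
    (j : ℕ) : SmoothStrip L ((EulerLayer.dx L)^[j] f) := by
  induction j with
  | zero => exact hf
  | succ j ih => simpa only [Function.iterate_succ_apply'] using ih.dx hL

theorem SmoothStrip.dY_iterate {L : ℝ} (hL : 0 < L) {f : ℝ × ℝ → ℝ} (hf : SmoothStrip L f)
    (j : ℕ) : SmoothStrip L (EulerLayer.dY^[j] f) := by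
  induction j with
  | zero => exact hf
  | succ j ih => simpa only [Function.iterate_succ_apply'] using ih.dY hL

/-- Every point of the closed strip is a limit of interior points, so the second derivative within
the strip is symmetric even on the boundary; both iterated partials are values of this bilinear
form. -/
theorem SmoothStrip.dx_dY {L : ℝ} (hL : 0 < L) {f : ℝ × ℝ → ℝ} (hf : SmoothStrip L f) :
    EqOn (EulerLayer.dx L (EulerLayer.dY f)) (EulerLayer.dY (EulerLayer.dx L f))
      (closedStrip L) := by
  intro p hp
  have hu := uniqueDiffOn_closedStrip hL
  have hsymm : IsSymmSndFDerivWithinAt ℝ f (closedStrip L) p := by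
    refine ContDiffWithinAt.isSymmSndFDerivWithinAt (n := ∞) (hf p hp) ?_ hu ?_ hp
    · rw [minSmoothness_of_isRCLikeNormedField]
      exact WithTop.coe_le_coe.2 le_top
    · rw [interior_closedStrip, closure_strip hL]; exact hp
  have hd : HasFDerivWithinAt (fderivWithin ℝ f (closedStrip L))
      (fderivWithin ℝ (fderivWithin ℝ f (closedStrip L)) (closedStrip L) p) (closedStrip L) p :=
    (((hf.fderivWithin (m := ∞) hu (by simp)) p hp).differentiableWithinAt
      (by simp)).hasFDerivWithinAt
  have key : ∀ v w : ℝ × ℝ, fderivWithin ℝ (fun r => fderivWithin ℝ f (closedStrip L) r v)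
      (closedStrip L) p w =
      fderivWithin ℝ (fderivWithin ℝ f (closedStrip L)) (closedStrip L) p w v := by
    intro v w
    have := hd.clm_apply (hasFDerivWithinAt_const v p (closedStrip L))
    rw [this.fderivWithin (hu p hp)]
    simp
  have e1 : EulerLayer.dx L (EulerLayer.dY f) p =
      EulerLayer.dx L (fun r => fderivWithin ℝ f (closedStrip L) r (0, 1)) p :=
    dx_congr (fun r hr => hf.dY_eq_fderivWithin hr) hp
  have e2 : EulerLayer.dY (EulerLayer.dx L f) p =
      EulerLayer.dY (fun r => fderivWithin ℝ f (closedStrip L) r (1, 0)) p :=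
    dY_congr (fun r hr => hf.dx_eq_fderivWithin hL hr) hp
  rw [e1, e2, (hf.fderivWithin_apply hL _).dx_eq_fderivWithin hL hp,
    (hf.fderivWithin_apply hL _).dY_eq_fderivWithin hp, key, key]
  exact hsymm.eq _ _

theorem SmoothStrip.dY_dx_iterate {L : ℝ} (hL : 0 < L) {f : ℝ × ℝ → ℝ} (hf : SmoothStrip L f)
    (j : ℕ) : EqOn (EulerLayer.dY ((EulerLayer.dx L)^[j] f))
      ((EulerLayer.dx L)^[j] (EulerLayer.dY f)) (closedStrip L) := by
  induction j with
  | zero => exact fun _ _ => rfl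
  | succ j ih =>
    intro p hp
    simp only [Function.iterate_succ_apply']
    rw [← (hf.dx_iterate hL j).dx_dY hL hp]
    exact dx_congr ih hp

theorem SmoothStrip.dY_iterate_dx_iterate {L : ℝ} (hL : 0 < L) {f : ℝ × ℝ → ℝ}
    (hf : SmoothStrip L f) (j k : ℕ) : EqOn (EulerLayer.dY^[k] ((EulerLayer.dx L)^[j] f))
      ((EulerLayer.dx L)^[j] (EulerLayer.dY^[k] f)) (closedStrip L) := by
  induction k with
  | zero => exact fun _ _ => rfl
  | succ k ih =>
    intro p hp
    simp only [Function.iterate_succ_apply']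
    rw [← (hf.dY_iterate hL k).dY_dx_iterate hL j hp]
    exact dY_congr ih hp

theorem abs_sub_le_of_hasDerivWithinAt {g g' : ℝ → ℝ} {s : Set ℝ} {C c x y : ℝ}
    (hs : Convex ℝ s) (h : ∀ z ∈ s, HasDerivWithinAt g (g' z) s z)
    (hb : ∀ z ∈ s, |g' z - c| ≤ C) (hx : x ∈ s) (hy : y ∈ s) :
    |g y - g x - c * (y - x)| ≤ C * |y - x| := by
  have := hs.norm_image_sub_le_of_norm_hasDerivWithin_le (f := fun z => g z - c * z)
    (f' := fun z => g' z - c) (C := C)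
    (fun z hz => ((h z hz).sub ((hasDerivWithinAt_id z s).const_mul c)).congr_deriv (by ring))
    (fun z hz => hb z hz) hx hy
  simp only [Real.norm_eq_abs] at this
  convert this using 2
  ring

/-- The increment from `p` to `r` is split at `(p.1, r.2)`. Both legs stay in the strip because it
is a product, and the mean value inequality applies to each. -/
theorem hasFDerivWithinAt_of_partials {L : ℝ} {f fx fy : ℝ × ℝ → ℝ} (hx : HasDx L f fx)
    (hy : HasDY L f fy) (cx : ContinuousOn fx (closedStrip L))
    (cy : ContinuousOn fy (closedStrip L)) {p : ℝ × ℝ} (hp : p ∈ closedStrip L) :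
    HasFDerivWithinAt f (fx p • ContinuousLinearMap.fst ℝ ℝ ℝ
      + fy p • ContinuousLinearMap.snd ℝ ℝ ℝ) (closedStrip L) p := by
  rw [hasFDerivWithinAt_iff_isLittleO, Asymptotics.isLittleO_iff]
  intro ε hε
  obtain ⟨δ₁, hδ₁, h1⟩ := Metric.continuousWithinAt_iff.1 (cx p hp) (ε / 2) (by positivity)
  obtain ⟨δ₂, hδ₂, h2⟩ := Metric.continuousWithinAt_iff.1 (cy p hp) (ε / 2) (by positivity)
  have hmem : Metric.ball p (min δ₁ δ₂) ∈ 𝓝[closedStrip L] p :=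
    mem_nhdsWithin_of_mem_nhds (Metric.ball_mem_nhds _ (lt_min hδ₁ hδ₂))
  filter_upwards [hmem, self_mem_nhdsWithin] with r hr hrS
  rw [Metric.mem_ball, Prod.dist_eq, max_lt_iff] at hr
  set δ := min δ₁ δ₂
  have b1 : |f (r.1, r.2) - f (p.1, r.2) - fx p * (r.1 - p.1)| ≤ ε / 2 * |r.1 - p.1| := by
    refine abs_sub_le_of_hasDerivWithinAt (g := fun s => f (s, r.2)) (g' := fun s => fx (s, r.2))
      (s := Icc 0 L ∩ Metric.ball p.1 δ) ((convex_Icc 0 L).inter (convex_ball _ _)) ?_ ?_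
      ⟨hp.1, Metric.mem_ball_self (lt_min hδ₁ hδ₂)⟩ ⟨hrS.1, hr.1⟩
    · exact fun z hz => (hx (z, r.2) ⟨hz.1, hrS.2⟩).mono inter_subset_left
    · intro z hz
      refine (h1 (x := (z, r.2)) ⟨hz.1, hrS.2⟩ ?_).le
      rw [Prod.dist_eq]
      exact (max_lt hz.2 hr.2).trans_le (min_le_left _ _)
  have b2 : |f (p.1, r.2) - f (p.1, p.2) - fy p * (r.2 - p.2)| ≤ ε / 2 * |r.2 - p.2| := by
    refine abs_sub_le_of_hasDerivWithinAt (g := fun s => f (p.1, s)) (g' := fun s => fy (p.1, s))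
      (s := Ici 0 ∩ Metric.ball p.2 δ) ((convex_Ici 0).inter (convex_ball _ _)) ?_ ?_
      ⟨hp.2, Metric.mem_ball_self (lt_min hδ₁ hδ₂)⟩ ⟨hrS.2, hr.2⟩
    · exact fun z hz => (hy (p.1, z) ⟨hp.1, hz.1⟩).mono inter_subset_left
    · intro z hz
      refine (h2 (x := (p.1, z)) ⟨hp.1, hz.1⟩ ?_).le
      rw [Prod.dist_eq]
      simp only [dist_self]
      exact (max_lt (lt_min hδ₁ hδ₂) hz.2).trans_le (min_le_right _ _)
  have n1 : |r.1 - p.1| ≤ ‖r - p‖ := norm_fst_le (r - p)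
  have n2 : |r.2 - p.2| ≤ ‖r - p‖ := norm_snd_le (r - p)
  have e : f r - f p - (fx p • ContinuousLinearMap.fst ℝ ℝ ℝ
      + fy p • ContinuousLinearMap.snd ℝ ℝ ℝ) (r - p) =
      (f (r.1, r.2) - f (p.1, r.2) - fx p * (r.1 - p.1)) +
      (f (p.1, r.2) - f (p.1, p.2) - fy p * (r.2 - p.2)) := by
    simp; ring
  rw [e, Real.norm_eq_abs]
  refine (abs_add_le _ _).trans ((add_le_add b1 b2).trans ?_)
  nlinarith

/-- One step of every later bootstrap: regularity is gained from formulas for the two partials. -/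
theorem contDiffOn_succ_of_partials {L : ℝ} (hL : 0 < L) {f fx fy : ℝ × ℝ → ℝ} (n : ℕ)
    (hx : HasDx L f fx) (hy : HasDY L f fy) (cx : ContDiffOn ℝ n fx (closedStrip L))
    (cy : ContDiffOn ℝ n fy (closedStrip L)) :
    ContDiffOn ℝ (n + 1 : ℕ) f (closedStrip L) := by
  push_cast
  rw [contDiffOn_succ_iff_hasFDerivWithinAt_of_uniqueDiffOn (uniqueDiffOn_closedStrip hL)]
  refine ⟨by simp, _, ?_, fun p hp =>
    hasFDerivWithinAt_of_partials hx hy cx.continuousOn cy.continuousOn hp⟩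
  exact (cx.smul contDiffOn_const).add (cy.smul contDiffOn_const)

theorem smoothStrip_of_partials {L : ℝ} (hL : 0 < L) {f fx fy : ℝ × ℝ → ℝ}
    (hx : HasDx L f fx) (hy : HasDY L f fy) (cx : SmoothStrip L fx) (cy : SmoothStrip L fy) :
    SmoothStrip L f := by
  refine contDiffOn_infty.2 fun n => ?_
  exact (contDiffOn_succ_of_partials hL n hx hy (contDiffOn_infty.1 cx n)
    (contDiffOn_infty.1 cy n)).of_le (by exact_mod_cast n.le_succ)

theorem continuousOn_horizontal {L : ℝ} {f : ℝ × ℝ → ℝ} (hf : ContinuousOn f (closedStrip L))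
    {Y : ℝ} (hY : 0 ≤ Y) : ContinuousOn (fun s => f (s, Y)) (Icc 0 L) :=
  hf.comp (by fun_prop) fun _ hs => ⟨hs, hY⟩

theorem continuousOn_vertical {L : ℝ} {f : ℝ × ℝ → ℝ} (hf : ContinuousOn f (closedStrip L))
    {x : ℝ} (hx : x ∈ Icc 0 L) : ContinuousOn (fun t => f (x, t)) (Ici 0) :=
  hf.comp (by fun_prop) fun _ hs => ⟨hx, hs⟩

theorem SmoothStrip.add {L : ℝ} {f g : ℝ × ℝ → ℝ} (hf : SmoothStrip L f) (hg : SmoothStrip L g) :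
    SmoothStrip L (fun p => f p + g p) := ContDiffOn.add hf hg

theorem SmoothStrip.sub {L : ℝ} {f g : ℝ × ℝ → ℝ} (hf : SmoothStrip L f) (hg : SmoothStrip L g) :
    SmoothStrip L (fun p => f p - g p) := ContDiffOn.sub hf hg

theorem SmoothStrip.mul {L : ℝ} {f g : ℝ × ℝ → ℝ} (hf : SmoothStrip L f) (hg : SmoothStrip L g) :
    SmoothStrip L (fun p => f p * g p) := ContDiffOn.mul hf hg

theorem SmoothStrip.neg {L : ℝ} {f : ℝ × ℝ → ℝ} (hf : SmoothStrip L f) :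
    SmoothStrip L (fun p => -f p) := ContDiffOn.neg hf

theorem smoothStrip_snd {L : ℝ} {h : ℝ → ℝ} (hh : ContDiffOn ℝ ∞ h (Ici 0)) :
    SmoothStrip L (fun p => h p.2) :=
  ContDiffOn.comp hh contDiffOn_snd fun _ hp => hp.2

theorem SmoothStrip.trace {L : ℝ} {f : ℝ × ℝ → ℝ} (hf : SmoothStrip L f) {x₀ : ℝ}
    (hx₀ : x₀ ∈ Icc 0 L) : SmoothStrip L (fun p => f (x₀, p.2)) :=
  ContDiffOn.comp hf (contDiffOn_const.prodMk contDiffOn_snd) fun _ hp => ⟨hx₀, hp.2⟩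

theorem HasDx.add {L : ℝ} {f g f' g' : ℝ × ℝ → ℝ} (hf : HasDx L f f') (hg : HasDx L g g') :
    HasDx L (fun p => f p + g p) (fun p => f' p + g' p) := fun p hp => (hf p hp).add (hg p hp)

theorem HasDx.sub {L : ℝ} {f g f' g' : ℝ × ℝ → ℝ} (hf : HasDx L f f') (hg : HasDx L g g') :
    HasDx L (fun p => f p - g p) (fun p => f' p - g' p) := fun p hp => (hf p hp).sub (hg p hp)

theorem HasDx.mul {L : ℝ} {f g f' g' : ℝ × ℝ → ℝ} (hf : HasDx L f f') (hg : HasDx L g g') :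
    HasDx L (fun p => f p * g p) (fun p => f' p * g p + f p * g' p) :=
  fun p hp => (hf p hp).mul (hg p hp)

theorem HasDx.neg {L : ℝ} {f f' : ℝ × ℝ → ℝ} (hf : HasDx L f f') :
    HasDx L (fun p => -f p) (fun p => -f' p) := fun p hp => (hf p hp).neg

theorem HasDY.add {L : ℝ} {f g f' g' : ℝ × ℝ → ℝ} (hf : HasDY L f f') (hg : HasDY L g g') :
    HasDY L (fun p => f p + g p) (fun p => f' p + g' p) := fun p hp => (hf p hp).add (hg p hp)

theorem HasDY.sub {L : ℝ} {f g f' g' : ℝ × ℝ → ℝ} (hf : HasDY L f f') (hg : HasDY L g g') :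
    HasDY L (fun p => f p - g p) (fun p => f' p - g' p) := fun p hp => (hf p hp).sub (hg p hp)

theorem HasDY.mul {L : ℝ} {f g f' g' : ℝ × ℝ → ℝ} (hf : HasDY L f f') (hg : HasDY L g g') :
    HasDY L (fun p => f p * g p) (fun p => f' p * g p + f p * g' p) :=
  fun p hp => (hf p hp).mul (hg p hp)

theorem HasDY.neg {L : ℝ} {f f' : ℝ × ℝ → ℝ} (hf : HasDY L f f') :
    HasDY L (fun p => -f p) (fun p => -f' p) := fun p hp => (hf p hp).neg

theorem hasDx_snd (L : ℝ) (h : ℝ → ℝ) : HasDx L (fun p => h p.2) (fun _ => 0) :=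
  fun p _ => hasDerivWithinAt_const p.1 (Icc 0 L) (h p.2)

theorem hasDY_snd (L : ℝ) {h h' : ℝ → ℝ} (hh : ∀ Y, 0 ≤ Y → HasDerivWithinAt h (h' Y) (Ici 0) Y) :
    HasDY L (fun p => h p.2) (fun p => h' p.2) :=
  fun p hp => hh p.2 hp.2

theorem dY_iterate_snd (h : ℝ → ℝ) (k : ℕ) :
    dY^[k] (fun p => h p.2) = fun p => dHalf k h p.2 := by
  induction k with
  | zero => ext p; simp [dHalf]
  | succ k ih =>
    rw [Function.iterate_succ_apply', ih]
    ext p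
    simp only [dY, dHalf, iteratedDerivWithin_succ]

theorem dY_iterate_eq_iteratedDerivWithin (f : ℝ × ℝ → ℝ) (k : ℕ) (p : ℝ × ℝ) :
    dY^[k] f p = iteratedDerivWithin k (fun t => f (p.1, t)) (Ici 0) p.2 := by
  induction k generalizing p with
  | zero => simp
  | succ k ih =>
    rw [Function.iterate_succ_apply', iteratedDerivWithin_succ]
    simp only [dY]
    congr 1
    ext t
    exact ih (p.1, t)

/-! ### Maximum principles on a thin strip -/

/-- `g` is differentiable near `x` and has second derivative `c` at `x`. -/
def HasD2At (g : ℝ → ℝ) (c x : ℝ) : Prop :=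
  ∃ g' : ℝ → ℝ, (∀ᶠ s in 𝓝 x, HasDerivAt g (g' s) s) ∧ HasDerivAt g' c x

theorem HasD2At.add {f g : ℝ → ℝ} {a b x : ℝ} (hf : HasD2At f a x) (hg : HasD2At g b x) :
    HasD2At (fun s => f s + g s) (a + b) x := by
  obtain ⟨f', h1, h2⟩ := hf
  obtain ⟨g', h3, h4⟩ := hg
  exact ⟨fun s => f' s + g' s, by filter_upwards [h1, h3] with s a b using a.add b, h2.add h4⟩

theorem HasD2At.const_mul {f : ℝ → ℝ} {a x : ℝ} (c : ℝ) (hf : HasD2At f a x) :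
    HasD2At (fun s => c * f s) (c * a) x := by
  obtain ⟨f', h1, h2⟩ := hf
  exact ⟨fun s => c * f' s, by filter_upwards [h1] with s a using a.const_mul c, h2.const_mul c⟩

theorem HasD2At.mul_const {f : ℝ → ℝ} {a x : ℝ} (hf : HasD2At f a x) (c : ℝ) :
    HasD2At (fun s => f s * c) (a * c) x := by
  simpa only [mul_comm] using hf.const_mul c

theorem HasD2At.neg {f : ℝ → ℝ} {a x : ℝ} (hf : HasD2At f a x) :
    HasD2At (fun s => -f s) (-a) x := by simpa using hf.const_mul (-1)

theorem HasD2At.sub {f g : ℝ → ℝ} {a b x : ℝ} (hf : HasD2At f a x) (hg : HasD2At g b x) :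
    HasD2At (fun s => f s - g s) (a - b) x := by
  simpa only [sub_eq_add_neg] using hf.add hg.neg

theorem HasD2At.of_hasDerivWithinAt {s : Set ℝ} {g g' g'' : ℝ → ℝ}
    (h1 : ∀ z ∈ s, HasDerivWithinAt g (g' z) s z) (h2 : ∀ z ∈ s, HasDerivWithinAt g' (g'' z) s z)
    {x : ℝ} (hx : s ∈ 𝓝 x) : HasD2At g (g'' x) x := by
  refine ⟨g', ?_, (h2 x (mem_of_mem_nhds hx)).hasDerivAt hx⟩
  filter_upwards [eventually_mem_nhds_iff.2 hx] with z hz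
  exact (h1 z (mem_of_mem_nhds hz)).hasDerivAt hz

/-- If `c < 0`, the second derivative test would make `x` a local maximum as well, so `g` would be
locally constant and `c` would be zero. -/
theorem HasD2At.nonneg_of_isLocalMin {g : ℝ → ℝ} {c x : ℝ} (h : HasD2At g c x)
    (hm : IsLocalMin g x) : 0 ≤ c := by
  obtain ⟨g', h1, h2⟩ := h
  by_contra! hc
  have e1 : deriv g =ᶠ[𝓝 x] g' := h1.mono fun s hs => hs.deriv
  have e2 : deriv (deriv g) x = c := by rw [e1.deriv_eq]; exact h2.deriv
  have e3 : deriv g x = 0 := hm.deriv_eq_zero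
  have hM := isLocalMax_of_deriv_deriv_neg (by rw [e2]; exact hc) e3 h1.self_of_nhds.continuousAt
  have hconst : g =ᶠ[𝓝 x] fun _ => g x := by
    filter_upwards [hm, hM] with s a b using le_antisymm b a
  have : deriv (deriv g) x = 0 := by
    have h3 : deriv g =ᶠ[𝓝 x] fun _ => 0 := by
      filter_upwards [hconst.deriv] with s hs
      rw [hs]; simp
    rw [h3.deriv_eq]; simp
  rw [e2] at this
  exact hc.ne this

theorem hasD2At_quadratic (K x : ℝ) : HasD2At (fun s => 2 - K * s ^ 2) (-(2 * K)) x :=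
  ⟨fun s => -(2 * K) * s, Eventually.of_forall fun s =>
    (((hasDerivAt_pow 2 s).const_mul K).const_sub 2).congr_deriv (by simp; ring),
    ((hasDerivAt_id x).const_mul _).congr_deriv (by simp)⟩

theorem hasD2At_affine (x : ℝ) : HasD2At (fun s => 1 + s) 0 x :=
  ⟨fun _ => 1, Eventually.of_forall fun s => (hasDerivAt_id s).const_add 1, hasDerivAt_const _ _⟩

theorem barrier_bounds {K L x : ℝ} (hK : 0 ≤ K) (hKL : K * L ^ 2 ≤ 1) (hx : x ∈ Icc 0 L) :
    1 ≤ 2 - K * x ^ 2 ∧ 2 - K * x ^ 2 ≤ 2 := by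
  have h1 : x ^ 2 ≤ L ^ 2 := pow_le_pow_left₀ hx.1 hx.2 2
  have h2 : K * x ^ 2 ≤ K * L ^ 2 := mul_le_mul_of_nonneg_left h1 hK
  have h3 : 0 ≤ K * x ^ 2 := by positivity
  constructor <;> linarith

/-- Minimum principle for `-Δ + q` on a thin strip, for functions bounded below. -/
theorem nonneg_of_supersolution {L K Q : ℝ} (hQ : 0 ≤ Q) (hK : Q < K)
    (hKL : K * L ^ 2 ≤ 1) {q : ℝ → ℝ} (hq : ∀ Y, 0 ≤ Y → |q Y| ≤ Q) {h hxx hyy : ℝ × ℝ → ℝ}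
    (hc : ContinuousOn h (closedStrip L)) (hb : ∃ C, ∀ p ∈ closedStrip L, -C ≤ h p)
    (hx : ∀ p ∈ strip L, HasD2At (fun s => h (s, p.2)) (hxx p) p.1)
    (hy : ∀ p ∈ strip L, HasD2At (fun t => h (p.1, t)) (hyy p) p.2)
    (hpde : ∀ p ∈ strip L, 0 ≤ -(hxx p + hyy p) + q p.2 * h p)
    (hbot : ∀ x ∈ Icc 0 L, 0 ≤ h (x, 0)) (hleft : ∀ Y, 0 ≤ Y → 0 ≤ h (0, Y))
    (hright : ∀ Y, 0 ≤ Y → 0 ≤ h (L, Y)) : ∀ p ∈ closedStrip L, 0 ≤ h p := by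
  intro p₁ hp₁
  by_contra! hneg
  obtain ⟨C₀, hC₀⟩ := hb
  set C := max C₀ 1
  have hC : ∀ p ∈ closedStrip L, -C ≤ h p := fun p hp =>
    (neg_le_neg (le_max_left _ _)).trans (hC₀ p hp)
  have hCpos : 0 < C := lt_of_lt_of_le one_pos (le_max_right _ _)
  have hK0 : 0 < K := hQ.trans_lt hK
  -- Concavity in x absorbs `q`. The factor `1 + Y` makes `Φ` unbounded, so that a negative infimum
  -- of `h / Φ` is attained, and it contributes no second derivative in Y.
  set Φ : ℝ × ℝ → ℝ := fun p => (2 - K * p.1 ^ 2) * (1 + p.2) with hΦ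
  have hΦ1 : ∀ p ∈ closedStrip L, 1 + p.2 ≤ Φ p := fun p hp => by
    have h2 : (0 : ℝ) ≤ p.2 := hp.2
    have := (barrier_bounds hK0.le hKL hp.1).1
    simp only [hΦ]; nlinarith
  have hΦ2 : ∀ p ∈ closedStrip L, Φ p ≤ 2 * (1 + p.2) := fun p hp => by
    have h2 : (0 : ℝ) ≤ p.2 := hp.2
    have := (barrier_bounds hK0.le hKL hp.1).2
    simp only [hΦ]; nlinarith
  have hΦ0 : ∀ p ∈ closedStrip L, 0 < Φ p := fun p hp => by
    have h2 : (0 : ℝ) ≤ p.2 := hp.2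
    linarith [hΦ1 p hp]
  set ρ : ℝ × ℝ → ℝ := fun p => h p / Φ p
  have hρc : ContinuousOn ρ (closedStrip L) :=
    hc.div (by simp only [hΦ]; fun_prop) fun p hp => (hΦ0 p hp).ne'
  have hρ1 : ρ p₁ < 0 := div_neg_of_neg_of_pos hneg (hΦ0 p₁ hp₁)
  -- Above this height `h / Φ ≥ -C / (1 + Y)` exceeds `ρ p₁`, so the minimum over a compact
  -- rectangle is a global one.
  set R := max (C / -ρ p₁) p₁.2
  have hcomp : IsCompact (Icc 0 L ×ˢ Icc 0 R) := isCompact_Icc.prod isCompact_Icc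
  have hsub : Icc 0 L ×ˢ Icc 0 R ⊆ closedStrip L := prod_mono le_rfl fun y hy => hy.1
  obtain ⟨p₀, hp₀, hmin⟩ := hcomp.exists_isMinOn ⟨p₁, hp₁.1, hp₁.2, le_max_right _ _⟩
    (hρc.mono hsub)
  have hp₀S := hsub hp₀
  have h01 : ρ p₀ ≤ ρ p₁ := hmin ⟨hp₁.1, hp₁.2, le_max_right _ _⟩
  have hglob : ∀ p ∈ closedStrip L, ρ p₀ ≤ ρ p := by
    intro p hp
    by_cases hpR : p.2 ≤ R
    · exact hmin ⟨hp.1, hp.2, hpR⟩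
    · push Not at hpR
      have h2 : (0 : ℝ) ≤ p.2 := hp.2
      refine h01.trans ?_
      have h3 : C / -ρ p₁ < p.2 := (le_max_left _ _).trans_lt hpR
      rw [div_lt_iff₀ (by linarith)] at h3
      rw [le_div_iff₀ (hΦ0 p hp)]
      nlinarith [hΦ1 p hp, hC p hp]
  have hp₀neg : h p₀ < 0 := by
    have : ρ p₀ < 0 := h01.trans_lt hρ1
    by_contra! h0
    exact absurd (div_nonneg h0 (hΦ0 p₀ hp₀S).le) (not_le.2 this)
  have hp₀strip : p₀ ∈ strip L := by
    obtain ⟨⟨a, b⟩, c⟩ := hp₀S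
    have c' : (0 : ℝ) ≤ p₀.2 := c
    refine ⟨⟨lt_of_le_of_ne a ?_, lt_of_le_of_ne b ?_⟩, lt_of_le_of_ne c' ?_⟩ <;> intro e
    · have := hleft p₀.2 c
      have e' : p₀ = (0, p₀.2) := Prod.ext e.symm rfl
      rw [← e'] at this; exact absurd this (not_le.2 hp₀neg)
    · have := hright p₀.2 c
      rw [← e] at this; exact absurd this (not_le.2 hp₀neg)
    · have := hbot p₀.1 ⟨a, b⟩
      have e' : p₀ = (p₀.1, 0) := Prod.ext rfl e.symm
      rw [← e'] at this; exact absurd this (not_le.2 hp₀neg)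
  -- The function `h + μ Φ` is nonnegative and vanishes at `p₀`, so there `hxx ≥ 2 K μ (1 + Y)` and
  -- `hyy ≥ 0`, while `q h ≤ 2 Q μ (1 + Y)`. The supersolution inequality would then force `K ≤ Q`.
  set μ := -ρ p₀
  have hμ : 0 < μ := by have := h01.trans_lt hρ1; simp only [μ]; linarith
  have hk : ∀ p ∈ closedStrip L, 0 ≤ h p + μ * Φ p := fun p hp => by
    have := hglob p hp
    rw [le_div_iff₀ (hΦ0 p hp)] at this
    simp only [μ]; linarith
  have hk0 : h p₀ + μ * Φ p₀ = 0 := by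
    have : ρ p₀ * Φ p₀ = h p₀ := div_mul_cancel₀ _ (hΦ0 p₀ hp₀S).ne'
    simp only [μ]; linarith
  have hnx : ∀ᶠ s in 𝓝 p₀.1, (s, p₀.2) ∈ closedStrip L := by
    filter_upwards [Ioo_mem_nhds hp₀strip.1.1 hp₀strip.1.2] with s hs
    exact ⟨Ioo_subset_Icc_self hs, hp₀S.2⟩
  have hny : ∀ᶠ s in 𝓝 p₀.2, (p₀.1, s) ∈ closedStrip L := by
    filter_upwards [Ioi_mem_nhds hp₀strip.2] with s hs
    exact ⟨hp₀S.1, (mem_Ioi.1 hs).le⟩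
  have hxx0 := ((hx p₀ hp₀strip).add
    (((hasD2At_quadratic K p₀.1).mul_const (1 + p₀.2)).const_mul μ)).nonneg_of_isLocalMin (by
      filter_upwards [hnx] with s hs
      have := hk _ hs
      simp only [hΦ] at this hk0
      linarith)
  have hyy0 := ((hy p₀ hp₀strip).add
    (((hasD2At_affine p₀.2).const_mul (2 - K * p₀.1 ^ 2)).const_mul μ)).nonneg_of_isLocalMin (by
      filter_upwards [hny] with s hs
      have := hk _ hs
      simp only [hΦ] at this hk0
      linarith)
  have hpd := hpde p₀ hp₀strip
  have hY : (0 : ℝ) < p₀.2 := hp₀strip.2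
  have hqh : q p₀.2 * h p₀ ≤ Q * (μ * (2 * (1 + p₀.2))) := by
    calc q p₀.2 * h p₀ ≤ |q p₀.2 * h p₀| := le_abs_self _
      _ = |q p₀.2| * (-h p₀) := by rw [abs_mul, abs_of_neg hp₀neg]
      _ ≤ Q * (μ * (2 * (1 + p₀.2))) := by
        refine mul_le_mul (hq _ hY.le) ?_ (by linarith) hQ
        have := mul_le_mul_of_nonneg_left (hΦ2 p₀ hp₀S) hμ.le
        linarith
  have : 0 < (K - Q) * (μ * (1 + p₀.2)) := by
    have := sub_pos.2 hK
    positivity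
  nlinarith

theorem eq_zero_of_homogeneous {L K Q : ℝ} (hQ : 0 ≤ Q) (hK : Q < K)
    (hKL : K * L ^ 2 ≤ 1) {q : ℝ → ℝ} (hq : ∀ Y, 0 ≤ Y → |q Y| ≤ Q) {h hxx hyy : ℝ × ℝ → ℝ}
    (hc : ContinuousOn h (closedStrip L)) (hb : ∃ C, ∀ p ∈ closedStrip L, |h p| ≤ C)
    (hx : ∀ p ∈ strip L, HasD2At (fun s => h (s, p.2)) (hxx p) p.1)
    (hy : ∀ p ∈ strip L, HasD2At (fun t => h (p.1, t)) (hyy p) p.2)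
    (hpde : ∀ p ∈ strip L, -(hxx p + hyy p) + q p.2 * h p = 0)
    (hbot : ∀ x ∈ Icc 0 L, h (x, 0) = 0) (hleft : ∀ Y, 0 ≤ Y → h (0, Y) = 0)
    (hright : ∀ Y, 0 ≤ Y → h (L, Y) = 0) : ∀ p ∈ closedStrip L, h p = 0 := by
  obtain ⟨C, hC⟩ := hb
  intro p hp
  refine le_antisymm ?_ ?_
  · have := nonneg_of_supersolution hQ hK hKL hq (h := fun p => -h p) (hxx := fun p => -hxx p)
      (hyy := fun p => -hyy p) hc.neg ⟨C, fun p hp => neg_le_neg (abs_le.1 (hC p hp)).2⟩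
      (fun p hp => (hx p hp).neg) (fun p hp => (hy p hp).neg)
      (fun p hp => by have := hpde p hp; linarith)
      (fun x hx => by simp [hbot x hx]) (fun Y hY => by simp [hleft Y hY])
      (fun Y hY => by simp [hright Y hY]) p hp
    linarith
  · exact nonneg_of_supersolution hQ hK hKL hq hc
      ⟨C, fun p hp => (abs_le.1 (hC p hp)).1⟩ hx hy (fun p hp => (hpde p hp).ge)
      (fun x hx => (hbot x hx).ge) (fun Y hY => (hleft Y hY).ge)
      (fun Y hY => (hright Y hY).ge) p hp

/-- Weighted maximum principle for `-Δ + q` on a thin strip. -/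
theorem abs_le_of_weighted_bounds {L K Q c : ℝ} (hQ : 0 ≤ Q) (hc0 : 0 ≤ c)
    (hK : Q + c + 1 ≤ K) (hKL : K * L ^ 2 ≤ 1) {q W W'' : ℝ → ℝ}
    (hq : ∀ Y, 0 ≤ Y → |q Y| ≤ Q)
    (hW : ∀ Y, 0 ≤ Y → 0 < W Y) (hWc : ContinuousOn W (Ici 0))
    (hW2 : ∀ Y, 0 < Y → HasD2At W (W'' Y) Y) (hWb : ∀ Y, 0 < Y → W'' Y ≤ c * W Y)
    {A : ℝ} (hA : 0 ≤ A) {v vxx vyy : ℝ × ℝ → ℝ}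
    (hvc : ContinuousOn v (closedStrip L)) (hb : ∃ C, ∀ p ∈ closedStrip L, |v p| ≤ C)
    (hx : ∀ p ∈ strip L, HasD2At (fun s => v (s, p.2)) (vxx p) p.1)
    (hy : ∀ p ∈ strip L, HasD2At (fun t => v (p.1, t)) (vyy p) p.2)
    (hpde : ∀ p ∈ strip L, |-(vxx p + vyy p) + q p.2 * v p| ≤ A * W p.2)
    (hbot : ∀ x ∈ Icc 0 L, |v (x, 0)| ≤ A * W 0) (hleft : ∀ Y, 0 ≤ Y → |v (0, Y)| ≤ A * W Y)
    (hright : ∀ Y, 0 ≤ Y → |v (L, Y)| ≤ A * W Y) :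
    ∀ p ∈ closedStrip L, |v p| ≤ 2 * A * W p.2 := by
  have hK0 : 0 ≤ K := by linarith
  -- Comparison with `A (2 - K x²) W(Y)`: applying `-Δ + q` to it gives at least `2 (K - c - Q) A
  -- W`, which dominates `A W` since `Q + c + 1 ≤ K`. The sign `ε` treats `v` and `-v` together.
  have main : ∀ ε : ℝ, |ε| = 1 → ∀ p ∈ closedStrip L,
      0 ≤ A * ((2 - K * p.1 ^ 2) * W p.2) + ε * v p := by
    intro ε hε
    have hεv : ∀ p, -|v p| ≤ ε * v p := fun p => by
      have := neg_abs_le (ε * v p); rwa [abs_mul, hε, one_mul] at this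
    have hψ : ∀ p ∈ closedStrip L, W p.2 ≤ (2 - K * p.1 ^ 2) * W p.2 := fun p hp => by
      have := (barrier_bounds hK0 hKL hp.1).1
      nlinarith [hW p.2 hp.2]
    have hbdry : ∀ p ∈ closedStrip L, |v p| ≤ A * W p.2 →
        0 ≤ A * ((2 - K * p.1 ^ 2) * W p.2) + ε * v p := fun p hp hv => by
      have := mul_le_mul_of_nonneg_left (hψ p hp) hA
      linarith [hεv p]
    refine nonneg_of_supersolution hQ (by linarith) hKL hq
      (hxx := fun p => A * (-(2 * K) * W p.2) + ε * vxx p)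
      (hyy := fun p => A * ((2 - K * p.1 ^ 2) * W'' p.2) + ε * vyy p) ?_ ?_ ?_ ?_ ?_ ?_ ?_ ?_
    · have : ContinuousOn (fun p : ℝ × ℝ => W p.2) (closedStrip L) :=
        hWc.comp continuousOn_snd fun p hp => hp.2
      fun_prop
    · obtain ⟨C, hC⟩ := hb
      refine ⟨C, fun p hp => ?_⟩
      have h1 : 0 ≤ A * ((2 - K * p.1 ^ 2) * W p.2) :=
        mul_nonneg hA ((hW _ hp.2).le.trans (hψ p hp))
      linarith [hC p hp, hεv p]
    · exact fun p hp =>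
        (((hasD2At_quadratic K p.1).mul_const (W p.2)).const_mul A).add ((hx p hp).const_mul ε)
    · exact fun p hp =>
        (((hW2 p.2 hp.2).const_mul (2 - K * p.1 ^ 2)).const_mul A).add ((hy p hp).const_mul ε)
    · intro p hp
      have hpS := strip_subset_closedStrip L hp
      obtain ⟨b1, b2⟩ := barrier_bounds hK0 hKL hpS.1
      have hWp := hW p.2 hpS.2
      set φ := 2 - K * p.1 ^ 2
      have e1 : φ * W'' p.2 ≤ 2 * c * W p.2 := by
        calc φ * W'' p.2 ≤ φ * (c * W p.2) := mul_le_mul_of_nonneg_left (hWb _ hp.2) (by linarith)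
          _ ≤ 2 * (c * W p.2) := mul_le_mul_of_nonneg_right b2 (by positivity)
          _ = _ := by ring
      have e2 : -(2 * Q * W p.2) ≤ q p.2 * (φ * W p.2) := by
        have : |q p.2 * (φ * W p.2)| ≤ Q * (2 * W p.2) := by
          rw [abs_mul, abs_of_nonneg (by positivity : 0 ≤ φ * W p.2)]
          exact mul_le_mul (hq _ hpS.2) (by gcongr) (by positivity) hQ
        linarith [neg_abs_le (q p.2 * (φ * W p.2))]
      have e3 : W p.2 ≤ 2 * K * W p.2 - φ * W'' p.2 + q p.2 * (φ * W p.2) := by nlinarith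
      have e4 := mul_le_mul_of_nonneg_left e3 hA
      have e5 : -(A * W p.2) ≤ ε * (-(vxx p + vyy p) + q p.2 * v p) := by
        have := neg_abs_le (ε * (-(vxx p + vyy p) + q p.2 * v p))
        rw [abs_mul, hε, one_mul] at this
        linarith [hpde p hp]
      linarith
    · intro x hx
      rcases eq_or_ne (Icc (0 : ℝ) L) ∅ with h | h
      · simp [h] at hx
      · exact hbdry (x, 0) ⟨hx, mem_Ici.2 le_rfl⟩ (hbot x hx)
    · intro Y hY
      by_cases hL : 0 ≤ L
      · exact hbdry (0, Y) ⟨⟨le_rfl, hL⟩, hY⟩ (hleft Y hY)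
      · have := mul_nonneg hA (hW Y hY).le
        have h2 := hεv (0, Y)
        have := hleft Y hY
        simp only
        nlinarith
    · intro Y hY
      have h1 : 1 ≤ 2 - K * L ^ 2 := by linarith
      have h2 := hεv (L, Y)
      have := hright Y hY
      have := mul_nonneg hA (hW Y hY).le
      simp only
      nlinarith
  intro p hp
  have h1 := main 1 (by simp) p hp
  have h2 := main (-1) (by simp) p hp
  have h3 : A * ((2 - K * p.1 ^ 2) * W p.2) ≤ 2 * A * W p.2 := by
    have := (barrier_bounds hK0 hKL hp.1).2
    have := mul_nonneg hA (hW p.2 hp.2).le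
    nlinarith
  rw [abs_le]
  constructor <;> linarith

/-- A bounded solution of `d'' = (λ² + q) d` on the half-line with `d(0) = 0` vanishes, when
`λ` is one of the Dirichlet frequencies of the thin interval `(0, L)`. -/
theorem eq_zero_of_halfLine {L K Q : ℝ} (hL : 0 < L) (hQ : 0 ≤ Q) (hK : Q < K)
    (hKL : K * L ^ 2 ≤ 1) {q : ℝ → ℝ} (hq : ∀ Y, 0 ≤ Y → |q Y| ≤ Q) (n : ℕ) (hn : n ≠ 0)
    {d d'' : ℝ → ℝ} (hc : ContinuousOn d (Ici 0)) (hb : ∃ C, ∀ Y, 0 ≤ Y → |d Y| ≤ C)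
    (hd : ∀ Y, 0 < Y → HasD2At d (d'' Y) Y)
    (hode : ∀ Y, 0 < Y → d'' Y = ((n * Real.pi / L) ^ 2 + q Y) * d Y) (h0 : d 0 = 0)
    {Y : ℝ} (hY : 0 ≤ Y) : d Y = 0 := by
  set lam := n * Real.pi / L with hlam
  have hsin : ∀ x : ℝ, HasD2At (fun s => Real.sin (lam * s)) (-(lam ^ 2 * Real.sin (lam * x))) x := by
    intro x
    refine ⟨fun s => lam * Real.cos (lam * s), Eventually.of_forall fun s => ?_, ?_⟩
    · exact (((hasDerivAt_id s).const_mul lam).sin).congr_deriv (by simp; ring)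
    · exact ((((hasDerivAt_id x).const_mul lam).cos).const_mul lam).congr_deriv (by simp; ring)
  -- The product `sin (λ x) d(Y)` is a bounded solution of the homogeneous problem on the strip. It
  -- is evaluated at `x = L / (2 n)`, where the sine equals 1.
  have hz := eq_zero_of_homogeneous hQ hK hKL hq (h := fun p => Real.sin (lam * p.1) * d p.2)
    (hxx := fun p => -(lam ^ 2 * Real.sin (lam * p.1)) * d p.2)
    (hyy := fun p => Real.sin (lam * p.1) * d'' p.2) ?_ ?_ ?_ ?_ ?_ ?_ ?_ ?_
    (L / (2 * n), Y) ⟨⟨by positivity, ?_⟩, hY⟩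
  · have : lam * (L / (2 * n)) = Real.pi / 2 := by
      rw [hlam]; field_simp
    simpa [this] using hz
  · have : ContinuousOn (fun p : ℝ × ℝ => d p.2) (closedStrip L) :=
      hc.comp continuousOn_snd fun p hp => hp.2
    fun_prop
  · obtain ⟨C, hC⟩ := hb
    refine ⟨C, fun p hp => ?_⟩
    rw [abs_mul]
    calc _ ≤ 1 * |d p.2| := mul_le_mul_of_nonneg_right (Real.abs_sin_le_one _) (abs_nonneg _)
      _ ≤ C := by rw [one_mul]; exact hC _ hp.2
  · exact fun p _ => (hsin p.1).mul_const (d p.2)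
  · exact fun p hp => (hd p.2 hp.2).const_mul (Real.sin (lam * p.1))
  · intro p hp
    rw [hode p.2 hp.2]; ring
  · intro x _; simp [h0]
  · intro Y _; simp
  · intro Y _
    have : lam * L = n * Real.pi := by rw [hlam]; field_simp
    simp [this, Real.sin_nat_mul_pi]
  · have : (1 : ℝ) ≤ n := by exact_mod_cast Nat.one_le_iff_ne_zero.2 hn
    exact div_le_self hL.le (by linarith)

/-- Somewhere the derivative equals the slope of the chord, and the bound on `g''` carries this
value to every other point. Used to interpolate first derivatives in both variables. -/
theorem abs_deriv_le_of_second_deriv {a b A₁ A₂ : ℝ} (hab : a < b) {g g' g'' : ℝ → ℝ}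
    (h1 : ∀ x ∈ Icc a b, HasDerivWithinAt g (g' x) (Icc a b) x)
    (h2 : ∀ x ∈ Icc a b, HasDerivWithinAt g' (g'' x) (Icc a b) x)
    (hA₁ : |g b - g a| ≤ A₁ * (b - a)) (hA₂ : ∀ x ∈ Icc a b, |g'' x| ≤ A₂) {x : ℝ}
    (hx : x ∈ Icc a b) : |g' x| ≤ A₁ + A₂ * (b - a) := by
  obtain ⟨ξ, hξ, e⟩ := exists_hasDerivAt_eq_slope g g' hab (fun x hx => (h1 x hx).continuousWithinAt)
    (fun x hx => (h1 x (Ioo_subset_Icc_self hx)).hasDerivAt (Icc_mem_nhds hx.1 hx.2))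
  have hpos : 0 < b - a := sub_pos.2 hab
  have hξ1 : |g' ξ| ≤ A₁ := by
    rw [e, abs_div, abs_of_pos hpos, div_le_iff₀ hpos]; exact hA₁
  have h3 := abs_sub_le_of_hasDerivWithinAt (c := 0) (convex_Icc a b) h2
    (fun z hz => by simpa using hA₂ z hz) (Ioo_subset_Icc_self hξ) hx
  have hA₂0 : 0 ≤ A₂ := (abs_nonneg _).trans (hA₂ x hx)
  have h4 : |x - ξ| ≤ b - a := by
    rw [abs_le]; constructor <;> linarith [hx.1, hx.2, hξ.1, hξ.2]
  have h5 : |g' x - g' ξ| ≤ A₂ * (b - a) := by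
    simpa using h3.trans (mul_le_mul_of_nonneg_left h4 hA₂0)
  have := abs_add_le (g' x - g' ξ) (g' ξ)
  simp only [sub_add_cancel] at this
  linarith

/-! ### The two scales of weights -/

theorem weight_pos (κ : WeightKind) (m : ℝ) {Y : ℝ} (hY : 0 ≤ Y) : 0 < weight κ m Y := by
  cases κ
  · exact Real.rpow_pos_of_pos (by linarith) _
  · exact Real.exp_pos _

theorem weight_neg (κ : WeightKind) (m : ℝ) {Y : ℝ} (hY : 0 ≤ Y) :
    weight κ (-m) Y = (weight κ m Y)⁻¹ := by
  cases κ
  · exact Real.rpow_neg (by linarith) _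
  · simp only [weight]; rw [← Real.exp_neg]; ring_nf

theorem weight_add (κ : WeightKind) (m l : ℝ) {Y : ℝ} (hY : 0 ≤ Y) :
    weight κ (m + l) Y = weight κ m Y * weight κ l Y := by
  cases κ
  · exact Real.rpow_add (by linarith) _ _
  · simp only [weight]; rw [← Real.exp_add]; ring_nf

theorem weight_zero (κ : WeightKind) (m : ℝ) : weight κ m 0 = 1 := by
  cases κ <;> simp [weight]

theorem weight_mono_exponent (κ : WeightKind) {m l : ℝ} (h : m ≤ l) {Y : ℝ} (hY : 0 ≤ Y) :
    weight κ m Y ≤ weight κ l Y := by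
  cases κ
  · exact Real.rpow_le_rpow_of_exponent_le (by linarith) h
  · exact Real.exp_le_exp.2 (mul_le_mul_of_nonneg_right h hY)

theorem weight_antitone (κ : WeightKind) {m : ℝ} (h : m ≤ 0) {Y Z : ℝ} (hY : 0 ≤ Y) (hYZ : Y ≤ Z) :
    weight κ m Z ≤ weight κ m Y := by
  cases κ
  · exact Real.rpow_le_rpow_of_nonpos (by linarith) (by linarith) h
  · exact Real.exp_le_exp.2 (mul_le_mul_of_nonpos_left hYZ h)

/-- The exponent of the derivative of a weight. -/
def WeightKind.lower : WeightKind → ℝ → ℝ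
  | .poly, m => m - 1
  | .expo, m => m

theorem WeightKind.lower_le (κ : WeightKind) (m : ℝ) : κ.lower m ≤ m := by
  cases κ <;> simp [WeightKind.lower]

theorem hasDerivAt_weight (κ : WeightKind) (m : ℝ) {Y : ℝ} (hY : -1 < Y) :
    HasDerivAt (weight κ m) (m * weight κ (κ.lower m) Y) Y := by
  cases κ
  · have := ((hasDerivAt_id Y).const_add 1).rpow_const (p := m) (Or.inl (by simp; linarith))
    exact this.congr_deriv (by simp [weight, WeightKind.lower])
  · have := ((hasDerivAt_id Y).const_mul m).exp
    exact this.congr_deriv (by simp [weight, WeightKind.lower]; ring)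

theorem continuousOn_weight (κ : WeightKind) (m : ℝ) : ContinuousOn (weight κ m) (Ici 0) :=
  fun Y hY => (hasDerivAt_weight κ m (by
    have : (0 : ℝ) ≤ Y := hY
    linarith)).continuousAt.continuousWithinAt

theorem hasD2At_weight (κ : WeightKind) (m : ℝ) {Y : ℝ} (hY : 0 < Y) :
    HasD2At (weight κ m) (m * (κ.lower m * weight κ (κ.lower (κ.lower m)) Y)) Y :=
  ⟨fun Z => m * weight κ (κ.lower m) Z,
    by filter_upwards [Ioi_mem_nhds (show -1 < Y by linarith)] with Z hZ using
      hasDerivAt_weight κ m hZ,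
    (hasDerivAt_weight κ _ (by linarith)).const_mul m⟩

/-- Provides the constant `c` of `abs_le_of_weighted_bounds`. Differentiation never raises the
exponent of a weight, which treats both scales at once. -/
theorem weight_second_deriv_le (κ : WeightKind) (m : ℝ) {Y : ℝ} (hY : 0 < Y) :
    m * (κ.lower m * weight κ (κ.lower (κ.lower m)) Y) ≤ |m * κ.lower m| * weight κ m Y := by
  have h1 := weight_mono_exponent κ ((κ.lower_le (κ.lower m)).trans (κ.lower_le m)) hY.le
  have h2 := weight_pos κ (κ.lower (κ.lower m)) hY.le
  calc _ = (m * κ.lower m) * weight κ (κ.lower (κ.lower m)) Y := by ring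
    _ ≤ |m * κ.lower m| * weight κ (κ.lower (κ.lower m)) Y :=
      mul_le_mul_of_nonneg_right (le_abs_self _) h2.le
    _ ≤ _ := mul_le_mul_of_nonneg_left h1 (abs_nonneg _)

/-! ### Dirichlet sine coefficients and completeness -/

/-- The `n`-th Dirichlet frequency of the interval `(0, L)`. -/
def freq (L : ℝ) (n : ℕ) : ℝ := n * Real.pi / L

/-- The `n`-th sine coefficient of a function on `(0, L)`. -/
def sinCoef (L : ℝ) (g : ℝ → ℝ) (n : ℕ) : ℝ :=
  2 / L * ∫ x in (0 : ℝ)..L, g x * Real.sin (freq L n * x)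

theorem freq_mul_self {L : ℝ} (hL : 0 < L) (n : ℕ) : freq L n * L = n * Real.pi := by
  rw [freq]; field_simp

theorem freq_pos {L : ℝ} (hL : 0 < L) {n : ℕ} (hn : n ≠ 0) : 0 < freq L n := by
  have : (0 : ℝ) < n := by exact_mod_cast Nat.pos_of_ne_zero hn
  have := Real.pi_pos
  rw [freq]; positivity

theorem sinCoef_add {L : ℝ} {f g : ℝ → ℝ} (hf : Continuous f) (hg : Continuous g) (n : ℕ) :
    sinCoef L (fun x => f x + g x) n = sinCoef L f n + sinCoef L g n := by
  simp only [sinCoef, add_mul]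
  rw [intervalIntegral.integral_add
    ((by fun_prop : Continuous fun x => f x * Real.sin (freq L n * x)).intervalIntegrable _ _)
    ((by fun_prop : Continuous fun x => g x * Real.sin (freq L n * x)).intervalIntegrable _ _)]
  ring

theorem sinCoef_const_mul (L c : ℝ) (f : ℝ → ℝ) (n : ℕ) :
    sinCoef L (fun x => c * f x) n = c * sinCoef L f n := by
  simp only [sinCoef, mul_assoc, intervalIntegral.integral_const_mul]
  ring

theorem sinCoef_neg (L : ℝ) (f : ℝ → ℝ) (n : ℕ) :
    sinCoef L (fun x => -f x) n = -sinCoef L f n := by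
  simpa using sinCoef_const_mul L (-1) f n

theorem sinCoef_sub {L : ℝ} {f g : ℝ → ℝ} (hf : Continuous f) (hg : Continuous g) (n : ℕ) :
    sinCoef L (fun x => f x - g x) n = sinCoef L f n - sinCoef L g n := by
  simp only [sub_eq_add_neg]
  rw [← sinCoef_neg]
  exact sinCoef_add hf hg.neg n

theorem sinCoef_mul_const (L c : ℝ) (f : ℝ → ℝ) (n : ℕ) :
    sinCoef L (fun x => f x * c) n = sinCoef L f n * c := by
  simpa only [mul_comm] using sinCoef_const_mul L c f n

theorem abs_sinCoef_le {L : ℝ} (hL : 0 < L) {g : ℝ → ℝ} {A : ℝ} (h : ∀ x ∈ Icc 0 L, |g x| ≤ A)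
    (n : ℕ) : |sinCoef L g n| ≤ 2 * A := by
  have h1 : ‖∫ x in (0 : ℝ)..L, g x * Real.sin (freq L n * x)‖ ≤ A * |L - 0| := by
    refine intervalIntegral.norm_integral_le_of_norm_le_const fun x hx => ?_
    rw [uIoc_of_le hL.le] at hx
    have h2 := h x (Ioc_subset_Icc_self hx)
    rw [Real.norm_eq_abs, abs_mul]
    calc _ ≤ |g x| * 1 := mul_le_mul_of_nonneg_left (Real.abs_sin_le_one _) (abs_nonneg _)
      _ ≤ A := by linarith
  rw [Real.norm_eq_abs, sub_zero, abs_of_pos hL] at h1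
  rw [sinCoef, abs_mul, abs_of_pos (by positivity)]
  calc _ ≤ 2 / L * (A * L) := by gcongr
    _ = 2 * A := by field_simp

theorem continuous_sinCoef {L : ℝ} {f : ℝ × ℝ → ℝ} (hf : Continuous f) (n : ℕ) :
    Continuous fun Y => sinCoef L (fun x => f (x, Y)) n := by
  unfold sinCoef
  refine continuous_const.mul ?_
  exact intervalIntegral.continuous_parametric_intervalIntegral_of_continuous
    (f := fun Y x => f (x, Y) * Real.sin (freq L n * x)) (by fun_prop) continuous_const

/-- Two integrations by parts; only the boundary terms with a cosine survive. This is the relation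
that consecutive levels of the tower have to satisfy. -/
theorem sinCoef_second_deriv {L : ℝ} (hL : 0 < L) {g g' g'' : ℝ → ℝ} (hc : Continuous g)
    (hc'' : Continuous g'') (h1 : ∀ x ∈ Icc 0 L, HasDerivWithinAt g (g' x) (Icc 0 L) x)
    (h2 : ∀ x ∈ Icc 0 L, HasDerivWithinAt g' (g'' x) (Icc 0 L) x) (n : ℕ) :
    sinCoef L g'' n = -freq L n ^ 2 * sinCoef L g n
      + 2 / L * freq L n * (g 0 - (-1) ^ n * g L) := by
  set lam := freq L n with hlam
  have hcos : Real.cos (lam * L) = (-1) ^ n := by rw [freq_mul_self hL, Real.cos_nat_mul_pi]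
  have hsin : Real.sin (lam * L) = 0 := by rw [freq_mul_self hL, Real.sin_nat_mul_pi]
  have key : ∫ x in (0 : ℝ)..L, (g'' x * Real.sin (lam * x) + lam ^ 2 * (g x * Real.sin (lam * x)))
      = (fun x => g' x * Real.sin (lam * x) - lam * (g x * Real.cos (lam * x))) L
        - (fun x => g' x * Real.sin (lam * x) - lam * (g x * Real.cos (lam * x))) 0 := by
    refine intervalIntegral.integral_eq_sub_of_hasDerivAt_of_le
      (f := fun x => g' x * Real.sin (lam * x) - lam * (g x * Real.cos (lam * x))) hL.le ?_ ?_ ?_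
    rotate_left 2
    · exact Continuous.intervalIntegrable (by fun_prop) _ _
    · have : ContinuousOn g' (Icc 0 L) := fun x hx => (h2 x hx).continuousWithinAt
      fun_prop
    · intro x hx
      have hn := Icc_mem_nhds hx.1 hx.2
      have d1 := (h1 x (Ioo_subset_Icc_self hx)).hasDerivAt hn
      have d2 := (h2 x (Ioo_subset_Icc_self hx)).hasDerivAt hn
      have l := (hasDerivAt_id x).const_mul lam
      exact ((d2.mul l.sin).sub ((d1.mul l.cos).const_mul lam)).congr_deriv (by simp; ring)
  rw [intervalIntegral.integral_add
    ((by fun_prop : Continuous fun x => g'' x * Real.sin (lam * x)).intervalIntegrable _ _)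
    ((by fun_prop : Continuous fun x => lam ^ 2 * (g x * Real.sin (lam * x))).intervalIntegrable
      _ _), intervalIntegral.integral_const_mul] at key
  simp only [hcos, hsin, mul_zero, Real.sin_zero, Real.cos_zero] at key
  unfold sinCoef
  rw [eq_sub_of_add_eq key]
  ring

theorem sinCoef_affine {L : ℝ} (hL : 0 < L) (α β : ℝ) {n : ℕ} (hn : n ≠ 0) :
    sinCoef L (fun x => α + (β - α) * (x / L)) n =
      2 / L / freq L n * (α - (-1) ^ n * β) := by
  have h := sinCoef_second_deriv hL (g := fun x => α + (β - α) * (x / L))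
    (g' := fun _ => (β - α) * (1 / L)) (g'' := fun _ => 0) (by fun_prop) (by fun_prop)
    (fun x _ => ((((hasDerivAt_id x).div_const L).const_mul _).const_add _).hasDerivWithinAt)
    (fun x _ => hasDerivWithinAt_const _ _ _) n
  have h0 : sinCoef L (fun _ => (0 : ℝ)) n = 0 := by simp [sinCoef]
  have hf := (freq_pos hL hn).ne'
  rw [h0, div_self hL.ne'] at h
  have h1 : freq L n * (freq L n * sinCoef L (fun x => α + (β - α) * (x / L)) n) =
      freq L n * (2 / L * (α - (-1) ^ n * β)) := by
    simp only [zero_div, mul_zero, add_zero, mul_one, add_sub_cancel] at h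
    linarith
  have h2 := mul_left_cancel₀ hf h1
  rw [div_mul_eq_mul_div, eq_div_iff hf, ← h2, mul_comm]

/-- Off the diagonal, `sinCoef_second_deriv` for an eigenfunction vanishing at both ends shows that
the difference of the squared frequencies annihilates the coefficient. -/
theorem sinCoef_sin {L : ℝ} (hL : 0 < L) {n m : ℕ} (hn : n ≠ 0) (hm : m ≠ 0) :
    sinCoef L (fun x => Real.sin (freq L m * x)) n = if m = n then 1 else 0 := by
  split_ifs with h
  · subst h
    have hf := (freq_pos hL hm).ne'
    have key : ∫ x in (0 : ℝ)..L, Real.sin (freq L m * x) * Real.sin (freq L m * x)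
      = (fun x => x / 2 - Real.sin (2 * (freq L m * x)) / (4 * freq L m)) L
        - (fun x => x / 2 - Real.sin (2 * (freq L m * x)) / (4 * freq L m)) 0 := by
      refine intervalIntegral.integral_eq_sub_of_hasDerivAt
        (f := fun x => x / 2 - Real.sin (2 * (freq L m * x)) / (4 * freq L m)) (fun x _ => ?_) ?_
      swap
      · exact Continuous.intervalIntegrable (by fun_prop) _ _
      have l := (((hasDerivAt_id x).const_mul (freq L m)).const_mul 2).sin
      refine (((hasDerivAt_id x).div_const 2).sub (l.div_const (4 * freq L m))).congr_deriv ?_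
      simp only [id]
      rw [Real.cos_two_mul, Real.cos_sq']
      field_simp; ring
    have hs : Real.sin (2 * (freq L m * L)) = 0 := by
      rw [freq_mul_self hL, show 2 * ((m : ℝ) * Real.pi) = ((2 * m : ℕ) : ℝ) * Real.pi by
        push_cast; ring, Real.sin_nat_mul_pi]
    rw [sinCoef, key]
    simp only [hs]
    simp [hL.ne']
  · have h2 := sinCoef_second_deriv hL (g := fun x => Real.sin (freq L m * x))
      (g' := fun x => freq L m * Real.cos (freq L m * x))
      (g'' := fun x => -freq L m ^ 2 * Real.sin (freq L m * x)) (by fun_prop) (by fun_prop)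
      (fun x _ => ((((hasDerivAt_id x).const_mul (freq L m)).sin).congr_deriv
        (by simp; ring)).hasDerivWithinAt)
      (fun x _ => (((((hasDerivAt_id x).const_mul (freq L m)).cos).const_mul _).congr_deriv
        (by simp; ring)).hasDerivWithinAt) n
    rw [sinCoef_const_mul, freq_mul_self hL, Real.sin_nat_mul_pi] at h2
    simp only [mul_zero, Real.sin_zero, sub_zero, add_zero] at h2
    have hne : freq L n ^ 2 - freq L m ^ 2 ≠ 0 := by
      intro h0
      have h3 : freq L m = freq L n :=
        (pow_left_inj₀ (freq_pos hL hm).le (freq_pos hL hn).le two_ne_zero).1 (by linarith)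
      unfold freq at h3
      have hpi := Real.pi_pos.ne'
      field_simp at h3
      exact h (by exact_mod_cast h3)
    have h4 : (freq L n ^ 2 - freq L m ^ 2) * sinCoef L (fun x => Real.sin (freq L m * x)) n = 0 := by
      linarith
    exact (mul_eq_zero.1 h4).resolve_left hne

theorem continuous_sine_series {L : ℝ} {a : ℕ → ℝ → ℝ} {b : ℕ → ℝ} (hb : Summable b)
    (ha : ∀ n, Continuous (a n)) (hab : ∀ n Y, |a n Y| ≤ b n) :
    Continuous fun p : ℝ × ℝ => ∑' n, a n p.2 * Real.sin (freq L n * p.1) := by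
  refine continuous_tsum (fun n => ?_) hb fun n p => ?_
  · have := ha n
    fun_prop
  · rw [Real.norm_eq_abs, abs_mul]
    calc _ ≤ |a n p.2| * 1 := mul_le_mul_of_nonneg_left (Real.abs_sin_le_one _) (abs_nonneg _)
      _ ≤ b n := by rw [mul_one]; exact hab n _

theorem sinCoef_series {L : ℝ} (hL : 0 < L) {a : ℕ → ℝ} (ha : Summable fun n => |a n|)
    (h0 : a 0 = 0) {n : ℕ} (hn : n ≠ 0) :
    sinCoef L (fun x => ∑' m, a m * Real.sin (freq L m * x)) n = a n := by
  have hterm : ∀ m x, |a m * Real.sin (freq L m * x) * Real.sin (freq L n * x)| ≤ |a m| := by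
    intro m x
    rw [abs_mul, abs_mul, mul_assoc]
    exact mul_le_of_le_one_right (abs_nonneg _)
      (mul_le_one₀ (Real.abs_sin_le_one _) (abs_nonneg _) (Real.abs_sin_le_one _))
  have hs := intervalIntegral.hasSum_integral_of_dominated_convergence (μ := volume)
    (a := 0) (b := L)
    (F := fun m x => a m * Real.sin (freq L m * x) * Real.sin (freq L n * x))
    (f := fun x => (∑' m, a m * Real.sin (freq L m * x)) * Real.sin (freq L n * x))
    (fun m _ => |a m|) (fun m => (by fun_prop : Continuous _).aestronglyMeasurable)
    (fun m => Eventually.of_forall fun x _ => hterm m x)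
    (Eventually.of_forall fun x _ => ha) (by simp)
    (Eventually.of_forall fun x _ => by
      have : Summable fun m => a m * Real.sin (freq L m * x) := by
        refine Summable.of_norm_bounded ha fun m => ?_
        rw [Real.norm_eq_abs, abs_mul]
        exact mul_le_of_le_one_right (abs_nonneg _) (Real.abs_sin_le_one _)
      exact this.hasSum.mul_right _)
  have h2 := hs.mul_left (2 / L)
  have h3 : (fun m => 2 / L * ∫ x in (0 : ℝ)..L,
      a m * Real.sin (freq L m * x) * Real.sin (freq L n * x)) =
      fun m => if m = n then a n else 0 := by
    ext m
    by_cases hm : m = 0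
    · subst hm
      simp [h0, hn.symm]
    · have := sinCoef_const_mul L (a m) (fun x => Real.sin (freq L m * x)) n
      rw [sinCoef_sin hL hn hm] at this
      unfold sinCoef at this
      rw [this]
      split_ifs with h
      · simp [h]
      · simp
  rw [h3] at h2
  exact h2.unique (hasSum_ite_eq n (a n))

/-- Completeness of the Dirichlet sine system on `[0, L]`. -/
theorem eq_zero_of_sinCoef_eq_zero {L : ℝ} (hL : 0 < L) {g : ℝ → ℝ} (hg : Continuous g)
    (h : ∀ n : ℕ, n ≠ 0 → sinCoef L g n = 0) : ∀ x ∈ Icc 0 L, g x = 0 := by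
  have hpi := Real.pi_pos
  set θ : ℝ → ℝ := fun x => freq L 1 * x with hθ
  have hθc : Continuous θ := by fun_prop
  have hfreq : ∀ (n : ℕ) x, freq L n * x = n * θ x := fun n x => by simp [hθ, freq]; ring
  -- The identity `2 sin ((n+1)θ) cos θ = sin ((n+2)θ) + sin (nθ)` lowers the power of the cosine.
  have c1 : ∀ k n : ℕ, ∫ x in (0 : ℝ)..L, g x * Real.sin (n * θ x) * Real.cos (θ x) ^ k = 0 := by
    intro k
    induction k with
    | zero =>
      intro n
      by_cases hn : n = 0
      · simp [hn]
      · have := h n hn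
        unfold sinCoef at this
        simp only [hfreq] at this
        simpa [hL.ne'] using this
    | succ k ih =>
      intro n
      cases n with
      | zero => simp
      | succ n =>
        have e : ∀ x, g x * Real.sin ((n + 1 : ℕ) * θ x) * Real.cos (θ x) ^ (k + 1) =
            (1 / 2) * (g x * Real.sin ((n + 2 : ℕ) * θ x) * Real.cos (θ x) ^ k) +
            (1 / 2) * (g x * Real.sin (n * θ x) * Real.cos (θ x) ^ k) := by
          intro x
          have e1 : ((n + 2 : ℕ) : ℝ) * θ x = (n + 1 : ℕ) * θ x + θ x := by push_cast; ring
          have e2 : (n : ℝ) * θ x = (n + 1 : ℕ) * θ x - θ x := by push_cast; ring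
          rw [e1, e2, Real.sin_add, Real.sin_sub, pow_succ]
          ring
        simp only [e]
        rw [intervalIntegral.integral_add ((by fun_prop : Continuous _).intervalIntegrable _ _)
          ((by fun_prop : Continuous _).intervalIntegrable _ _),
          intervalIntegral.integral_const_mul, intervalIntegral.integral_const_mul, ih, ih]
        simp
  set G : ℝ → ℝ := fun x => g x * Real.sin (θ x) with hG
  have hGc : Continuous G := by fun_prop
  have c2 : ∀ p : Polynomial ℝ, ∫ x in (0 : ℝ)..L, G x * p.eval (Real.cos (θ x)) = 0 := by
    intro p
    simp only [Polynomial.eval_eq_sum_range, Finset.mul_sum]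
    rw [intervalIntegral.integral_finsetSum
      (fun i _ => (by fun_prop : Continuous _).intervalIntegrable _ _)]
    refine Finset.sum_eq_zero fun i _ => ?_
    have := c1 i 1
    simp only [Nat.cast_one, one_mul] at this
    have e : ∀ x, G x * (p.coeff i * Real.cos (θ x) ^ i) =
      p.coeff i * (g x * Real.sin (θ x) * Real.cos (θ x) ^ i) := fun x => by simp only [hG]; ring
    simp only [e, intervalIntegral.integral_const_mul, this, mul_zero]
  set A := ∫ x in (0 : ℝ)..L, |G x| with hA
  have hA0 : 0 ≤ A := intervalIntegral.integral_nonneg hL.le fun x _ => abs_nonneg _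
  -- By Weierstrass, `G` as a function of `cos θ` in [-1, 1] is uniformly close to a polynomial in
  -- `cos θ`, and `G` is orthogonal to all of these.
  have c3 : ∀ ε : ℝ, 0 < ε → ∫ x in (0 : ℝ)..L, G x * G x ≤ ε * A := by
    intro ε hε
    obtain ⟨p, hp⟩ := exists_polynomial_near_of_continuousOn (-1) 1
      (fun c => G (Real.arccos c * L / Real.pi))
      (by have := Real.continuous_arccos; fun_prop) ε hε
    have hp' : ∀ x ∈ Icc 0 L, |p.eval (Real.cos (θ x)) - G x| ≤ ε := by
      intro x hx
      have := hp (Real.cos (θ x)) ⟨Real.neg_one_le_cos _, Real.cos_le_one _⟩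
      have e : θ x = Real.pi * (x / L) := by simp [hθ, freq]; ring
      have h1 : x / L ≤ 1 := (div_le_one hL).2 hx.2
      have h2 : 0 ≤ x / L := div_nonneg hx.1 hL.le
      rw [Real.arccos_cos (by rw [e]; positivity) (by rw [e]; nlinarith)] at this
      have e3 : θ x * L / Real.pi = x := by rw [e]; field_simp
      rw [e3] at this
      exact this.le
    have e : ∫ x in (0 : ℝ)..L, G x * G x =
        ∫ x in (0 : ℝ)..L, (G x * G x - G x * p.eval (Real.cos (θ x))) := by
      rw [intervalIntegral.integral_sub ((by fun_prop : Continuous _).intervalIntegrable _ _)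
        ((by fun_prop : Continuous _).intervalIntegrable _ _), c2, sub_zero]
    rw [e, hA, ← intervalIntegral.integral_const_mul]
    refine intervalIntegral.integral_mono_on hL.le
      ((by fun_prop : Continuous _).intervalIntegrable _ _)
      ((by fun_prop : Continuous _).intervalIntegrable _ _) fun x hx => ?_
    calc G x * G x - G x * p.eval (Real.cos (θ x))
        ≤ |G x * (G x - p.eval (Real.cos (θ x)))| := by rw [← mul_sub]; exact le_abs_self _
      _ = |G x| * |p.eval (Real.cos (θ x)) - G x| := by rw [abs_mul, abs_sub_comm]
      _ ≤ |G x| * ε := mul_le_mul_of_nonneg_left (hp' x hx) (abs_nonneg _)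
      _ = ε * |G x| := mul_comm _ _
  have c4 : ∫ x in (0 : ℝ)..L, G x * G x ≤ 0 := by
    refine le_of_forall_pos_le_add fun δ hδ => ?_
    have := c3 (δ / (A + 1)) (by positivity)
    rw [zero_add]
    refine this.trans ?_
    rw [div_mul_eq_mul_div, div_le_iff₀ (by linarith)]
    nlinarith
  have c5 : ∀ x ∈ Icc 0 L, G x = 0 := by
    intro x hx
    by_contra hne
    refine absurd c4 (not_le.2 ?_)
    exact intervalIntegral.integral_pos hL (by fun_prop) (fun x _ => mul_self_nonneg _)
      ⟨x, hx, mul_self_pos.2 hne⟩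
  -- The factor `sin θ` is positive in the open interval; the end points follow by continuity of
  -- `g`.
  have c6 : Ioo 0 L ⊆ {x | g x = 0} := by
    intro x hx
    have e : θ x = Real.pi * (x / L) := by simp [hθ, freq]; ring
    have h1 : x / L < 1 := (div_lt_one hL).2 hx.2
    have h2 : 0 < x / L := div_pos hx.1 hL
    have : 0 < Real.sin (θ x) := Real.sin_pos_of_pos_of_lt_pi (by rw [e]; positivity)
      (by rw [e]; nlinarith)
    exact (mul_eq_zero.1 (c5 x (Ioo_subset_Icc_self hx))).resolve_right this.ne'
  have c7 := closure_minimal c6 (isClosed_eq hg continuous_const)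
  rw [closure_Ioo hL.ne] at c7
  exact fun x hx => c7 hx

theorem eqOn_of_sinCoef_eq {L : ℝ} (hL : 0 < L) {f g : ℝ → ℝ} (hf : Continuous f)
    (hg : Continuous g) (h : ∀ n : ℕ, n ≠ 0 → sinCoef L f n = sinCoef L g n) :
    EqOn f g (Icc 0 L) := fun x hx =>
  sub_eq_zero.1 (eq_zero_of_sinCoef_eq_zero hL (hf.sub hg) (fun n hn => by
    rw [← sub_eq_zero.2 (h n hn), ← sinCoef_sub hf hg]; rfl) x hx)

/-! ### Primitives and integrals depending on a parameter -/

theorem integral_swap_of_continuous {F : ℝ → ℝ → ℝ} (hF : Continuous F.uncurry) {a b c d : ℝ} :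
    ∫ x in a..b, ∫ y in c..d, F x y = ∫ y in c..d, ∫ x in a..b, F x y :=
  intervalIntegral_intervalIntegral_swap <| IntegrableOn.mono_set
    (hF.continuousOn.integrableOn_compact (isCompact_uIcc.prod isCompact_uIcc))
    (prod_mono uIoc_subset_uIcc uIoc_subset_uIcc)

theorem sinCoef_integral {L : ℝ} {h : ℝ × ℝ → ℝ} (hh : Continuous h) {k : ℝ → ℝ} (hk : Continuous k)
    (Y : ℝ) (n : ℕ) :
    sinCoef L (fun x => ∫ t in (0 : ℝ)..Y, k t * h (x, t)) n =
      ∫ t in (0 : ℝ)..Y, k t * sinCoef L (fun x => h (x, t)) n := by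
  unfold sinCoef
  simp only [← intervalIntegral.integral_mul_const]
  have : Continuous (Function.uncurry fun x t => k t * h (x, t) * Real.sin (freq L n * x)) := by
    unfold Function.uncurry; fun_prop
  rw [integral_swap_of_continuous this, ← intervalIntegral.integral_const_mul]
  refine intervalIntegral.integral_congr fun t _ => ?_
  simp only [mul_assoc, intervalIntegral.integral_const_mul]
  ring

theorem hasDerivAt_double_primitive {H : ℝ → ℝ} (hH : Continuous H) (Y : ℝ) :
    HasDerivAt (fun Y => ∫ t in (0 : ℝ)..Y, (Y - t) * H t) (∫ t in (0 : ℝ)..Y, H t) Y := by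
  have e : (fun Y => ∫ t in (0 : ℝ)..Y, (Y - t) * H t) =
      fun Y => Y * (∫ t in (0 : ℝ)..Y, H t) - ∫ t in (0 : ℝ)..Y, t * H t := by
    ext Y
    rw [← intervalIntegral.integral_const_mul, ← intervalIntegral.integral_sub
      ((by fun_prop : Continuous _).intervalIntegrable _ _)
      ((by fun_prop : Continuous _).intervalIntegrable _ _)]
    simp only [sub_mul]
  rw [e]
  have d1 := intervalIntegral.integral_hasDerivAt_right (hH.intervalIntegrable 0 Y)
    (hH.stronglyMeasurableAtFilter _ _) hH.continuousAt
  have hc : Continuous fun t => t * H t := by fun_prop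
  have d2 := intervalIntegral.integral_hasDerivAt_right (hc.intervalIntegrable 0 Y)
    (hc.stronglyMeasurableAtFilter _ _) hc.continuousAt
  exact (((hasDerivAt_id Y).mul d1).sub d2).congr_deriv (by simp)

theorem hasDerivAt_primitive {H : ℝ → ℝ} (hH : Continuous H) (Y : ℝ) :
    HasDerivAt (fun Y => ∫ t in (0 : ℝ)..Y, H t) (H Y) Y :=
  intervalIntegral.integral_hasDerivAt_right (hH.intervalIntegrable 0 Y)
    (hH.stronglyMeasurableAtFilter _ _) hH.continuousAt

/-- Taylor's formula with integral remainder, the form in which second Y-derivatives pass from the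
sine coefficients to the sum of the series. -/
theorem eq_double_primitive_of_second_deriv {a : ℝ} (ha : 0 ≤ a) {g g' g'' : ℝ → ℝ}
    (hc : Continuous g'')
    (h1 : ∀ x ∈ Icc 0 a, HasDerivWithinAt g (g' x) (Icc 0 a) x)
    (h2 : ∀ x ∈ Icc 0 a, HasDerivWithinAt g' (g'' x) (Icc 0 a) x) :
    ∫ t in (0 : ℝ)..a, (a - t) * g'' t = g a - g 0 - a * g' 0 := by
  have hk := intervalIntegral.integral_eq_sub_of_hasDerivAt_of_le (f := fun t => (a - t) * g' t + g t)
    (f' := fun t => (a - t) * g'' t) ha ?_ ?_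
    ((by fun_prop : Continuous _).intervalIntegrable _ _)
  · rw [hk]; ring
  · have c1 : ContinuousOn g' (Icc 0 a) := fun x hx => (h2 x hx).continuousWithinAt
    have c2 : ContinuousOn g (Icc 0 a) := fun x hx => (h1 x hx).continuousWithinAt
    fun_prop
  · intro x hx
    have hn := Icc_mem_nhds hx.1 hx.2
    have d1 := (h1 x (Ioo_subset_Icc_self hx)).hasDerivAt hn
    have d2 := (h2 x (Ioo_subset_Icc_self hx)).hasDerivAt hn
    exact ((((hasDerivAt_id x).const_sub a).mul d2).add d1).congr_deriv (by simp)

/-- Differentiation under the integral sign, up to the boundary of the half-line. -/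
theorem hasDerivWithinAt_integral_param {g g' : ℝ × ℝ → ℝ} {k : ℝ → ℝ} (hg : Continuous g)
    (hg' : Continuous g') (hk : Continuous k) {x : ℝ}
    (hd : ∀ s ∈ uIcc 0 x, ∀ t, 0 ≤ t → HasDerivWithinAt (fun t => g (s, t)) (g' (s, t)) (Ici 0) t)
    {Y : ℝ} (hY : 0 ≤ Y) :
    HasDerivWithinAt (fun Y => ∫ s in (0 : ℝ)..x, k s * g (s, Y))
      (∫ s in (0 : ℝ)..x, k s * g' (s, Y)) (Ici 0) Y := by
  have hc : Continuous fun t => ∫ s in (0 : ℝ)..x, k s * g' (s, t) :=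
    intervalIntegral.continuous_parametric_intervalIntegral_of_continuous
      (f := fun t s => k s * g' (s, t)) (by unfold Function.uncurry; fun_prop) continuous_const
  have hu : Continuous (Function.uncurry fun t s => k s * g' (s, t)) := by
    unfold Function.uncurry; fun_prop
  -- By Fubini the integral is a primitive in Y of a continuous function, hence differentiable also
  -- at the end point 0.
  have e : ∀ Z, 0 ≤ Z → ∫ s in (0 : ℝ)..x, k s * g (s, Z) =
      (∫ s in (0 : ℝ)..x, k s * g (s, 0)) +
        ∫ t in (0 : ℝ)..Z, ∫ s in (0 : ℝ)..x, k s * g' (s, t) := by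
    intro Z hZ
    rw [integral_swap_of_continuous hu, ← intervalIntegral.integral_add
      ((by fun_prop : Continuous _).intervalIntegrable _ _)
      ((intervalIntegral.continuous_parametric_intervalIntegral_of_continuous
      (f := fun s t => k s * g' (s, t)) (by unfold Function.uncurry; fun_prop)
      continuous_const).intervalIntegrable _ _)]
    refine intervalIntegral.integral_congr fun s hs => ?_
    simp only [intervalIntegral.integral_const_mul]
    rw [intervalIntegral.integral_eq_sub_of_hasDerivAt_of_le hZ
      (f := fun t => g (s, t)) (by fun_prop)
      (fun t ht => (hd s hs t ht.1.le).hasDerivAt (Ici_mem_nhds ht.1))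
      ((by fun_prop : Continuous fun t => g' (s, t)).intervalIntegrable _ _)]
    ring
  refine (((hasDerivAt_primitive hc Y).const_add _).hasDerivWithinAt).congr
    (fun Z hZ => e Z hZ) (e Y hY)

/-! ### Bounded solutions of ordinary differential equations on the half-line -/

/-- The part `e^{λY} ∫_Y^∞ e^{-λt} h(t) dt` of the Green operator of `-∂² + λ²`. -/
def expTail (lam : ℝ) (h : ℝ → ℝ) (Y : ℝ) : ℝ :=
  Real.exp (lam * Y) * ∫ t in Ioi Y, Real.exp (-lam * t) * h t

/-- The part `e^{-λY} ∫_0^Y e^{λt} h(t) dt` of the Green operator of `-∂² + λ²`. -/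
def expHead (lam : ℝ) (h : ℝ → ℝ) (Y : ℝ) : ℝ :=
  Real.exp (-lam * Y) * ∫ t in (0 : ℝ)..Y, Real.exp (lam * t) * h t

/-- The bounded solution on the half-line of `z'' = λ² z - h`, `z(0) = b`. -/
def greenSol (lam b : ℝ) (h : ℝ → ℝ) (Y : ℝ) : ℝ :=
  (expTail lam h Y + expHead lam h Y) / (2 * lam)
    + (b - expTail lam h 0 / (2 * lam)) * Real.exp (-lam * Y)

/-- The derivative of `greenSol`. -/
def greenSolDeriv (lam b : ℝ) (h : ℝ → ℝ) (Y : ℝ) : ℝ :=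
  (expTail lam h Y - expHead lam h Y) / 2
    - lam * (b - expTail lam h 0 / (2 * lam)) * Real.exp (-lam * Y)

section Green

variable {lam : ℝ} {h : ℝ → ℝ} {A : ℝ}

theorem integrableOn_expTail (hlam : 0 < lam) (hc : Continuous h) (hA : ∀ Y, |h Y| ≤ A) (Y : ℝ) :
    IntegrableOn (fun t => Real.exp (-lam * t) * h t) (Ioi Y) := by
  refine Integrable.mono' ((integrableOn_exp_mul_Ioi (neg_lt_zero.2 hlam) Y).mul_const A)
    (by fun_prop : Continuous _).aestronglyMeasurable (Eventually.of_forall fun t => ?_)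
  rw [Real.norm_eq_abs, abs_mul, abs_of_pos (Real.exp_pos _)]
  exact mul_le_mul_of_nonneg_left (hA t) (Real.exp_pos _).le

theorem abs_expTail_le (hlam : 0 < lam) (hA : ∀ Y, |h Y| ≤ A) (Y : ℝ) :
    |expTail lam h Y| ≤ A / lam := by
  have h1 : ‖∫ t in Ioi Y, Real.exp (-lam * t) * h t‖ ≤
      ∫ t in Ioi Y, Real.exp (-lam * t) * A := by
    refine norm_integral_le_of_norm_le
      ((integrableOn_exp_mul_Ioi (neg_lt_zero.2 hlam) Y).mul_const A)
      (Eventually.of_forall fun t => ?_)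
    rw [Real.norm_eq_abs, abs_mul, abs_of_pos (Real.exp_pos _)]
    exact mul_le_mul_of_nonneg_left (hA t) (Real.exp_pos _).le
  rw [integral_mul_const, integral_exp_mul_Ioi (neg_lt_zero.2 hlam), Real.norm_eq_abs] at h1
  rw [expTail, abs_mul, abs_of_pos (Real.exp_pos _)]
  refine (mul_le_mul_of_nonneg_left h1 (Real.exp_pos _).le).trans_eq ?_
  have : Real.exp (lam * Y) * Real.exp (-lam * Y) = 1 := by
    rw [← Real.exp_add]; simp
  rw [neg_div_neg_eq, ← mul_assoc, ← mul_div_assoc, this, one_div, div_eq_mul_inv, mul_comm]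

theorem abs_expHead_le (hlam : 0 < lam) (hA : ∀ Y, |h Y| ≤ A) {Y : ℝ} (hY : 0 ≤ Y) :
    |expHead lam h Y| ≤ A / lam := by
  have hA0 : 0 ≤ A := (abs_nonneg _).trans (hA 0)
  have h1 : ‖∫ t in (0 : ℝ)..Y, Real.exp (lam * t) * h t‖ ≤
      ∫ t in (0 : ℝ)..Y, Real.exp (lam * t) * A := by
    refine intervalIntegral.norm_integral_le_of_norm_le hY (Eventually.of_forall fun t _ => ?_)
      (Continuous.intervalIntegrable (by fun_prop) _ _)
    rw [Real.norm_eq_abs, abs_mul, abs_of_pos (Real.exp_pos _)]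
    exact mul_le_mul_of_nonneg_left (hA t) (Real.exp_pos _).le
  have h2 : ∫ t in (0 : ℝ)..Y, Real.exp (lam * t) = (Real.exp (lam * Y) - 1) / lam := by
    rw [intervalIntegral.integral_comp_mul_left (fun t => Real.exp t) hlam.ne']
    simp [integral_exp]; ring
  rw [intervalIntegral.integral_mul_const, h2, Real.norm_eq_abs] at h1
  rw [expHead, abs_mul, abs_of_pos (Real.exp_pos _)]
  refine (mul_le_mul_of_nonneg_left h1 (Real.exp_pos _).le).trans ?_
  have h3 : Real.exp (-lam * Y) * Real.exp (lam * Y) = 1 := by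
    rw [← Real.exp_add]; simp
  have h4 := Real.exp_pos (-lam * Y)
  have e : Real.exp (-lam * Y) * ((Real.exp (lam * Y) - 1) / lam * A) =
      (1 - Real.exp (-lam * Y)) * (A / lam) := by
    linear_combination (A / lam) * h3
  rw [e]
  exact mul_le_of_le_one_left (by positivity) (by linarith)

theorem hasDerivAt_expTail (hlam : 0 < lam) (hc : Continuous h) (hA : ∀ Y, |h Y| ≤ A) (Y : ℝ) :
    HasDerivAt (expTail lam h) (lam * expTail lam h Y - h Y) Y := by
  have e : expTail lam h = fun Y => Real.exp (lam * Y) * ((∫ t in Ioi (0 : ℝ),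
      Real.exp (-lam * t) * h t) - ∫ t in (0 : ℝ)..Y, Real.exp (-lam * t) * h t) := by
    ext Z
    rw [expTail, ← intervalIntegral.integral_Ioi_sub_Ioi' (integrableOn_expTail hlam hc hA 0)
      (integrableOn_expTail hlam hc hA Z)]
    ring
  have d1 := ((hasDerivAt_id Y).const_mul lam).exp
  have d2 := hasDerivAt_primitive (H := fun t => Real.exp (-lam * t) * h t) (by fun_prop) Y
  have h3 : Real.exp (lam * Y) * Real.exp (-lam * Y) = 1 := by
    rw [← Real.exp_add]; simp
  rw [e]
  refine (d1.mul (d2.const_sub _)).congr_deriv ?_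
  simp only [id]
  linear_combination -(h Y) * h3

theorem hasDerivAt_expHead (hc : Continuous h) (Y : ℝ) :
    HasDerivAt (expHead lam h) (-lam * expHead lam h Y + h Y) Y := by
  have d1 := ((hasDerivAt_id Y).const_mul (-lam)).exp
  have d2 := hasDerivAt_primitive (H := fun t => Real.exp (lam * t) * h t) (by fun_prop) Y
  have h3 : Real.exp (-lam * Y) * Real.exp (lam * Y) = 1 := by
    rw [← Real.exp_add]; simp
  refine (d1.mul d2).congr_deriv ?_
  simp only [id, expHead]
  linear_combination (h Y) * h3

theorem hasDerivAt_greenSol (hlam : 0 < lam) (b : ℝ) (hc : Continuous h) (hA : ∀ Y, |h Y| ≤ A)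
    (Y : ℝ) : HasDerivAt (greenSol lam b h) (greenSolDeriv lam b h Y) Y := by
  have d1 := ((hasDerivAt_id Y).const_mul (-lam)).exp
  refine ((((hasDerivAt_expTail hlam hc hA Y).add (hasDerivAt_expHead hc Y)).div_const
    (2 * lam)).add (d1.const_mul (b - expTail lam h 0 / (2 * lam)))).congr_deriv ?_
  simp only [id, greenSolDeriv]
  field_simp
  ring

theorem hasDerivAt_greenSolDeriv (hlam : 0 < lam) (b : ℝ) (hc : Continuous h)
    (hA : ∀ Y, |h Y| ≤ A) (Y : ℝ) :
    HasDerivAt (greenSolDeriv lam b h) (lam ^ 2 * greenSol lam b h Y - h Y) Y := by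
  have d1 := ((hasDerivAt_id Y).const_mul (-lam)).exp
  refine ((((hasDerivAt_expTail hlam hc hA Y).sub (hasDerivAt_expHead hc Y)).div_const
    2).sub (d1.const_mul (lam * (b - expTail lam h 0 / (2 * lam))))).congr_deriv ?_
  simp only [id, greenSol]
  field_simp
  ring

theorem greenSol_zero (lam b : ℝ) (h : ℝ → ℝ) : greenSol lam b h 0 = b := by
  simp [greenSol, expHead]

/-- The gain of `λ⁻²` over the source is what makes the potential a contractive perturbation at high
frequency. -/
theorem abs_greenSol_le (hlam : 0 < lam) (b : ℝ) (hA : ∀ Y, |h Y| ≤ A) {Y : ℝ} (hY : 0 ≤ Y) :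
    |greenSol lam b h Y| ≤ |b| + 2 * A / lam ^ 2 := by
  have h1 := abs_expTail_le hlam hA Y
  have h2 := abs_expHead_le hlam hA hY
  have h3 := abs_expTail_le hlam hA 0
  have hA0 : 0 ≤ A := (abs_nonneg _).trans (hA 0)
  have h4 : Real.exp (-lam * Y) ≤ 1 := Real.exp_le_one_iff.2 (by nlinarith)
  have h5 := Real.exp_pos (-lam * Y)
  have h6 : |(expTail lam h Y + expHead lam h Y) / (2 * lam)| ≤ A / lam ^ 2 := by
    rw [abs_div, abs_of_pos (by positivity : 0 < 2 * lam), div_le_iff₀ (by positivity)]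
    refine ((abs_add_le _ _).trans (add_le_add h1 h2)).trans_eq ?_
    field_simp; ring
  have h7 : |expTail lam h 0 / (2 * lam)| ≤ A / lam ^ 2 := by
    rw [abs_div, abs_of_pos (by positivity : 0 < 2 * lam), div_le_iff₀ (by positivity)]
    refine h3.trans ?_
    have : A / lam ^ 2 * (2 * lam) = 2 * (A / lam) := by field_simp
    rw [this]
    have : 0 ≤ A / lam := by positivity
    linarith
  have h8 : |(b - expTail lam h 0 / (2 * lam)) * Real.exp (-lam * Y)| ≤ |b| + A / lam ^ 2 := by
    rw [abs_mul, abs_of_pos h5]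
    calc _ ≤ |b - expTail lam h 0 / (2 * lam)| := mul_le_of_le_one_right (abs_nonneg _) h4
      _ ≤ |b| + |expTail lam h 0 / (2 * lam)| := abs_sub _ _
      _ ≤ _ := by linarith
  have := abs_add_le ((expTail lam h Y + expHead lam h Y) / (2 * lam))
    ((b - expTail lam h 0 / (2 * lam)) * Real.exp (-lam * Y))
  rw [greenSol]
  have e : 2 * A / lam ^ 2 = A / lam ^ 2 + A / lam ^ 2 := by ring
  linarith

theorem greenSol_sub (hlam : 0 < lam) (b : ℝ) {k : ℝ → ℝ} {B : ℝ} (hc : Continuous h)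
    (hA : ∀ Y, |h Y| ≤ A) (kc : Continuous k) (hB : ∀ Y, |k Y| ≤ B) (Y : ℝ) :
    greenSol lam b h Y - greenSol lam b k Y = greenSol lam 0 (fun t => h t - k t) Y := by
  have e1 : ∀ Z, expTail lam (fun t => h t - k t) Z = expTail lam h Z - expTail lam k Z := by
    intro Z
    simp only [expTail, mul_sub]
    rw [integral_sub (integrableOn_expTail hlam hc hA Z) (integrableOn_expTail hlam kc hB Z)]
    ring
  have e2 : expHead lam (fun t => h t - k t) Y = expHead lam h Y - expHead lam k Y := by
    simp only [expHead, mul_sub]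
    rw [intervalIntegral.integral_sub (Continuous.intervalIntegrable (by fun_prop) _ _)
      (Continuous.intervalIntegrable (by fun_prop) _ _)]
    ring
  simp only [greenSol, e1, e2]
  ring

end Green

/-- Bounded solutions on the half-line of `z'' = (λ² + q) z - g`, `z(0) = b`, for large `λ`. -/
theorem exists_bounded_ode_solution {lam Q G : ℝ} (hlam : 0 < lam) (hQ : 4 * Q ≤ lam ^ 2)
    {q g : ℝ → ℝ} (hq : Continuous q) (hqQ : ∀ Y, |q Y| ≤ Q) (hg : Continuous g)
    (hgG : ∀ Y, |g Y| ≤ G) (b : ℝ) :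
    ∃ z z' : ℝ → ℝ, Continuous z ∧ (∀ Y, |z Y| ≤ 2 * |b| + 4 * G / lam ^ 2) ∧ z 0 = b ∧
      (∀ Y, 0 ≤ Y → HasDerivWithinAt z (z' Y) (Ici 0) Y) ∧
      (∀ Y, 0 ≤ Y → HasDerivWithinAt z' ((lam ^ 2 + q Y) * z Y - g Y) (Ici 0) Y) := by
  have hQ0 : 0 ≤ Q := (abs_nonneg _).trans (hqQ 0)
  have hsrc : ∀ w : BoundedContinuousFunction ℝ ℝ,
      (Continuous fun t => g t - q t * w t) ∧ ∀ t, |g t - q t * w t| ≤ G + Q * ‖w‖ := by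
    intro w
    refine ⟨by have := w.continuous; fun_prop, fun t => ?_⟩
    have h1 : |q t * w t| ≤ Q * ‖w‖ := by
      rw [abs_mul]
      exact mul_le_mul (hqQ t) (w.norm_coe_le_norm t) (abs_nonneg _) hQ0
    exact (abs_sub _ _).trans (add_le_add (hgG t) h1)
  -- The term `q w` is moved into the source of `-∂² + λ²`; the resulting Lipschitz constant is `2 Q
  -- / λ² ≤ 1 / 2`. The Green formula is bounded only for `Y ≥ 0`, so it is frozen at its value at 0
  -- for negative Y.
  let Φ : BoundedContinuousFunction ℝ ℝ → BoundedContinuousFunction ℝ ℝ := fun w =>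
    BoundedContinuousFunction.ofNormedAddCommGroup
      (fun Y => greenSol lam b (fun t => g t - q t * w t) (max Y 0))
      ((continuous_iff_continuousAt.2 fun Y =>
        (hasDerivAt_greenSol hlam b (hsrc w).1 (hsrc w).2 Y).continuousAt).comp (by fun_prop))
      _ fun Y => abs_greenSol_le hlam b (hsrc w).2 (le_max_right Y 0)
  have hΦ : ContractingWith (1 / 2) Φ := by
    refine ⟨by rw [← NNReal.coe_lt_coe]; norm_num, LipschitzWith.of_dist_le_mul fun w₁ w₂ => ?_⟩
    rw [BoundedContinuousFunction.dist_le (by positivity)]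
    intro Y
    change |greenSol lam b (fun t => g t - q t * w₁ t) (max Y 0) -
      greenSol lam b (fun t => g t - q t * w₂ t) (max Y 0)| ≤ _
    rw [greenSol_sub hlam b (hsrc w₁).1 (hsrc w₁).2 (hsrc w₂).1 (hsrc w₂).2]
    refine (abs_greenSol_le hlam 0 (A := Q * dist w₁ w₂) (fun t => ?_) (le_max_right Y 0)).trans ?_
    · have : g t - q t * w₁ t - (g t - q t * w₂ t) = -(q t * (w₁ t - w₂ t)) := by ring
      rw [this, abs_neg, abs_mul]
      exact mul_le_mul (hqQ t) ((Real.dist_eq _ _).symm.trans_le (BoundedContinuousFunction.dist_coe_le_dist t)) (abs_nonneg _) hQ0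
    · rw [abs_zero, zero_add, div_le_iff₀ (by positivity)]
      have := mul_le_mul_of_nonneg_right hQ (dist_nonneg (x := w₁) (y := w₂))
      push_cast
      linarith
  set w := hΦ.fixedPoint
  have hw : Φ w = w := hΦ.fixedPoint_isFixedPt
  have hwY : ∀ Y, w Y = greenSol lam b (fun t => g t - q t * w t) (max Y 0) := fun Y => by
    conv_lhs => rw [← hw]
    rfl
  have hw0 : ∀ Y, 0 ≤ Y → w Y = greenSol lam b (fun t => g t - q t * w t) Y := fun Y hY => by
    rw [hwY, max_eq_left hY]
  -- The fixed point equation gives `‖w‖ ≤ |b| + 2 G / λ² + ‖w‖ / 2`, and the last term is absorbed.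
  have hbound : ‖w‖ ≤ 2 * |b| + 4 * G / lam ^ 2 := by
    have hG0 : 0 ≤ G := (abs_nonneg _).trans (hgG 0)
    have h1 : ‖w‖ ≤ |b| + 2 * (G + Q * ‖w‖) / lam ^ 2 := by
      rw [BoundedContinuousFunction.norm_le (by positivity)]
      intro Y
      rw [hwY]
      exact abs_greenSol_le hlam b (hsrc w).2 (le_max_right Y 0)
    have h2 : 2 * (Q * ‖w‖) / lam ^ 2 ≤ ‖w‖ / 2 := by
      rw [div_le_iff₀ (by positivity)]
      nlinarith [norm_nonneg w]
    have e : 2 * (G + Q * ‖w‖) / lam ^ 2 = 2 * G / lam ^ 2 + 2 * (Q * ‖w‖) / lam ^ 2 := by ring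
    have e2 : 4 * G / lam ^ 2 = 2 * (2 * G / lam ^ 2) := by ring
    linarith
  refine ⟨w, greenSolDeriv lam b (fun t => g t - q t * w t), w.continuous,
    fun Y => (w.norm_coe_le_norm Y).trans hbound, ?_, fun Y hY => ?_, fun Y hY => ?_⟩
  · rw [hw0 0 le_rfl, greenSol_zero]
  · exact (hasDerivAt_greenSol hlam b (hsrc w).1 (hsrc w).2 Y).hasDerivWithinAt.congr
      (fun Z hZ => hw0 Z hZ) (hw0 Y hY)
  · refine (hasDerivAt_greenSolDeriv hlam b (hsrc w).1 (hsrc w).2 Y).hasDerivWithinAt.congr_deriv ?_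
    rw [← hw0 Y hY]
    ring

/-! ### Second x-derivatives in integrated form -/

/-- The slope at `x = 0` of a function `e` whose second `x`-derivative is `e₂`. -/
def slope (L : ℝ) (e e₂ : ℝ × ℝ → ℝ) (Y : ℝ) : ℝ :=
  (e (L, Y) - e (0, Y) - ∫ s in (0 : ℝ)..L, (L - s) * e₂ (s, Y)) / L

/-- The `x`-derivative of a function `e` whose second `x`-derivative is `e₂`. -/
def xPrimitive (L : ℝ) (e e₂ : ℝ × ℝ → ℝ) (p : ℝ × ℝ) : ℝ :=
  slope L e e₂ p.2 + ∫ s in (0 : ℝ)..p.1, e₂ (s, p.2)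

/-- `e₂` is the second `x`-derivative of `e`, in integrated form. -/
def HasDxx (L : ℝ) (e e₂ : ℝ × ℝ → ℝ) : Prop :=
  ∀ p ∈ closedStrip L, e p = e (0, p.2) + slope L e e₂ p.2 * p.1
    + ∫ s in (0 : ℝ)..p.1, (p.1 - s) * e₂ (s, p.2)

section HasDxx

variable {L : ℝ} {e e₂ d d₂ : ℝ × ℝ → ℝ}

theorem continuous_integral_param {f : ℝ × ℝ → ℝ} (hf : Continuous f) {k : ℝ → ℝ}
    (hk : Continuous k) (a : ℝ) : Continuous fun Y => ∫ s in (0 : ℝ)..a, k s * f (s, Y) :=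
  intervalIntegral.continuous_parametric_intervalIntegral_of_continuous
    (f := fun Y s => k s * f (s, Y)) (by unfold Function.uncurry; fun_prop) continuous_const

theorem continuous_slope (he : Continuous e) (he₂ : Continuous e₂) :
    Continuous (slope L e e₂) := by
  have := continuous_integral_param he₂ (k := fun s => L - s) (by fun_prop) L
  unfold slope
  fun_prop

theorem continuous_xPrimitive (he : Continuous e) (he₂ : Continuous e₂) :
    Continuous (xPrimitive L e e₂) := by
  have h1 := continuous_slope (L := L) he he₂
  have h2 : Continuous fun p : ℝ × ℝ => ∫ s in (0 : ℝ)..p.1, e₂ (s, p.2) :=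
    intervalIntegral.continuous_parametric_intervalIntegral_of_continuous
      (f := fun (p : ℝ × ℝ) s => e₂ (s, p.2)) (by unfold Function.uncurry; fun_prop) continuous_fst
  unfold xPrimitive
  fun_prop

theorem HasDxx.hasDx (h : HasDxx L e e₂) (he₂ : Continuous e₂) :
    HasDx L e (xPrimitive L e e₂) := by
  intro p hp
  have d1 := hasDerivAt_double_primitive (H := fun s => e₂ (s, p.2)) (by fun_prop) p.1
  have d2 := ((hasDerivAt_id p.1).const_mul (slope L e e₂ p.2)).const_add (e (0, p.2))
  refine ((d2.add d1).hasDerivWithinAt.congr_deriv ?_).congr (fun s hs => ?_) ?_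
  · simp [xPrimitive]
  · exact h (s, p.2) ⟨hs, hp.2⟩
  · exact h p hp

theorem hasDx_xPrimitive (L : ℝ) (e : ℝ × ℝ → ℝ) (he₂ : Continuous e₂) :
    HasDx L (xPrimitive L e e₂) e₂ := fun p _ =>
  ((hasDerivAt_primitive (H := fun s => e₂ (s, p.2)) (by fun_prop) p.1).const_add
    (slope L e e₂ p.2)).hasDerivWithinAt

theorem hasDerivWithinAt_slope (hL : 0 < L) (he₂ : Continuous e₂)
    (hd₂ : Continuous d₂) (hed : HasDY L e d) (hed₂ : HasDY L e₂ d₂) {Y : ℝ} (hY : 0 ≤ Y) :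
    HasDerivWithinAt (slope L e e₂) (slope L d d₂ Y) (Ici 0) Y := by
  have h1 := hed (L, Y) ⟨⟨hL.le, le_rfl⟩, hY⟩
  have h2 := hed (0, Y) ⟨⟨le_rfl, hL.le⟩, hY⟩
  have h3 := hasDerivWithinAt_integral_param (k := fun s => L - s) he₂ hd₂ (by fun_prop) (x := L)
    (fun s hs t ht => hed₂ (s, t) ⟨by rwa [uIcc_of_le hL.le] at hs, ht⟩) hY
  exact ((h1.sub h2).sub h3).div_const L

theorem hasDY_xPrimitive (hL : 0 < L) (he₂ : Continuous e₂)
    (hd₂ : Continuous d₂) (hed : HasDY L e d) (hed₂ : HasDY L e₂ d₂) :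
    HasDY L (xPrimitive L e e₂) (xPrimitive L d d₂) := by
  intro p hp
  have h3 := hasDerivWithinAt_integral_param (k := fun _ => 1) he₂ hd₂ (by fun_prop) (x := p.1)
    (fun s hs t ht => hed₂ (s, t) ⟨by
      rw [uIcc_of_le hp.1.1] at hs
      exact ⟨hs.1, hs.2.trans hp.1.2⟩, ht⟩) hp.2
  simp only [one_mul] at h3
  exact (hasDerivWithinAt_slope hL he₂ hd₂ hed hed₂ hp.2).add h3

/-- The integrated identity can be differentiated in Y under the integral sign, so two x-derivatives
pass from a function to its Y-derivative. -/
theorem HasDxx.dY (hL : 0 < L) (h : HasDxx L e e₂) (he₂ : Continuous e₂)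
    (hd₂ : Continuous d₂) (hed : HasDY L e d) (hed₂ : HasDY L e₂ d₂) : HasDxx L d d₂ := by
  intro p hp
  have h0 := hed (0, p.2) ⟨⟨le_rfl, hL.le⟩, hp.2⟩
  have h3 := hasDerivWithinAt_integral_param (k := fun s => p.1 - s) he₂ hd₂ (by fun_prop)
    (x := p.1) (fun s hs t ht => hed₂ (s, t) ⟨by
      rw [uIcc_of_le hp.1.1] at hs
      exact ⟨hs.1, hs.2.trans hp.1.2⟩, ht⟩) hp.2
  have h4 := (h0.add ((hasDerivWithinAt_slope hL he₂ hd₂ hed hed₂ hp.2).mul_const p.1)).add h3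
  have h5 := (hed p hp).congr (fun t ht => (h (p.1, t) ⟨hp.1, ht⟩).symm) (h p hp).symm
  exact (uniqueDiffOn_Ici (0 : ℝ) _ hp.2).eq_deriv _ h5 h4

/-- The right-hand side has second derivative `g₂` and the end values of `g`, so by
`sinCoef_second_deriv` it has the sine coefficients of `g`; completeness concludes. -/
theorem eq_double_primitive_of_sinCoef (hL : 0 < L) {g g₂ : ℝ → ℝ} (hg : Continuous g)
    (hg₂ : Continuous g₂) (h : ∀ n : ℕ, n ≠ 0 → sinCoef L g₂ n = -freq L n ^ 2 * sinCoef L g n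
      + 2 / L * freq L n * (g 0 - (-1) ^ n * g L)) :
    ∀ x ∈ Icc 0 L, g x = g 0 + (g L - g 0 - ∫ s in (0 : ℝ)..L, (L - s) * g₂ s) / L * x
      + ∫ s in (0 : ℝ)..x, (x - s) * g₂ s := by
  set β := (g L - g 0 - ∫ s in (0 : ℝ)..L, (L - s) * g₂ s) / L with hβ
  set W : ℝ → ℝ := fun x => g 0 + β * x + ∫ s in (0 : ℝ)..x, (x - s) * g₂ s with hW
  have d1 : ∀ x, HasDerivAt W (β + ∫ s in (0 : ℝ)..x, g₂ s) x := fun x =>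
    ((((hasDerivAt_id x).const_mul β).const_add (g 0)).add
      (hasDerivAt_double_primitive hg₂ x)).congr_deriv (by simp)
  have d2 : ∀ x, HasDerivAt (fun x => β + ∫ s in (0 : ℝ)..x, g₂ s) (g₂ x) x := fun x =>
    (hasDerivAt_primitive hg₂ x).const_add β
  have hWc : Continuous W := continuous_iff_continuousAt.2 fun x => (d1 x).continuousAt
  have hW0 : W 0 = g 0 := by simp [hW]
  have hWL : W L = g L := by
    simp only [hW]
    rw [hβ, div_mul_cancel₀ _ hL.ne']
    ring
  refine eqOn_of_sinCoef_eq hL hg hWc fun n hn => ?_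
  have h1 := sinCoef_second_deriv hL hWc hg₂ (fun x _ => (d1 x).hasDerivWithinAt)
    (fun x _ => (d2 x).hasDerivWithinAt) n
  rw [hW0, hWL, h n hn] at h1
  have hf := freq_pos hL hn
  have h2 : freq L n ^ 2 * sinCoef L g n = freq L n ^ 2 * sinCoef L W n := by linarith
  exact mul_left_cancel₀ (by positivity) h2

end HasDxx

/-! ### Solving the tower of Dirichlet problems by sine series -/

/-- The data of the Dirichlet problems solved by `v, ∂ₓ² v, ∂ₓ⁴ v, …`. -/
structure IsDirichletTower (L Q : ℝ) (q : ℝ → ℝ) (f fx : ℕ → ℝ × ℝ → ℝ) (b V₀ V₁ : ℕ → ℝ → ℝ) :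
    Prop where
  q_cont : Continuous q
  q_bound : ∀ Y, |q Y| ≤ Q
  f_cont : ∀ j, Continuous (f j)
  f_bound : ∀ j, ∃ C, ∀ p, |f j p| ≤ C
  f_dx : ∀ j, HasDx L (f j) (fx j)
  fx_dx : ∀ j, HasDx L (fx j) (f (j + 1))
  b_cont : ∀ j, Continuous (b j)
  b_second : ∀ j, ∃ b' : ℝ → ℝ, (∀ x ∈ Icc 0 L, HasDerivWithinAt (b j) (b' x) (Icc 0 L) x) ∧
    ∀ x ∈ Icc 0 L, HasDerivWithinAt b' (b (j + 1) x) (Icc 0 L) x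
  V₀_cont : ∀ j, Continuous (V₀ j)
  V₁_cont : ∀ j, Continuous (V₁ j)
  V₀_bound : ∀ j, ∃ C, ∀ Y, |V₀ j Y| ≤ C
  V₁_bound : ∀ j, ∃ C, ∀ Y, |V₁ j Y| ≤ C
  V₀_second : ∀ j, ∃ V' : ℝ → ℝ, (∀ Y, 0 ≤ Y → HasDerivWithinAt (V₀ j) (V' Y) (Ici 0) Y) ∧
    ∀ Y, 0 ≤ Y → HasDerivWithinAt V' (q Y * V₀ j Y - f j (0, Y) - V₀ (j + 1) Y) (Ici 0) Y
  V₁_second : ∀ j, ∃ V' : ℝ → ℝ, (∀ Y, 0 ≤ Y → HasDerivWithinAt (V₁ j) (V' Y) (Ici 0) Y) ∧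
    ∀ Y, 0 ≤ Y → HasDerivWithinAt V' (q Y * V₁ j Y - f j (L, Y) - V₁ (j + 1) Y) (Ici 0) Y
  corner₀ : ∀ j, V₀ j 0 = b j 0
  corner₁ : ∀ j, V₁ j 0 = b j L

theorem freq_one_le {L : ℝ} (hL : 0 < L) {n : ℕ} (hn : n ≠ 0) : freq L 1 ≤ freq L n := by
  have : (1 : ℝ) ≤ n := by exact_mod_cast Nat.one_le_iff_ne_zero.2 hn
  have hpi := Real.pi_pos
  unfold freq
  gcongr
  exact_mod_cast this

theorem summable_inv_freq_sq (L : ℝ) : Summable fun n => (freq L n ^ 2)⁻¹ := by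
  have h := (Real.summable_one_div_nat_pow.2 (one_lt_two)).mul_left ((Real.pi / L) ^ 2)⁻¹
  refine h.congr fun n => ?_
  rw [freq, mul_div_assoc, mul_pow, mul_inv, one_div]
  ring

/-- Thinness puts all frequencies in the contractive regime: `freq L n ^ 2 ≥ π² / L² ≥ 4 K`. -/
theorem four_mul_le_freq_sq {L K Q : ℝ} (hL : 0 < L) (hK : Q < K) (hKL : K * L ^ 2 ≤ 1) {n : ℕ}
    (hn : n ≠ 0) : 4 * Q ≤ freq L n ^ 2 := by
  have h1 : (freq L 1) ^ 2 ≤ freq L n ^ 2 :=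
    pow_le_pow_left₀ (freq_pos hL one_ne_zero).le (freq_one_le hL hn) 2
  have h2 : K ≤ 1 / L ^ 2 := by rwa [le_div_iff₀ (by positivity)]
  have h3 : freq L 1 ^ 2 = Real.pi ^ 2 * (1 / L ^ 2) := by simp [freq]; ring
  have h4 : 4 ≤ Real.pi ^ 2 := by nlinarith [Real.pi_gt_three]
  have h5 : 0 < 1 / L ^ 2 := by positivity
  nlinarith

/-- The sine coefficients in `x` of the solutions. -/
structure IsCoefTower (L : ℝ) (q : ℝ → ℝ) (f : ℕ → ℝ × ℝ → ℝ) (b V₀ V₁ : ℕ → ℝ → ℝ)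
    (z z' : ℕ → ℕ → ℝ → ℝ) : Prop where
  cont : ∀ j n, Continuous (z j n)
  bound : ∀ j, ∃ C, ∀ n Y, |z j n Y| ≤ C
  init : ∀ j n, n ≠ 0 → z j n 0 = sinCoef L (b j) n
  deriv : ∀ j n, n ≠ 0 → ∀ Y, 0 ≤ Y → HasDerivWithinAt (z j n) (z' j n Y) (Ici 0) Y
  deriv₂ : ∀ j n, n ≠ 0 → ∀ Y, 0 ≤ Y → HasDerivWithinAt (z' j n)
    ((freq L n ^ 2 + q Y) * z j n Y - (sinCoef L (fun x => f j (x, Y)) n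
      + 2 / L * freq L n * (V₀ j Y - (-1) ^ n * V₁ j Y))) (Ici 0) Y

section Tower

variable {L K Q : ℝ} {q : ℝ → ℝ} {f fx : ℕ → ℝ × ℝ → ℝ} {b V₀ V₁ : ℕ → ℝ → ℝ}

/-- The differential equation is the n-th sine coefficient of the j-th problem. Its boundary term
grows like the frequency, but the solution operator gains two powers, so the bound is uniform in n.
-/
theorem IsDirichletTower.exists_coef (hL : 0 < L) (hK : Q < K) (hKL : K * L ^ 2 ≤ 1)
    (T : IsDirichletTower L Q q f fx b V₀ V₁) :
    ∃ z z' : ℕ → ℕ → ℝ → ℝ, IsCoefTower L q f b V₀ V₁ z z' := by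
  have hQ : 0 ≤ Q := (abs_nonneg _).trans (T.q_bound 0)
  choose Cf hCf using T.f_bound
  choose C₀ hC₀ using T.V₀_bound
  choose C₁ hC₁ using T.V₁_bound
  have hbb : ∀ j, ∃ C, ∀ x ∈ Icc 0 L, |b j x| ≤ C := fun j =>
    isCompact_Icc.exists_bound_of_continuousOn (T.b_cont j).continuousOn
  choose Cb hCb using hbb
  have hg : ∀ j n Y, |sinCoef L (fun x => f j (x, Y)) n
      + 2 / L * freq L n * (V₀ j Y - (-1) ^ n * V₁ j Y)| ≤
      2 * Cf j + 2 / L * freq L n * (C₀ j + C₁ j) := by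
    intro j n Y
    have hfr : 0 ≤ freq L n := by unfold freq; have := Real.pi_pos; positivity
    have h1 : |V₀ j Y - (-1) ^ n * V₁ j Y| ≤ C₀ j + C₁ j := by
      refine (abs_sub _ _).trans (add_le_add (hC₀ j Y) ?_)
      rw [abs_mul, abs_pow, abs_neg, abs_one, one_pow, one_mul]
      exact hC₁ j Y
    refine (abs_add_le _ _).trans (add_le_add (abs_sinCoef_le hL (fun x _ => hCf j _) n) ?_)
    rw [abs_mul, abs_of_nonneg (by positivity)]
    gcongr
  have key : ∀ j n, ∃ z z' : ℝ → ℝ, Continuous z ∧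
      (∀ Y, |z Y| ≤ 4 * Cb j + 8 * Cf j / freq L 1 ^ 2 + 8 / L * (C₀ j + C₁ j) / freq L 1) ∧
      (n ≠ 0 → z 0 = sinCoef L (b j) n ∧
      (∀ Y, 0 ≤ Y → HasDerivWithinAt z (z' Y) (Ici 0) Y) ∧
      ∀ Y, 0 ≤ Y → HasDerivWithinAt z' ((freq L n ^ 2 + q Y) * z Y -
        (sinCoef L (fun x => f j (x, Y)) n
          + 2 / L * freq L n * (V₀ j Y - (-1) ^ n * V₁ j Y))) (Ici 0) Y) := by
    intro j n
    have hCf0 : 0 ≤ Cf j := (abs_nonneg _).trans (hCf j 0)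
    have hCb0 : 0 ≤ Cb j := (abs_nonneg _).trans (hCb j 0 ⟨le_rfl, hL.le⟩)
    have hC00 : 0 ≤ C₀ j := (abs_nonneg _).trans (hC₀ j 0)
    have hC10 : 0 ≤ C₁ j := (abs_nonneg _).trans (hC₁ j 0)
    have h1 := freq_pos hL one_ne_zero
    rcases eq_or_ne n 0 with rfl | hn
    · exact ⟨fun _ => 0, fun _ => 0, continuous_const, fun Y => by rw [abs_zero]; positivity,
        fun h => absurd rfl h⟩
    have hn0 := freq_pos hL hn
    obtain ⟨z, z', hz, hzb, hz0, hz1, hz2⟩ := exists_bounded_ode_solution hn0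
      (four_mul_le_freq_sq hL hK hKL hn) T.q_cont T.q_bound
      (g := fun Y => sinCoef L (fun x => f j (x, Y)) n
        + 2 / L * freq L n * (V₀ j Y - (-1) ^ n * V₁ j Y))
      (by
        have c1 := continuous_sinCoef (L := L) (T.f_cont j) n
        have c2 := T.V₀_cont j
        have c3 := T.V₁_cont j
        fun_prop) (hg j n) (sinCoef L (b j) n)
    refine ⟨z, z', hz, fun Y => (hzb Y).trans ?_, fun _ => ⟨hz0, hz1, hz2⟩⟩
    have e1 := abs_sinCoef_le hL (hCb j) n
    have e2 : 4 * (2 * Cf j + 2 / L * freq L n * (C₀ j + C₁ j)) / freq L n ^ 2 =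
        8 * Cf j / freq L n ^ 2 + 8 / L * (C₀ j + C₁ j) / freq L n := by
      field_simp; ring
    have hle := freq_one_le hL hn
    have e3 : 8 * Cf j / freq L n ^ 2 ≤ 8 * Cf j / freq L 1 ^ 2 := by gcongr
    have e4 : 8 / L * (C₀ j + C₁ j) / freq L n ≤ 8 / L * (C₀ j + C₁ j) / freq L 1 := by gcongr
    linarith
  choose z z' h1 h2 h3 using key
  exact ⟨z, z', h1, fun j => ⟨_, fun n Y => h2 j n Y⟩, fun j n hn => (h3 j n hn).1,
    fun j n hn => (h3 j n hn).2.1, fun j n hn => (h3 j n hn).2.2⟩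

variable {z z' : ℕ → ℕ → ℝ → ℝ}

/-- The difference of the two sides is bounded and solves the homogeneous equation, by the equations
for the side data; it vanishes at `Y = 0` because the corner values match. Hence
`eq_zero_of_halfLine` applies. The relation also shows how the coefficients decay in n. -/
theorem IsCoefTower.succ_eq (hL : 0 < L) (hK : Q < K) (hKL : K * L ^ 2 ≤ 1)
    (T : IsDirichletTower L Q q f fx b V₀ V₁) (Z : IsCoefTower L q f b V₀ V₁ z z')
    (j : ℕ) {n : ℕ} (hn : n ≠ 0) {Y : ℝ} (hY : 0 ≤ Y) :
    z (j + 1) n Y = -freq L n ^ 2 * z j n Y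
      + 2 / L * freq L n * (V₀ j Y - (-1) ^ n * V₁ j Y) := by
  have hQ : 0 ≤ Q := (abs_nonneg _).trans (T.q_bound 0)
  obtain ⟨V₀', hV₀, hV₀'⟩ := T.V₀_second j
  obtain ⟨V₁', hV₁, hV₁'⟩ := T.V₁_second j
  obtain ⟨b', hb, hb'⟩ := T.b_second j
  have hf : ∀ t, 0 ≤ t → sinCoef L (fun x => f (j + 1) (x, t)) n =
      -freq L n ^ 2 * sinCoef L (fun x => f j (x, t)) n
      + 2 / L * freq L n * (f j (0, t) - (-1) ^ n * f j (L, t)) := fun t ht =>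
    sinCoef_second_deriv hL (g' := fun x => fx j (x, t))
      (by have := T.f_cont j; fun_prop) (by have := T.f_cont (j + 1); fun_prop)
      (fun x hx => T.f_dx j (x, t) ⟨hx, ht⟩) (fun x hx => T.fx_dx j (x, t) ⟨hx, ht⟩) n
  have hbc : sinCoef L (b (j + 1)) n = -freq L n ^ 2 * sinCoef L (b j) n
      + 2 / L * freq L n * (b j 0 - (-1) ^ n * b j L) :=
    sinCoef_second_deriv hL (T.b_cont j) (T.b_cont (j + 1)) hb hb' n
  obtain ⟨A, hA⟩ := Z.bound j
  obtain ⟨A', hA'⟩ := Z.bound (j + 1)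
  obtain ⟨C₀, hC₀⟩ := T.V₀_bound j
  obtain ⟨C₁, hC₁⟩ := T.V₁_bound j
  set lam := freq L n with hlam
  have hlam0 : 0 < lam := freq_pos hL hn
  have hz := eq_zero_of_halfLine hL hQ hK hKL (q := q) (fun Y _ => T.q_bound Y) n hn
    (d := fun t => z (j + 1) n t + lam ^ 2 * z j n t
      - 2 / L * lam * (V₀ j t - (-1) ^ n * V₁ j t))
    (d'' := fun t => (lam ^ 2 + q t) * (z (j + 1) n t + lam ^ 2 * z j n t
      - 2 / L * lam * (V₀ j t - (-1) ^ n * V₁ j t))) ?_ ?_ ?_ ?_ ?_ hY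
  · linarith
  · have c1 := Z.cont j n
    have c2 := Z.cont (j + 1) n
    have c3 := T.V₀_cont j
    have c4 := T.V₁_cont j
    fun_prop
  · refine ⟨A' + lam ^ 2 * A + 2 / L * lam * (C₀ + C₁), fun t _ => ?_⟩
    refine (abs_sub _ _).trans (add_le_add ((abs_add_le _ _).trans (add_le_add (hA' n t) ?_)) ?_)
    · rw [abs_mul, abs_of_pos (by positivity)]
      exact mul_le_mul_of_nonneg_left (hA n t) (by positivity)
    · rw [abs_mul, abs_of_pos (by positivity)]
      refine mul_le_mul_of_nonneg_left ((abs_sub _ _).trans (add_le_add (hC₀ t) ?_)) (by positivity)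
      rw [abs_mul, abs_pow, abs_neg, abs_one, one_pow, one_mul]
      exact hC₁ t
  · intro t ht
    refine HasD2At.of_hasDerivWithinAt (s := Ici 0)
      (g' := fun t => z' (j + 1) n t + lam ^ 2 * z' j n t
        - 2 / L * lam * (V₀' t - (-1) ^ n * V₁' t))
      (g'' := fun t => (lam ^ 2 + q t) * (z (j + 1) n t + lam ^ 2 * z j n t
        - 2 / L * lam * (V₀ j t - (-1) ^ n * V₁ j t))) (fun s hs => ?_) (fun s hs => ?_)
      (Ici_mem_nhds ht)
    · exact ((Z.deriv (j + 1) n hn s hs).add ((Z.deriv j n hn s hs).const_mul _)).sub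
        (((hV₀ s hs).sub ((hV₁ s hs).const_mul _)).const_mul _)
    · refine (((Z.deriv₂ (j + 1) n hn s hs).add ((Z.deriv₂ j n hn s hs).const_mul _)).sub
        (((hV₀' s hs).sub ((hV₁' s hs).const_mul _)).const_mul _)).congr_deriv ?_
      rw [hf s hs]
      ring
  · exact fun t _ => rfl
  · rw [Z.init j n hn, Z.init (j + 1) n hn, hbc, T.corner₀, T.corner₁]
    ring

/-- The solution of the `j`-th Dirichlet problem. -/
def towerSol (L : ℝ) (V₀ V₁ : ℕ → ℝ → ℝ) (z : ℕ → ℕ → ℝ → ℝ) (j : ℕ) (p : ℝ × ℝ) : ℝ :=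
  V₀ j p.2 + (V₁ j p.2 - V₀ j p.2) * (p.1 / L)
    - ∑' n, z (j + 1) n p.2 * (freq L n ^ 2)⁻¹ * Real.sin (freq L n * p.1)

theorem IsCoefTower.term_le (Z : IsCoefTower L q f b V₀ V₁ z z') (j : ℕ) :
    ∃ C, ∀ n Y, |z j n Y * (freq L n ^ 2)⁻¹| ≤ C * (freq L n ^ 2)⁻¹ := by
  obtain ⟨C, hC⟩ := Z.bound j
  refine ⟨C, fun n Y => ?_⟩
  rw [abs_mul, abs_of_nonneg (by positivity : 0 ≤ (freq L n ^ 2)⁻¹)]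
  exact mul_le_mul_of_nonneg_right (hC n Y) (by positivity)

theorem continuous_towerSol (T : IsDirichletTower L Q q f fx b V₀ V₁)
    (Z : IsCoefTower L q f b V₀ V₁ z z') (j : ℕ) : Continuous (towerSol L V₀ V₁ z j) := by
  obtain ⟨C, hC⟩ := Z.term_le (j + 1)
  have h1 := continuous_sine_series (L := L) ((summable_inv_freq_sq L).mul_left C)
    (fun n => (Z.cont (j + 1) n).mul_const _) hC
  have c3 := T.V₀_cont j
  have c4 := T.V₁_cont j
  unfold towerSol
  fun_prop

/-- The affine part contributes the boundary term of `IsCoefTower.succ_eq` divided by the squared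
frequency, the series the rest. Building `towerSol` from the coefficients of the next level is what
makes it absolutely convergent. -/
theorem sinCoef_towerSol (hL : 0 < L) (hK : Q < K) (hKL : K * L ^ 2 ≤ 1)
    (T : IsDirichletTower L Q q f fx b V₀ V₁) (Z : IsCoefTower L q f b V₀ V₁ z z')
    (j : ℕ) {n : ℕ} (hn : n ≠ 0) {Y : ℝ} (hY : 0 ≤ Y) :
    sinCoef L (fun x => towerSol L V₀ V₁ z j (x, Y)) n = z j n Y := by
  obtain ⟨C, hC⟩ := Z.term_le (j + 1)
  have hs := ((summable_inv_freq_sq L).mul_left C)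
  have hc := continuous_sine_series (L := L) hs (fun n => (Z.cont (j + 1) n).mul_const _) hC
  -- The term of index 0 is harmless: its frequency is 0, and so is the inverse of that.
  have hser := sinCoef_series hL (a := fun n => z (j + 1) n Y * (freq L n ^ 2)⁻¹)
    (Summable.of_nonneg_of_le (fun n => abs_nonneg _) (fun n => hC n Y) hs) (by simp [freq]) hn
  have hsub := sinCoef_sub (L := L) (f := fun x => V₀ j Y + (V₁ j Y - V₀ j Y) * (x / L))
    (g := fun x => ∑' n, z (j + 1) n Y * (freq L n ^ 2)⁻¹ * Real.sin (freq L n * x))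
    (by fun_prop) (hc.comp (by fun_prop : Continuous fun x : ℝ => (x, Y))) n
  have hf := (freq_pos hL hn).ne'
  rw [hser, sinCoef_affine hL _ _ hn, Z.succ_eq hL hK hKL T j hn hY] at hsub
  refine hsub.trans ?_
  field_simp
  ring

theorem towerSol_left (j : ℕ) (Y : ℝ) : towerSol L V₀ V₁ z j (0, Y) = V₀ j Y := by
  simp [towerSol]

theorem towerSol_right (hL : 0 < L) (j : ℕ) (Y : ℝ) : towerSol L V₀ V₁ z j (L, Y) = V₁ j Y := by
  simp only [towerSol, freq_mul_self hL, Real.sin_nat_mul_pi]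
  simp [hL.ne']

theorem towerSol_bottom (hL : 0 < L) (hK : Q < K) (hKL : K * L ^ 2 ≤ 1)
    (T : IsDirichletTower L Q q f fx b V₀ V₁) (Z : IsCoefTower L q f b V₀ V₁ z z')
    (j : ℕ) {x : ℝ} (hx : x ∈ Icc 0 L) : towerSol L V₀ V₁ z j (x, 0) = b j x := by
  have hc := continuous_towerSol T Z j
  refine eqOn_of_sinCoef_eq hL (f := fun x => towerSol L V₀ V₁ z j (x, 0)) (by fun_prop)
    (T.b_cont j) (fun n hn => ?_) hx
  rw [sinCoef_towerSol hL hK hKL T Z j hn le_rfl, Z.init j n hn]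

theorem exists_bound_towerSol (hL : 0 < L) (T : IsDirichletTower L Q q f fx b V₀ V₁)
    (Z : IsCoefTower L q f b V₀ V₁ z z') (j : ℕ) :
    ∃ C, ∀ p ∈ closedStrip L, |towerSol L V₀ V₁ z j p| ≤ C := by
  obtain ⟨C, hC⟩ := Z.term_le (j + 1)
  have hs := ((summable_inv_freq_sq L).mul_left C)
  obtain ⟨C₀, hC₀⟩ := T.V₀_bound j
  obtain ⟨C₁, hC₁⟩ := T.V₁_bound j
  refine ⟨C₀ + (C₁ + C₀) + ∑' n, C * (freq L n ^ 2)⁻¹, fun p hp => ?_⟩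
  refine (abs_sub _ _).trans (add_le_add ((abs_add_le _ _).trans (add_le_add (hC₀ _) ?_)) ?_)
  · have h1 : p.1 / L ≤ 1 := (div_le_one hL).2 hp.1.2
    have h2 : 0 ≤ p.1 / L := div_nonneg hp.1.1 hL.le
    rw [abs_mul, abs_of_nonneg h2]
    exact (mul_le_of_le_one_right (abs_nonneg _) h1).trans
      ((abs_sub _ _).trans (add_le_add (hC₁ _) (hC₀ _)))
  · rw [← Real.norm_eq_abs]
    refine tsum_of_norm_bounded hs.hasSum fun n => ?_
    rw [Real.norm_eq_abs, abs_mul]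
    exact (mul_le_of_le_one_right (abs_nonneg _) (Real.abs_sin_le_one _)).trans (hC n _)

theorem hasDxx_towerSol (hL : 0 < L) (hK : Q < K) (hKL : K * L ^ 2 ≤ 1)
    (T : IsDirichletTower L Q q f fx b V₀ V₁) (Z : IsCoefTower L q f b V₀ V₁ z z') (j : ℕ) :
    HasDxx L (towerSol L V₀ V₁ z j) (towerSol L V₀ V₁ z (j + 1)) := by
  intro p hp
  have hc := continuous_towerSol T Z j
  have hc' := continuous_towerSol T Z (j + 1)
  refine eq_double_primitive_of_sinCoef hL (g := fun x => towerSol L V₀ V₁ z j (x, p.2))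
    (g₂ := fun x => towerSol L V₀ V₁ z (j + 1) (x, p.2)) (by fun_prop) (by fun_prop)
    (fun n hn => ?_) p.1 hp.1
  rw [sinCoef_towerSol hL hK hKL T Z j hn hp.2, sinCoef_towerSol hL hK hKL T Z (j + 1) hn hp.2,
    Z.succ_eq hL hK hKL T j hn hp.2, towerSol_left, towerSol_right hL]

/-- The second `Y`-derivative of the solution of the `j`-th problem. -/
def towerDYY (q : ℝ → ℝ) (f E : ℕ → ℝ × ℝ → ℝ) (j : ℕ) (p : ℝ × ℝ) : ℝ :=
  -E (j + 1) p + q p.2 * E j p - f j p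

/-- The `Y`-derivative of the solution of the `j`-th problem. -/
def towerDY (q : ℝ → ℝ) (f E : ℕ → ℝ × ℝ → ℝ) (j : ℕ) (p : ℝ × ℝ) : ℝ :=
  (E j (p.1, 1) - E j (p.1, 0) - ∫ t in (0 : ℝ)..1, (1 - t) * towerDYY q f E j (p.1, t))
    + ∫ t in (0 : ℝ)..p.2, towerDYY q f E j (p.1, t)

theorem continuous_towerDYY (T : IsDirichletTower L Q q f fx b V₀ V₁) {E : ℕ → ℝ × ℝ → ℝ}
    (hE : ∀ j, Continuous (E j)) (j : ℕ) : Continuous (towerDYY q f E j) := by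
  have c1 := hE j
  have c2 := hE (j + 1)
  have c3 := T.f_cont j
  have c4 := T.q_cont
  unfold towerDYY
  fun_prop

theorem continuous_towerDY (T : IsDirichletTower L Q q f fx b V₀ V₁) {E : ℕ → ℝ × ℝ → ℝ}
    (hE : ∀ j, Continuous (E j)) (j : ℕ) : Continuous (towerDY q f E j) := by
  have c1 := hE j
  have c2 := continuous_towerDYY T hE j
  have c3 : Continuous fun p : ℝ × ℝ => ∫ t in (0 : ℝ)..p.2, towerDYY q f E j (p.1, t) :=
    intervalIntegral.continuous_parametric_intervalIntegral_of_continuous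
      (f := fun (p : ℝ × ℝ) t => towerDYY q f E j (p.1, t))
      (by unfold Function.uncurry; fun_prop) continuous_snd
  have c4 : Continuous fun p : ℝ × ℝ => ∫ t in (0 : ℝ)..1, (1 - t) * towerDYY q f E j (p.1, t) :=
    intervalIntegral.continuous_parametric_intervalIntegral_of_continuous
      (f := fun (p : ℝ × ℝ) t => (1 - t) * towerDYY q f E j (p.1, t))
      (by unfold Function.uncurry; fun_prop) continuous_const
  unfold towerDY
  fun_prop

theorem sinCoef_towerDYY (hL : 0 < L) (hK : Q < K) (hKL : K * L ^ 2 ≤ 1)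
    (T : IsDirichletTower L Q q f fx b V₀ V₁) (Z : IsCoefTower L q f b V₀ V₁ z z')
    (j : ℕ) {n : ℕ} (hn : n ≠ 0) {Y : ℝ} (hY : 0 ≤ Y) :
    sinCoef L (fun x => towerDYY q f (towerSol L V₀ V₁ z) j (x, Y)) n =
      (freq L n ^ 2 + q Y) * z j n Y - (sinCoef L (fun x => f j (x, Y)) n
      + 2 / L * freq L n * (V₀ j Y - (-1) ^ n * V₁ j Y)) := by
  have c1 := continuous_towerSol T Z j
  have c2 := continuous_towerSol T Z (j + 1)
  have c3 := T.f_cont j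
  simp only [towerDYY]
  rw [sinCoef_sub (by fun_prop) (by fun_prop), sinCoef_add (by fun_prop) (by fun_prop),
    sinCoef_neg, sinCoef_const_mul, sinCoef_towerSol hL hK hKL T Z j hn hY,
    sinCoef_towerSol hL hK hKL T Z (j + 1) hn hY, Z.succ_eq hL hK hKL T j hn hY]
  ring

/-- On each sine coefficient this is Taylor's formula on `[0, Y]`, with the slope at 0 eliminated by
the same formula on `[0, 1]`. The elimination avoids summing the `z'`, for which `IsCoefTower`
records no bound. -/
theorem towerSol_eq_double_primitive (hL : 0 < L) (hK : Q < K) (hKL : K * L ^ 2 ≤ 1)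
    (T : IsDirichletTower L Q q f fx b V₀ V₁) (Z : IsCoefTower L q f b V₀ V₁ z z') (j : ℕ)
    {p : ℝ × ℝ} (hp : p ∈ closedStrip L) :
    towerSol L V₀ V₁ z j p = towerSol L V₀ V₁ z j (p.1, 0) +
      (towerSol L V₀ V₁ z j (p.1, 1) - towerSol L V₀ V₁ z j (p.1, 0) - ∫ t in (0 : ℝ)..1,
        (1 - t) * towerDYY q f (towerSol L V₀ V₁ z) j (p.1, t)) * p.2 +
      ∫ t in (0 : ℝ)..p.2, (p.2 - t) * towerDYY q f (towerSol L V₀ V₁ z) j (p.1, t) := by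
  set E := towerSol L V₀ V₁ z with hE
  have cE := continuous_towerSol T Z
  have c1 : Continuous (E j) := cE j
  have c2 : Continuous (towerDYY q f E j) := continuous_towerDYY T cE j
  have cint : ∀ Y, Continuous fun x => ∫ t in (0 : ℝ)..Y, (Y - t) * towerDYY q f E j (x, t) :=
    fun Y => intervalIntegral.continuous_parametric_intervalIntegral_of_continuous
      (f := fun x t => (Y - t) * towerDYY q f E j (x, t))
      (by unfold Function.uncurry; fun_prop) continuous_const
  have hint : ∀ n, n ≠ 0 → ∀ Y, 0 ≤ Y →
      sinCoef L (fun x => ∫ t in (0 : ℝ)..Y, (Y - t) * towerDYY q f E j (x, t)) n =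
        z j n Y - z j n 0 - Y * z' j n 0 := by
    intro n hn Y hY
    rw [sinCoef_integral c2 (k := fun t => Y - t) (by fun_prop)]
    rw [← eq_double_primitive_of_second_deriv hY (g := z j n) (g' := z' j n)
      (g'' := fun Y => (freq L n ^ 2 + q Y) * z j n Y - (sinCoef L (fun x => f j (x, Y)) n
      + 2 / L * freq L n * (V₀ j Y - (-1) ^ n * V₁ j Y)))]
    · refine intervalIntegral.integral_congr fun t ht => ?_
      rw [uIcc_of_le hY] at ht
      simp only [sinCoef_towerDYY hL hK hKL T Z j hn ht.1, hE]
    · have d1 := continuous_sinCoef (L := L) (T.f_cont j) n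
      have d2 := T.V₀_cont j
      have d3 := T.V₁_cont j
      have d4 := T.q_cont
      have d5 := Z.cont j n
      fun_prop
    · exact fun t ht => (Z.deriv j n hn t ht.1).mono Icc_subset_Ici_self
    · exact fun t ht => (Z.deriv₂ j n hn t ht.1).mono Icc_subset_Ici_self
  have ci1 := cint 1
  have ci2 := cint p.2
  refine eqOn_of_sinCoef_eq hL (f := fun x => E j (x, p.2)) (g := fun x => E j (x, 0) +
      (E j (x, 1) - E j (x, 0) - ∫ t in (0 : ℝ)..1, (1 - t) * towerDYY q f E j (x, t)) * p.2 +
      ∫ t in (0 : ℝ)..p.2, (p.2 - t) * towerDYY q f E j (x, t))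
    (by fun_prop) (by fun_prop) (fun n hn => ?_) hp.1
  rw [sinCoef_add (by fun_prop) (by fun_prop), sinCoef_add (by fun_prop) (by fun_prop),
    sinCoef_mul_const, sinCoef_sub (by fun_prop) (by fun_prop),
    sinCoef_sub (by fun_prop) (by fun_prop), hint n hn _ hp.2, hint n hn _ zero_le_one]
  simp only [hE]
  rw [sinCoef_towerSol hL hK hKL T Z j hn hp.2, sinCoef_towerSol hL hK hKL T Z j hn le_rfl,
    sinCoef_towerSol hL hK hKL T Z j hn zero_le_one]
  ring

theorem hasDY_towerSol (hL : 0 < L) (hK : Q < K) (hKL : K * L ^ 2 ≤ 1)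
    (T : IsDirichletTower L Q q f fx b V₀ V₁) (Z : IsCoefTower L q f b V₀ V₁ z z') (j : ℕ) :
    HasDY L (towerSol L V₀ V₁ z j) (towerDY q f (towerSol L V₀ V₁ z) j) := by
  intro p hp
  have c2 := continuous_towerDYY T (continuous_towerSol T Z) j
  have d1 := hasDerivAt_double_primitive
    (H := fun t => towerDYY q f (towerSol L V₀ V₁ z) j (p.1, t)) (by fun_prop) p.2
  have d2 := ((hasDerivAt_id p.2).const_mul (towerSol L V₀ V₁ z j (p.1, 1) -
    towerSol L V₀ V₁ z j (p.1, 0) - ∫ t in (0 : ℝ)..1,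
      (1 - t) * towerDYY q f (towerSol L V₀ V₁ z) j (p.1, t))).const_add
    (towerSol L V₀ V₁ z j (p.1, 0))
  refine ((d2.add d1).hasDerivWithinAt.congr_deriv ?_).congr (fun t ht => ?_) ?_
  · simp [towerDY]
  · exact towerSol_eq_double_primitive hL hK hKL T Z j (p := (p.1, t)) ⟨hp.1, ht⟩
  · exact towerSol_eq_double_primitive hL hK hKL T Z j hp

theorem hasDY_towerDY (T : IsDirichletTower L Q q f fx b V₀ V₁)
    {E : ℕ → ℝ × ℝ → ℝ} (hE : ∀ j, Continuous (E j)) (j : ℕ) :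
    HasDY L (towerDY q f E j) (towerDYY q f E j) := fun p _ =>
  ((hasDerivAt_primitive (H := fun t => towerDYY q f E j (p.1, t))
    (by have := continuous_towerDYY T hE j; fun_prop) p.2).const_add
    (E j (p.1, 1) - E j (p.1, 0) -
      ∫ t in (0 : ℝ)..1, (1 - t) * towerDYY q f E j (p.1, t))).hasDerivWithinAt

end Tower

/-! ### The closed first-order system and smoothness up to the boundary -/

/-- Solutions `E j` of the Dirichlet problems for `∂ₓ^{2j} v`, with first derivatives `X j` and
`D j` in `x` and `Y` and mixed derivative `M j`. -/
structure IsTowerSolution (L : ℝ) (q : ℝ → ℝ) (f fx : ℕ → ℝ × ℝ → ℝ) (b V₀ V₁ : ℕ → ℝ → ℝ)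
    (E X D M : ℕ → ℝ × ℝ → ℝ) : Prop where
  bounded : ∀ j, ∃ C, ∀ p ∈ closedStrip L, |E j p| ≤ C
  left : ∀ j Y, 0 ≤ Y → E j (0, Y) = V₀ j Y
  right : ∀ j Y, 0 ≤ Y → E j (L, Y) = V₁ j Y
  bottom : ∀ j, ∀ x ∈ Icc 0 L, E j (x, 0) = b j x
  contE : ∀ j, ContinuousOn (E j) (closedStrip L)
  contX : ∀ j, ContinuousOn (X j) (closedStrip L)
  contD : ∀ j, ContinuousOn (D j) (closedStrip L)
  contM : ∀ j, ContinuousOn (M j) (closedStrip L)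
  E_dx : ∀ j, HasDx L (E j) (X j)
  X_dx : ∀ j, HasDx L (X j) (E (j + 1))
  D_dx : ∀ j, HasDx L (D j) (M j)
  M_dx : ∀ j, HasDx L (M j) (D (j + 1))
  E_dY : ∀ j, HasDY L (E j) (D j)
  X_dY : ∀ j, HasDY L (X j) (M j)
  D_dY : ∀ j, HasDY L (D j) (fun p => -E (j + 1) p + q p.2 * E j p - f j p)
  M_dY : ∀ j, HasDY L (M j) (fun p => -X (j + 1) p + q p.2 * X j p - fx j p)

theorem IsDirichletTower.exists_solution {L K Q : ℝ} {q : ℝ → ℝ} {f fx : ℕ → ℝ × ℝ → ℝ}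
    {b V₀ V₁ : ℕ → ℝ → ℝ} (hL : 0 < L) (hK : Q < K) (hKL : K * L ^ 2 ≤ 1)
    (T : IsDirichletTower L Q q f fx b V₀ V₁) :
    ∃ E X D M : ℕ → ℝ × ℝ → ℝ, IsTowerSolution L q f fx b V₀ V₁ E X D M := by
  obtain ⟨z, z', Z⟩ := T.exists_coef hL hK hKL
  set E := towerSol L V₀ V₁ z with hE
  have cE : ∀ j, Continuous (E j) := continuous_towerSol T Z
  have cH : ∀ j, Continuous (towerDYY q f E j) := continuous_towerDYY T cE
  have cD : ∀ j, Continuous (towerDY q f E j) := continuous_towerDY T cE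
  have hxx : ∀ j, HasDxx L (E j) (E (j + 1)) := hasDxx_towerSol hL hK hKL T Z
  have hED : ∀ j, HasDY L (E j) (towerDY q f E j) := hasDY_towerSol hL hK hKL T Z
  have hDH : ∀ j, HasDY L (towerDY q f E j) (towerDYY q f E j) := hasDY_towerDY T cE
  have hDxx : ∀ j, HasDxx L (towerDY q f E j) (towerDY q f E (j + 1)) := fun j =>
    (hxx j).dY hL (cE _) (cD _) (hED j) (hED (j + 1))
  have hHxx : ∀ j, HasDxx L (towerDYY q f E j) (towerDYY q f E (j + 1)) := fun j =>
    (hDxx j).dY hL (cD _) (cH _) (hDH j) (hDH (j + 1))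
  refine ⟨E, fun j => xPrimitive L (E j) (E (j + 1)), towerDY q f E,
    fun j => xPrimitive L (towerDY q f E j) (towerDY q f E (j + 1)),
    exists_bound_towerSol hL T Z, fun j Y _ => towerSol_left j Y,
    fun j Y _ => towerSol_right hL j Y, fun j x hx => towerSol_bottom hL hK hKL T Z j hx,
    fun j => (cE j).continuousOn, fun j => (continuous_xPrimitive (cE _) (cE _)).continuousOn,
    fun j => (cD j).continuousOn, fun j => (continuous_xPrimitive (cD _) (cD _)).continuousOn,
    fun j => (hxx j).hasDx (cE _), fun j => hasDx_xPrimitive L (E j) (cE _),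
    fun j => (hDxx j).hasDx (cD _), fun j => hasDx_xPrimitive L _ (cD _), hED,
    fun j => hasDY_xPrimitive hL (cE _) (cD _) (hED j) (hED (j + 1)), hDH, fun j => ?_⟩
  refine (hasDY_xPrimitive hL (cD _) (cH _) (hDH j) (hDH (j + 1))).congr (fun _ _ => rfl)
    fun p hp => ?_
  -- The Y-derivative of `M j` is the x-derivative of `towerDYY`, which is computed a second time
  -- from the equation.
  have h1 : HasDx L (towerDYY q f E j) (fun p => -xPrimitive L (E (j + 1)) (E (j + 1 + 1)) p +
      q p.2 * xPrimitive L (E j) (E (j + 1)) p - fx j p) := by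
    have := (((hxx (j + 1)).hasDx (cE _)).neg.add ((hasDx_snd L q).mul ((hxx j).hasDx (cE _)))).sub
      (T.f_dx j)
    refine this.congr (fun _ _ => rfl) (fun p _ => ?_)
    simp
  have h2 := (hHxx j).hasDx (cH _)
  rw [← h1.eq hL hp, ← h2.eq hL hp]

/-- Each partial of `E`, `X`, `D`, `M` is a combination of these functions, possibly one level
higher, and of smooth data. Each order of regularity is therefore proved for all levels at once. -/
theorem IsTowerSolution.smooth {L : ℝ} {q : ℝ → ℝ} {f fx : ℕ → ℝ × ℝ → ℝ}
    {b V₀ V₁ : ℕ → ℝ → ℝ} {E X D M : ℕ → ℝ × ℝ → ℝ} (hL : 0 < L)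
    (hq : ContDiffOn ℝ ∞ q (Ici 0)) (hf : ∀ j, SmoothStrip L (f j))
    (hfx : ∀ j, SmoothStrip L (fx j))
    (S : IsTowerSolution L q f fx b V₀ V₁ E X D M) (j : ℕ) :
    SmoothStrip L (E j) ∧ SmoothStrip L (X j) ∧ SmoothStrip L (D j) ∧ SmoothStrip L (M j) := by
  have hq' := smoothStrip_snd (L := L) hq
  have key : ∀ n : ℕ, ∀ j, ContDiffOn ℝ n (E j) (closedStrip L) ∧
      ContDiffOn ℝ n (X j) (closedStrip L) ∧ ContDiffOn ℝ n (D j) (closedStrip L) ∧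
      ContDiffOn ℝ n (M j) (closedStrip L) := by
    intro n
    induction n with
    | zero =>
      intro j
      simp only [Nat.cast_zero, contDiffOn_zero]
      exact ⟨S.contE j, S.contX j, S.contD j, S.contM j⟩
    | succ n ih =>
      intro j
      have hqn := contDiffOn_infty.1 hq' n
      obtain ⟨h1, h2, h3, h4⟩ := ih j
      obtain ⟨k1, k2, k3, k4⟩ := ih (j + 1)
      exact ⟨contDiffOn_succ_of_partials hL n (S.E_dx j) (S.E_dY j) h2 h3,
        contDiffOn_succ_of_partials hL n (S.X_dx j) (S.X_dY j) k1 h4,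
        contDiffOn_succ_of_partials hL n (S.D_dx j) (S.D_dY j) h4
          ((k1.neg.add (hqn.mul h1)).sub (contDiffOn_infty.1 (hf j) n)),
        contDiffOn_succ_of_partials hL n (S.M_dx j) (S.M_dY j) k3
          ((k2.neg.add (hqn.mul h2)).sub (contDiffOn_infty.1 (hfx j) n))⟩
  exact ⟨contDiffOn_infty.2 fun n => (key n j).1, contDiffOn_infty.2 fun n => (key n j).2.1,
    contDiffOn_infty.2 fun n => (key n j).2.2.1, contDiffOn_infty.2 fun n => (key n j).2.2.2⟩

/-! ### Families with uniform weighted bounds on all derivatives -/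

/-- A family of functions on strips of widths `Λ θ` is bounded by a multiple of `s θ * W Y`. -/
def UnifBound {Θ : Type*} (Λ s : Θ → ℝ) (W : ℝ → ℝ) (g : Θ → ℝ × ℝ → ℝ) : Prop :=
  ∃ C : ℝ, ∀ θ, ∀ p ∈ closedStrip (Λ θ), |g θ p| ≤ C * (s θ * W p.2)

/-- All partial derivatives of order at most `n` are uniformly bounded. -/
def UnifBoundUpTo {Θ : Type*} (Λ s : Θ → ℝ) (W : ℝ → ℝ) : ℕ → (Θ → ℝ × ℝ → ℝ) → Prop
  | 0, g => UnifBound Λ s W g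
  | n + 1, g => UnifBound Λ s W g ∧ UnifBoundUpTo Λ s W n (fun θ => dx (Λ θ) (g θ)) ∧
      UnifBoundUpTo Λ s W n (fun θ => dY (g θ))

/-- A family of smooth functions on strips, all of whose partial derivatives are uniformly
bounded by multiples of `s θ * W Y`. -/
structure Tame {Θ : Type*} (Λ s : Θ → ℝ) (W : ℝ → ℝ) (g : Θ → ℝ × ℝ → ℝ) : Prop where
  smooth : ∀ θ, SmoothStrip (Λ θ) (g θ)
  bound : ∀ n, UnifBoundUpTo Λ s W n g

section Tame

variable {Θ : Type*} {Λ s s₁ s₂ : Θ → ℝ} {W W₁ W₂ : ℝ → ℝ} {g h gx gy : Θ → ℝ × ℝ → ℝ}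

theorem UnifBoundUpTo.of_succ {n : ℕ} (hg : UnifBoundUpTo Λ s W (n + 1) g) :
    UnifBoundUpTo Λ s W n g := by
  induction n generalizing g with
  | zero => exact hg.1
  | succ n ih => exact ⟨hg.1, ih hg.2.1, ih hg.2.2⟩

theorem UnifBound.congr (hg : UnifBound Λ s W g) (e : ∀ θ, EqOn (h θ) (g θ) (closedStrip (Λ θ))) :
    UnifBound Λ s W h := by
  obtain ⟨C, hC⟩ := hg
  exact ⟨C, fun θ p hp => by rw [e θ hp]; exact hC θ p hp⟩

theorem UnifBoundUpTo.congr {n : ℕ} (hg : UnifBoundUpTo Λ s W n g)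
    (e : ∀ θ, EqOn (h θ) (g θ) (closedStrip (Λ θ))) : UnifBoundUpTo Λ s W n h := by
  induction n generalizing g h with
  | zero => exact UnifBound.congr hg e
  | succ n ih =>
    exact ⟨UnifBound.congr hg.1 e, ih hg.2.1 fun θ => dx_congr (e θ),
      ih hg.2.2 fun θ => dY_congr (e θ)⟩

theorem Tame.congr (hg : Tame Λ s W g) (e : ∀ θ, EqOn (h θ) (g θ) (closedStrip (Λ θ))) :
    Tame Λ s W h :=
  ⟨fun θ => (hg.smooth θ).congr (e θ), fun n => (hg.bound n).congr e⟩

theorem UnifBoundUpTo.of_partials (hΛ : ∀ θ, 0 < Λ θ) {n : ℕ} (hg : UnifBound Λ s W g)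
    (hx : ∀ θ, HasDx (Λ θ) (g θ) (gx θ)) (hy : ∀ θ, HasDY (Λ θ) (g θ) (gy θ))
    (bx : UnifBoundUpTo Λ s W n gx) (hby : UnifBoundUpTo Λ s W n gy) :
    UnifBoundUpTo Λ s W (n + 1) g :=
  ⟨hg, bx.congr fun θ _ hp => (hx θ).eq (hΛ θ) hp, hby.congr fun θ _ hp => (hy θ).eq hp⟩

theorem UnifBound.add (hg : UnifBound Λ s W g) (hh : UnifBound Λ s W h) :
    UnifBound Λ s W (fun θ p => g θ p + h θ p) := by
  obtain ⟨C, hC⟩ := hg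
  obtain ⟨D, hD⟩ := hh
  refine ⟨C + D, fun θ p hp => (abs_add_le _ _).trans ?_⟩
  rw [add_mul]
  exact add_le_add (hC θ p hp) (hD θ p hp)

theorem UnifBound.neg (hg : UnifBound Λ s W g) : UnifBound Λ s W (fun θ p => -g θ p) := by
  obtain ⟨C, hC⟩ := hg
  exact ⟨C, fun θ p hp => by rw [abs_neg]; exact hC θ p hp⟩

theorem UnifBound.mul (hg : UnifBound Λ s₁ W₁ g) (hh : UnifBound Λ s₂ W₂ h) :
    UnifBound Λ (fun θ => s₁ θ * s₂ θ) (fun Y => W₁ Y * W₂ Y) (fun θ p => g θ p * h θ p) := by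
  obtain ⟨C, hC⟩ := hg
  obtain ⟨D, hD⟩ := hh
  refine ⟨C * D, fun θ p hp => ?_⟩
  rw [abs_mul]
  refine (mul_le_mul (hC θ p hp) (hD θ p hp) (abs_nonneg _)
    ((abs_nonneg _).trans (hC θ p hp))).trans_eq (by ring)

theorem UnifBoundUpTo.add (hΛ : ∀ θ, 0 < Λ θ) {n : ℕ} (sg : ∀ θ, SmoothStrip (Λ θ) (g θ))
    (sh : ∀ θ, SmoothStrip (Λ θ) (h θ)) (hg : UnifBoundUpTo Λ s W n g)
    (hh : UnifBoundUpTo Λ s W n h) : UnifBoundUpTo Λ s W n (fun θ p => g θ p + h θ p) := by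
  induction n generalizing g h with
  | zero => exact UnifBound.add hg hh
  | succ n ih =>
    exact .of_partials hΛ (UnifBound.add hg.1 hh.1)
      (fun θ => ((sg θ).hasDx (hΛ θ)).add ((sh θ).hasDx (hΛ θ)))
      (fun θ => (sg θ).hasDY.add (sh θ).hasDY)
      (ih (fun θ => (sg θ).dx (hΛ θ)) (fun θ => (sh θ).dx (hΛ θ)) hg.2.1 hh.2.1)
      (ih (fun θ => (sg θ).dY (hΛ θ)) (fun θ => (sh θ).dY (hΛ θ)) hg.2.2 hh.2.2)

theorem UnifBoundUpTo.neg (hΛ : ∀ θ, 0 < Λ θ) {n : ℕ} (sg : ∀ θ, SmoothStrip (Λ θ) (g θ))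
    (hg : UnifBoundUpTo Λ s W n g) : UnifBoundUpTo Λ s W n (fun θ p => -g θ p) := by
  induction n generalizing g with
  | zero => exact UnifBound.neg hg
  | succ n ih =>
    exact .of_partials hΛ (UnifBound.neg hg.1)
      (fun θ => ((sg θ).hasDx (hΛ θ)).neg) (fun θ => (sg θ).hasDY.neg)
      (ih (fun θ => (sg θ).dx (hΛ θ)) hg.2.1) (ih (fun θ => (sg θ).dY (hΛ θ)) hg.2.2)

theorem UnifBoundUpTo.mul (hΛ : ∀ θ, 0 < Λ θ) {n : ℕ} (sg : ∀ θ, SmoothStrip (Λ θ) (g θ))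
    (sh : ∀ θ, SmoothStrip (Λ θ) (h θ)) (hg : UnifBoundUpTo Λ s₁ W₁ n g)
    (hh : UnifBoundUpTo Λ s₂ W₂ n h) : UnifBoundUpTo Λ (fun θ => s₁ θ * s₂ θ)
      (fun Y => W₁ Y * W₂ Y) n (fun θ p => g θ p * h θ p) := by
  induction n generalizing g h with
  | zero => exact UnifBound.mul hg hh
  | succ n ih =>
    have gx := fun θ => (sg θ).dx (hΛ θ)
    have hx := fun θ => (sh θ).dx (hΛ θ)
    have gy := fun θ => (sg θ).dY (hΛ θ)
    have hy := fun θ => (sh θ).dY (hΛ θ)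
    exact .of_partials hΛ (UnifBound.mul hg.1 hh.1)
      (fun θ => ((sg θ).hasDx (hΛ θ)).mul ((sh θ).hasDx (hΛ θ)))
      (fun θ => (sg θ).hasDY.mul (sh θ).hasDY)
      (.add hΛ (fun θ => (gx θ).mul (sh θ)) (fun θ => (sg θ).mul (hx θ))
        (ih gx sh hg.2.1 hh.of_succ) (ih sg hx hg.of_succ hh.2.1))
      (.add hΛ (fun θ => (gy θ).mul (sh θ)) (fun θ => (sg θ).mul (hy θ))
        (ih gy sh hg.2.2 hh.of_succ) (ih sg hy hg.of_succ hh.2.2))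

theorem Tame.add (hΛ : ∀ θ, 0 < Λ θ) (hg : Tame Λ s W g) (hh : Tame Λ s W h) :
    Tame Λ s W (fun θ p => g θ p + h θ p) :=
  ⟨fun θ => (hg.smooth θ).add (hh.smooth θ),
    fun n => (hg.bound n).add hΛ hg.smooth hh.smooth (hh.bound n)⟩

theorem Tame.neg (hΛ : ∀ θ, 0 < Λ θ) (hg : Tame Λ s W g) : Tame Λ s W (fun θ p => -g θ p) :=
  ⟨fun θ => (hg.smooth θ).neg, fun n => (hg.bound n).neg hΛ hg.smooth⟩

theorem Tame.sub (hΛ : ∀ θ, 0 < Λ θ) (hg : Tame Λ s W g) (hh : Tame Λ s W h) :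
    Tame Λ s W (fun θ p => g θ p - h θ p) := by
  simpa only [sub_eq_add_neg] using hg.add hΛ (hh.neg hΛ)

theorem Tame.mul (hΛ : ∀ θ, 0 < Λ θ) (hg : Tame Λ s₁ W₁ g) (hh : Tame Λ s₂ W₂ h) :
    Tame Λ (fun θ => s₁ θ * s₂ θ) (fun Y => W₁ Y * W₂ Y) (fun θ p => g θ p * h θ p) :=
  ⟨fun θ => (hg.smooth θ).mul (hh.smooth θ),
    fun n => (hg.bound n).mul hΛ hg.smooth hh.smooth (hh.bound n)⟩

/-- Multiplication by a coefficient with bounded derivatives. -/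
theorem Tame.coef_mul (hΛ : ∀ θ, 0 < Λ θ) (hg : Tame Λ (fun _ => 1) (fun _ => 1) g)
    (hh : Tame Λ s W h) : Tame Λ s W (fun θ p => g θ p * h θ p) := by
  simpa only [one_mul] using hg.mul hΛ hh

theorem Tame.dx (hΛ : ∀ θ, 0 < Λ θ) (hg : Tame Λ s W g) :
    Tame Λ s W (fun θ => dx (Λ θ) (g θ)) :=
  ⟨fun θ => (hg.smooth θ).dx (hΛ θ), fun n => (hg.bound (n + 1)).2.1⟩

theorem Tame.dY (hΛ : ∀ θ, 0 < Λ θ) (hg : Tame Λ s W g) : Tame Λ s W (fun θ => dY (g θ)) :=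
  ⟨fun θ => (hg.smooth θ).dY (hΛ θ), fun n => (hg.bound (n + 1)).2.2⟩

theorem Tame.dx_iterate (hΛ : ∀ θ, 0 < Λ θ) (hg : Tame Λ s W g) (j : ℕ) :
    Tame Λ s W (fun θ => (EulerLayer.dx (Λ θ))^[j] (g θ)) := by
  induction j with
  | zero => exact hg
  | succ j ih => simpa only [Function.iterate_succ_apply'] using ih.dx hΛ

theorem Tame.dY_iterate (hΛ : ∀ θ, 0 < Λ θ) (hg : Tame Λ s W g) (j : ℕ) :
    Tame Λ s W (fun θ => EulerLayer.dY^[j] (g θ)) := by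
  induction j with
  | zero => exact hg
  | succ j ih => simpa only [Function.iterate_succ_apply'] using ih.dY hΛ

/-- `UnifBoundUpTo` takes derivatives in any order; commuting partials reduces them to the order in
which the data are bounded. -/
theorem Tame.of_iterate (hΛ : ∀ θ, 0 < Λ θ) (hs : ∀ θ, SmoothStrip (Λ θ) (g θ))
    (hb : ∀ j k, UnifBound Λ s W (fun θ => (EulerLayer.dx (Λ θ))^[j] (EulerLayer.dY^[k] (g θ)))) :
    Tame Λ s W g := by
  have key : ∀ n j k, UnifBoundUpTo Λ s W n
      (fun θ => (EulerLayer.dx (Λ θ))^[j] (EulerLayer.dY^[k] (g θ))) := by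
    intro n
    induction n with
    | zero => exact hb
    | succ n ih =>
      intro j k
      refine ⟨hb j k, ?_, ?_⟩
      · simpa only [Function.iterate_succ_apply'] using ih (j + 1) k
      · refine (ih j (k + 1)).congr fun θ p hp => ?_
        rw [Function.iterate_succ_apply']
        exact ((hs θ).dY_iterate (hΛ θ) k).dY_dx_iterate (hΛ θ) j hp
  exact ⟨hs, fun n => key n 0 0⟩

theorem Tame.unifBound_iterate (hΛ : ∀ θ, 0 < Λ θ) (hg : Tame Λ s W g) (j k : ℕ) :
    UnifBound Λ s W (fun θ => (EulerLayer.dx (Λ θ))^[j] (EulerLayer.dY^[k] (g θ))) :=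
  ((hg.dY_iterate hΛ k).dx_iterate hΛ j).bound 0

theorem UnifBoundUpTo.zero (hΛ : ∀ θ, 0 < Λ θ) (n : ℕ) :
    UnifBoundUpTo Λ s W n (fun _ _ => 0) := by
  have h0 : UnifBound Λ s W (fun _ _ => 0) := ⟨0, fun θ p _ => by simp⟩
  induction n with
  | zero => exact h0
  | succ n ih =>
    exact .of_partials hΛ h0 (fun θ _ _ => hasDerivWithinAt_const _ _ _)
      (fun θ _ _ => hasDerivWithinAt_const _ _ _) ih ih

theorem dHalf_succ (k : ℕ) (u : ℝ → ℝ) :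
    dHalf (k + 1) u = fun Y => derivWithin (dHalf k u) (Ici 0) Y := by
  ext Y
  simp only [dHalf, iteratedDerivWithin_succ]
  rfl

theorem contDiffOn_dHalf {u : ℝ → ℝ} (hu : ContDiffOn ℝ ∞ u (Ici 0)) (k : ℕ) :
    ContDiffOn ℝ ∞ (dHalf k u) (Ici 0) := by
  induction k with
  | zero =>
    refine hu.congr fun Y _ => ?_
    simp [dHalf]
  | succ k ih =>
    rw [dHalf_succ]
    exact ih.derivWithin (uniqueDiffOn_Ici 0) (by simp)

theorem hasDerivWithinAt_dHalf {u : ℝ → ℝ} (hu : ContDiffOn ℝ ∞ u (Ici 0)) (k : ℕ) {Y : ℝ}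
    (hY : 0 ≤ Y) : HasDerivWithinAt (dHalf k u) (dHalf (k + 1) u Y) (Ici 0) Y := by
  rw [dHalf_succ]
  exact ((contDiffOn_dHalf hu k).differentiableOn (by simp) Y hY).hasDerivWithinAt

theorem dx_iterate_snd (L : ℝ) (h : ℝ → ℝ) (j : ℕ) :
    (EulerLayer.dx L)^[j + 1] (fun p => h p.2) = fun _ => 0 := by
  have h0 : EulerLayer.dx L (fun p => h p.2) = fun _ => 0 := by
    ext p; simp [EulerLayer.dx]
  have h1 : EulerLayer.dx L (fun _ => (0 : ℝ)) = fun _ => 0 := by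
    ext p; simp [EulerLayer.dx]
  induction j with
  | zero => exact h0
  | succ j ih => rw [Function.iterate_succ_apply', ih, h1]

theorem Tame.of_snd (hΛ : ∀ θ, 0 < Λ θ) {u : Θ → ℝ → ℝ}
    (hs : ∀ θ, ContDiffOn ℝ ∞ (u θ) (Ici 0))
    (hb : ∀ k, ∃ C, ∀ θ Y, 0 ≤ Y → |dHalf k (u θ) Y| ≤ C * (s θ * W Y)) :
    Tame Λ s W (fun θ p => u θ p.2) := by
  refine Tame.of_iterate hΛ (fun θ => smoothStrip_snd (hs θ)) fun j k => ?_
  simp only [dY_iterate_snd]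
  cases j with
  | zero =>
    obtain ⟨C, hC⟩ := hb k
    exact ⟨C, fun θ p hp => hC θ p.2 hp.2⟩
  | succ j =>
    simp only [dx_iterate_snd]
    exact ⟨0, fun θ p _ => by simp⟩

theorem Tame.trace (hΛ : ∀ θ, 0 < Λ θ) (hg : Tame Λ s W g) {x₀ : Θ → ℝ}
    (hx₀ : ∀ θ, x₀ θ ∈ Icc 0 (Λ θ)) : Tame Λ s W (fun θ p => g θ (x₀ θ, p.2)) := by
  refine ⟨fun θ => (hg.smooth θ).trace (hx₀ θ), fun n => ?_⟩
  have hb : ∀ {g : Θ → ℝ × ℝ → ℝ}, UnifBound Λ s W g →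
      UnifBound Λ s W (fun θ p => g θ (x₀ θ, p.2)) := by
    rintro g ⟨C, hC⟩
    exact ⟨C, fun θ p hp => hC θ (x₀ θ, p.2) ⟨hx₀ θ, hp.2⟩⟩
  induction n generalizing g with
  | zero => exact hb (hg.bound 0)
  | succ n ih =>
    exact .of_partials hΛ (hb (hg.bound 0)) (fun θ => hasDx_snd (Λ θ) fun Y => g θ (x₀ θ, Y))
      (fun θ p hp => (hg.smooth θ).hasDY (x₀ θ, p.2) ⟨hx₀ θ, hp.2⟩) (.zero hΛ n) (ih (hg.dY hΛ))

/-- The mean value inequality in x gains the factor `Λ θ`. This keeps the side data of all levels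
close to each other. -/
theorem Tame.trace_sub_trace (hΛ : ∀ θ, 0 < Λ θ) (hg : Tame Λ s W g) :
    Tame Λ (fun θ => s θ * Λ θ) W (fun θ p => g θ (0, p.2) - g θ (Λ θ, p.2)) := by
  have m0 : ∀ θ, (0 : ℝ) ∈ Icc 0 (Λ θ) := fun θ => ⟨le_rfl, (hΛ θ).le⟩
  have m1 : ∀ θ, Λ θ ∈ Icc 0 (Λ θ) := fun θ => ⟨(hΛ θ).le, le_rfl⟩
  refine ⟨fun θ => ((hg.smooth θ).trace (m0 θ)).sub ((hg.smooth θ).trace (m1 θ)), fun n => ?_⟩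
  have hb : ∀ {g : Θ → ℝ × ℝ → ℝ}, Tame Λ s W g → UnifBound Λ (fun θ => s θ * Λ θ) W
      (fun θ p => g θ (0, p.2) - g θ (Λ θ, p.2)) := by
    intro g hg
    obtain ⟨C, hC⟩ := (hg.bound 1).2.1
    refine ⟨C, fun θ p hp => ?_⟩
    have := abs_sub_le_of_hasDerivWithinAt (c := 0) (convex_Icc 0 (Λ θ))
      (g := fun s => g θ (s, p.2)) (fun x hx => (hg.smooth θ).hasDx (hΛ θ) (x, p.2) ⟨hx, hp.2⟩)
      (fun x hx => by simpa using hC θ (x, p.2) ⟨hx, hp.2⟩) (m1 θ) (m0 θ)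
    simp only [zero_mul, sub_zero, zero_sub, abs_neg, abs_of_pos (hΛ θ)] at this
    exact this.trans_eq (by ring)
  induction n generalizing g with
  | zero => exact hb hg
  | succ n ih =>
    exact .of_partials hΛ (hb hg)
      (fun θ => hasDx_snd (Λ θ) fun Y => g θ (0, Y) - g θ (Λ θ, Y))
      (fun θ p hp => ((hg.smooth θ).hasDY (0, p.2) ⟨m0 θ, hp.2⟩).sub
        ((hg.smooth θ).hasDY (Λ θ, p.2) ⟨m1 θ, hp.2⟩)) (.zero hΛ n) (ih (hg.dY hΛ))

theorem UnifBound.mono (hg : UnifBound Λ s₁ W₁ g) (hs : ∀ θ, 0 ≤ s₁ θ)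
    (hW : ∀ Y, 0 ≤ Y → 0 ≤ W₁ Y) (c : ℝ)
    (hle : ∀ θ Y, 0 ≤ Y → s₁ θ * W₁ Y ≤ c * (s₂ θ * W₂ Y)) : UnifBound Λ s₂ W₂ g := by
  obtain ⟨C, hC⟩ := hg
  refine ⟨|C| * c, fun θ p hp => (hC θ p hp).trans ?_⟩
  have h1 : 0 ≤ s₁ θ * W₁ p.2 := mul_nonneg (hs θ) (hW _ hp.2)
  calc _ ≤ |C| * (s₁ θ * W₁ p.2) := mul_le_mul_of_nonneg_right (le_abs_self C) h1
    _ ≤ |C| * (c * (s₂ θ * W₂ p.2)) := mul_le_mul_of_nonneg_left (hle θ _ hp.2) (abs_nonneg _)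
    _ = _ := by ring

theorem UnifBoundUpTo.mono {n : ℕ} (hg : UnifBoundUpTo Λ s₁ W₁ n g) (hs : ∀ θ, 0 ≤ s₁ θ)
    (hW : ∀ Y, 0 ≤ Y → 0 ≤ W₁ Y) (c : ℝ)
    (hle : ∀ θ Y, 0 ≤ Y → s₁ θ * W₁ Y ≤ c * (s₂ θ * W₂ Y)) : UnifBoundUpTo Λ s₂ W₂ n g := by
  induction n generalizing g with
  | zero => exact UnifBound.mono hg hs hW c hle
  | succ n ih => exact ⟨hg.1.mono hs hW c hle, ih hg.2.1, ih hg.2.2⟩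

theorem Tame.mono (hg : Tame Λ s₁ W₁ g) (hs : ∀ θ, 0 ≤ s₁ θ)
    (hW : ∀ Y, 0 ≤ Y → 0 ≤ W₁ Y) (c : ℝ)
    (hle : ∀ θ Y, 0 ≤ Y → s₁ θ * W₁ Y ≤ c * (s₂ θ * W₂ Y)) : Tame Λ s₂ W₂ g :=
  ⟨hg.smooth, fun n => (hg.bound n).mono hs hW c hle⟩

/-- Reciprocals of tame coefficients bounded below are tame. -/
theorem Tame.inv (hΛ : ∀ θ, 0 < Λ θ) (hg : Tame Λ (fun _ => 1) (fun _ => 1) g) {c : ℝ}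
    (hc : 0 < c) (hlow : ∀ θ, ∀ p ∈ closedStrip (Λ θ), c ≤ g θ p) :
    Tame Λ (fun _ => 1) (fun _ => 1) (fun θ p => (g θ p)⁻¹) := by
  have hne : ∀ θ, ∀ p ∈ closedStrip (Λ θ), g θ p ≠ 0 := fun θ p hp =>
    (hc.trans_le (hlow θ p hp)).ne'
  have hsm : ∀ θ, SmoothStrip (Λ θ) (fun p => (g θ p)⁻¹) := fun θ =>
    ContDiffOn.inv (hg.smooth θ) (hne θ)
  have hb : UnifBound Λ (fun _ => 1) (fun _ => 1) (fun θ p => (g θ p)⁻¹) := by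
    refine ⟨c⁻¹, fun θ p hp => ?_⟩
    rw [abs_of_pos (inv_pos.2 (hc.trans_le (hlow θ p hp))), mul_one, mul_one]
    exact inv_anti₀ hc (hlow θ p hp)
  have hx : ∀ θ, HasDx (Λ θ) (fun p => (g θ p)⁻¹)
      (fun p => (-EulerLayer.dx (Λ θ) (g θ) p) * ((g θ p)⁻¹ * (g θ p)⁻¹)) := fun θ p hp =>
    (((hg.smooth θ).hasDx (hΛ θ) p hp).inv (hne θ p hp)).congr_deriv (by
      simp only [Prod.mk.eta]; rw [div_eq_mul_inv, sq, mul_inv])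
  have hy : ∀ θ, HasDY (Λ θ) (fun p => (g θ p)⁻¹)
      (fun p => (-EulerLayer.dY (g θ) p) * ((g θ p)⁻¹ * (g θ p)⁻¹)) := fun θ p hp =>
    (((hg.smooth θ).hasDY p hp).inv (hne θ p hp)).congr_deriv (by
      simp only [Prod.mk.eta]; rw [div_eq_mul_inv, sq, mul_inv])
  refine ⟨hsm, fun n => ?_⟩
  induction n with
  | zero => exact hb
  | succ n ih =>
    -- Since `∂(1/g) = -∂g (1/g)²`, bounds of order n on the reciprocal give those of order n + 1.
    have h2 := ih.mul hΛ hsm hsm ih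
    have ss := fun θ => (hsm θ).mul (hsm θ)
    have gx := (hg.dx hΛ).neg hΛ
    have gy := (hg.dY hΛ).neg hΛ
    have bx := (gx.bound n).mul hΛ gx.smooth ss h2
    have by' := (gy.bound n).mul hΛ gy.smooth ss h2
    simp only [mul_one] at bx by'
    exact .of_partials hΛ hb hx hy bx by'

theorem hasDx_integral {L : ℝ} (hL : 0 < L) {f : ℝ × ℝ → ℝ} (hf : ContinuousOn f (closedStrip L)) :
    HasDx L (fun p => ∫ t in (0 : ℝ)..p.1, f (t, p.2)) f := by
  intro p hp
  have hcl : Continuous fun s => f (max 0 (min s L), p.2) :=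
    (continuousOn_horizontal hf hp.2).comp_continuous (by fun_prop) fun s =>
      ⟨le_max_left _ _, max_le hL.le (min_le_right _ _)⟩
  have hcl' : ∀ t ∈ Icc 0 L, max 0 (min t L) = t := fun t ht => by
    rw [min_eq_left ht.2, max_eq_right ht.1]
  have e : ∀ x ∈ Icc 0 L, ∫ t in (0 : ℝ)..x, f (t, p.2) =
      ∫ t in (0 : ℝ)..x, f (max 0 (min t L), p.2) := fun x hx =>
    intervalIntegral.integral_congr fun t ht => by
      rw [uIcc_of_le hx.1] at ht
      simp only [hcl' t ⟨ht.1, ht.2.trans hx.2⟩]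
  refine ((hasDerivAt_primitive hcl p.1).hasDerivWithinAt.congr e (e _ hp.1)).congr_deriv ?_
  rw [hcl' _ hp.1]

theorem hasDY_integral {L : ℝ} (hL : 0 < L) {f : ℝ × ℝ → ℝ} (hf : SmoothStrip L f) :
    HasDY L (fun p => ∫ t in (0 : ℝ)..p.1, f (t, p.2))
      (fun p => ∫ t in (0 : ℝ)..p.1, EulerLayer.dY f (t, p.2)) := by
  intro p hp
  have hcl : ∀ {f : ℝ × ℝ → ℝ}, SmoothStrip L f →
      Continuous fun r : ℝ × ℝ => f (max 0 (min r.1 L), max r.2 0) := fun hf =>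
    hf.continuousOn.comp_continuous (by fun_prop) fun r =>
      ⟨⟨le_max_left _ _, max_le hL.le (min_le_right _ _)⟩, mem_Ici.2 (le_max_right _ _)⟩
  have hcl' : ∀ t ∈ Icc 0 L, max 0 (min t L) = t := fun t ht => by
    rw [min_eq_left ht.2, max_eq_right ht.1]
  have hmem : ∀ t ∈ uIcc 0 p.1, t ∈ Icc 0 L := fun t ht => by
    rw [uIcc_of_le hp.1.1] at ht
    exact ⟨ht.1, ht.2.trans hp.1.2⟩
  have hd := hasDerivWithinAt_integral_param (k := fun _ => 1) (x := p.1)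
    (hcl hf) (hcl (hf.dY hL)) continuous_const
    (fun t ht Y hY => by
      have := hf.hasDY (t, Y) ⟨hmem t ht, hY⟩
      refine (this.congr (fun Z hZ => ?_) ?_).congr_deriv ?_ <;>
        simp only [hcl' t (hmem t ht)]
      · rw [max_eq_left (mem_Ici.1 hZ)]
      · rw [max_eq_left hY]
      · rw [max_eq_left hY]) hp.2
  simp only [one_mul] at hd
  refine (hd.congr (fun Z hZ => ?_) ?_).congr_deriv ?_
  · refine intervalIntegral.integral_congr fun t ht => ?_
    simp only [hcl' t (hmem t ht), max_eq_left (mem_Ici.1 hZ)]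
  · refine intervalIntegral.integral_congr fun t ht => ?_
    simp only [hcl' t (hmem t ht), max_eq_left (mem_Ici.1 hp.2)]
  · refine intervalIntegral.integral_congr fun t ht => ?_
    simp only [hcl' t (hmem t ht), max_eq_left (mem_Ici.1 hp.2)]

/-- Primitives in `x` of tame families are tame, when the widths are bounded. -/
theorem Tame.integral (hΛ : ∀ θ, 0 < Λ θ) {A : ℝ} (hA : ∀ θ, Λ θ ≤ A) (hg : Tame Λ s W g) :
    Tame Λ s W (fun θ p => ∫ t in (0 : ℝ)..p.1, g θ (t, p.2)) := by
  have hA0 : ∀ θ, |Λ θ| ≤ |A| := fun θ => by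
    rw [abs_of_pos (hΛ θ)]; exact (hA θ).trans (le_abs_self A)
  have hb : ∀ {g : Θ → ℝ × ℝ → ℝ}, Tame Λ s W g →
      UnifBound Λ s W (fun θ p => ∫ t in (0 : ℝ)..p.1, g θ (t, p.2)) := by
    intro g hg
    obtain ⟨C, hC⟩ := hg.bound 0
    refine ⟨C * |A|, fun θ p hp => ?_⟩
    have h1 : ‖∫ t in (0 : ℝ)..p.1, g θ (t, p.2)‖ ≤ (C * (s θ * W p.2)) * |p.1 - 0| := by
      refine intervalIntegral.norm_integral_le_of_norm_le_const fun t ht => ?_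
      rw [uIoc_of_le hp.1.1] at ht
      exact hC θ (t, p.2) ⟨⟨ht.1.le, ht.2.trans hp.1.2⟩, hp.2⟩
    have h2 : 0 ≤ C * (s θ * W p.2) := (abs_nonneg _).trans (hC θ p hp)
    have h3 : |p.1 - 0| ≤ |A| := by
      rw [sub_zero, abs_of_nonneg hp.1.1]
      exact hp.1.2.trans ((le_abs_self _).trans (hA0 θ))
    exact h1.trans ((mul_le_mul_of_nonneg_left h3 h2).trans_eq (by ring))
  have hx : ∀ {g : Θ → ℝ × ℝ → ℝ}, Tame Λ s W g → ∀ θ,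
      HasDx (Λ θ) (fun p => ∫ t in (0 : ℝ)..p.1, g θ (t, p.2)) (g θ) := fun hg θ =>
    hasDx_integral (hΛ θ) (hg.smooth θ).continuousOn
  have hy : ∀ {g : Θ → ℝ × ℝ → ℝ}, Tame Λ s W g → ∀ θ,
      HasDY (Λ θ) (fun p => ∫ t in (0 : ℝ)..p.1, g θ (t, p.2))
        (fun p => ∫ t in (0 : ℝ)..p.1, EulerLayer.dY (g θ) (t, p.2)) := fun hg θ =>
    hasDY_integral (hΛ θ) (hg.smooth θ)
  -- The x-derivative of the primitive is `g`, and its Y-derivative is the primitive of another tame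
  -- family; hence the induction over all `g` simultaneously.
  have key : ∀ n : ℕ, ∀ {g : Θ → ℝ × ℝ → ℝ}, Tame Λ s W g →
      (∀ θ, ContDiffOn ℝ n (fun p => ∫ t in (0 : ℝ)..p.1, g θ (t, p.2)) (closedStrip (Λ θ))) ∧
      UnifBoundUpTo Λ s W n (fun θ p => ∫ t in (0 : ℝ)..p.1, g θ (t, p.2)) := by
    intro n
    induction n with
    | zero =>
      intro g hg
      refine ⟨fun θ => ?_, hb hg⟩
      rw [Nat.cast_zero, contDiffOn_zero]
      refine fun p hp => (hasFDerivWithinAt_of_partials (hx hg θ) (hy hg θ)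
        (hg.smooth θ).continuousOn ?_ hp).continuousWithinAt
      have hcl : Continuous fun r : ℝ × ℝ =>
          EulerLayer.dY (g θ) (max 0 (min r.1 (Λ θ)), max r.2 0) :=
        ((hg.smooth θ).dY (hΛ θ)).continuousOn.comp_continuous (by fun_prop) fun r =>
          ⟨⟨le_max_left _ _, max_le (hΛ θ).le (min_le_right _ _)⟩, mem_Ici.2 (le_max_right _ _)⟩
      have hc2 : Continuous fun r : ℝ × ℝ => ∫ t in (0 : ℝ)..r.1,
          EulerLayer.dY (g θ) (max 0 (min t (Λ θ)), max r.2 0) :=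
        intervalIntegral.continuous_parametric_intervalIntegral_of_continuous
          (f := fun (r : ℝ × ℝ) t => EulerLayer.dY (g θ) (max 0 (min t (Λ θ)), max r.2 0))
          (hcl.comp (by fun_prop : Continuous fun r : (ℝ × ℝ) × ℝ => (r.2, r.1.2)))
          continuous_fst
      refine hc2.continuousOn.congr fun r hr => intervalIntegral.integral_congr fun t ht => ?_
      rw [uIcc_of_le hr.1.1] at ht
      simp only [max_eq_left (show (0 : ℝ) ≤ r.2 from hr.2), min_eq_left (ht.2.trans hr.1.2),
        max_eq_right ht.1]
    | succ n ih =>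
      intro g hg
      exact ⟨fun θ => contDiffOn_succ_of_partials (hΛ θ) n (hx hg θ) (hy hg θ)
        (contDiffOn_infty.1 (hg.smooth θ) n) ((ih (hg.dY hΛ)).1 θ),
        .of_partials hΛ (hb hg) (hx hg) (hy hg) (hg.bound n) (ih (hg.dY hΛ)).2⟩
  exact ⟨fun θ => contDiffOn_infty.2 fun n => (key n hg).1 θ, fun n => (key n hg).2⟩

end Tame

/-! ### Side data of the differentiated problems and corner compatibility -/

/-- The potential `q = u⁰'' / u⁰`. -/
def potential (u0 : ℝ → ℝ) (Y : ℝ) : ℝ := (u0 Y)⁻¹ * dHalf 2 u0 Y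

/-- The normalised forcing `F / u⁰`. -/
def source (L : ℝ) (u0 : ℝ → ℝ) (d : LayerData) (p : ℝ × ℝ) : ℝ := (u0 p.2)⁻¹ * d.F L p

/-- The values on the side `x = x₀` of the derivatives `∂ₓ^{2j} v`. -/
def sideFun (L : ℝ) (u0 : ℝ → ℝ) (d : LayerData) (x₀ : ℝ) (V : ℝ → ℝ) : ℕ → ℝ → ℝ
  | 0 => V
  | j + 1 => fun Y => -dHalf 2 (sideFun L u0 d x₀ V j) Y
      + potential u0 Y * sideFun L u0 d x₀ V j Y - (dx L)^[2 * j] (source L u0 d) (x₀, Y)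

theorem dHalf_zero (u : ℝ → ℝ) : dHalf 0 u = u := by
  ext Y; simp [dHalf]

theorem dHalf_dHalf (a b : ℕ) (u : ℝ → ℝ) : dHalf a (dHalf b u) = dHalf (a + b) u := by
  induction a with
  | zero => rw [dHalf_zero, zero_add]
  | succ a ih => rw [dHalf_succ, ih, add_right_comm, dHalf_succ]

theorem dHalf_congr {u v : ℝ → ℝ} (h : EqOn u v (Ici 0)) (k : ℕ) {Y : ℝ} (hY : 0 ≤ Y) :
    dHalf k u Y = dHalf k v Y := iteratedDerivWithin_congr h hY

theorem dHalf_add {u v : ℝ → ℝ} (hu : ContDiffOn ℝ ∞ u (Ici 0)) (hv : ContDiffOn ℝ ∞ v (Ici 0))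
    (k : ℕ) {Y : ℝ} (hY : 0 ≤ Y) :
    dHalf k (fun Y => u Y + v Y) Y = dHalf k u Y + dHalf k v Y :=
  iteratedDerivWithin_fun_add hY (uniqueDiffOn_Ici 0) (contDiffOn_infty.1 hu k Y hY)
    (contDiffOn_infty.1 hv k Y hY)

theorem dHalf_sub {u v : ℝ → ℝ} (hu : ContDiffOn ℝ ∞ u (Ici 0)) (hv : ContDiffOn ℝ ∞ v (Ici 0))
    (k : ℕ) {Y : ℝ} (hY : 0 ≤ Y) :
    dHalf k (fun Y => u Y - v Y) Y = dHalf k u Y - dHalf k v Y :=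
  iteratedDerivWithin_sub hY (uniqueDiffOn_Ici 0) (contDiffOn_infty.1 hu k Y hY)
    (contDiffOn_infty.1 hv k Y hY)

theorem dHalf_mul {u v : ℝ → ℝ} (hu : ContDiffOn ℝ ∞ u (Ici 0)) (hv : ContDiffOn ℝ ∞ v (Ici 0))
    (k : ℕ) {Y : ℝ} (hY : 0 ≤ Y) : dHalf k (fun Y => u Y * v Y) Y =
      ∑ i ∈ Finset.range (k + 1), (k.choose i : ℝ) * dHalf i u Y * dHalf (k - i) v Y :=
  iteratedDerivWithin_mul hY (uniqueDiffOn_Ici 0) (contDiffOn_infty.1 hu k Y hY)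
    (contDiffOn_infty.1 hv k Y hY)

theorem IsShearFlow.pos {u0 : ℝ → ℝ} (hu : IsShearFlow u0) {Y : ℝ} (hY : 0 ≤ Y) : 0 < u0 Y := by
  obtain ⟨c₀, C₀, h0, h⟩ := hu.bounds
  exact h0.trans_le (h Y hY).1

theorem smooth_F {κ : WeightKind} {m l L : ℝ} {B : ℕ → ℝ} {u0 : ℝ → ℝ} {d : LayerData}
    (hL : 0 < L) (h : Admissible κ m l B L u0 d) : SmoothStrip L (d.F L) :=
  (SmoothStrip.dY hL h.smooth_f₁).sub (SmoothStrip.dx hL h.smooth_f₂)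

theorem smooth_source {L : ℝ} {u0 : ℝ → ℝ} {d : LayerData} (hu : IsShearFlow u0)
    (hF : SmoothStrip L (d.F L)) : SmoothStrip L (source L u0 d) :=
  (smoothStrip_snd (hu.smooth.inv fun _ hY => (hu.pos hY).ne')).mul hF

theorem smooth_potential {u0 : ℝ → ℝ} (hu : IsShearFlow u0) :
    ContDiffOn ℝ ∞ (potential u0) (Ici 0) :=
  (hu.smooth.inv fun _ hY => (hu.pos hY).ne').mul (contDiffOn_dHalf hu.smooth 2)

theorem dx_iterate_source (L : ℝ) (u0 : ℝ → ℝ) (d : LayerData) (j : ℕ) :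
    (dx L)^[j] (source L u0 d) = fun p => (u0 p.2)⁻¹ * (dx L)^[j] (d.F L) p := by
  induction j with
  | zero => rfl
  | succ j ih =>
    rw [Function.iterate_succ_apply', ih, Function.iterate_succ_apply']
    ext p
    exact derivWithin_const_mul_field (𝕜 := ℝ) (u0 p.2)⁻¹

theorem smooth_slice {L : ℝ} {f : ℝ × ℝ → ℝ} (hf : SmoothStrip L f) {x₀ : ℝ}
    (hx₀ : x₀ ∈ Icc 0 L) : ContDiffOn ℝ ∞ (fun Y => f (x₀, Y)) (Ici 0) :=
  ContDiffOn.comp hf (contDiffOn_const.prodMk contDiffOn_id) fun _ hY => ⟨hx₀, hY⟩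

theorem smooth_sideFun {L : ℝ} (hL : 0 < L) {u0 : ℝ → ℝ} {d : LayerData} (hu : IsShearFlow u0)
    (hF : SmoothStrip L (d.F L)) {x₀ : ℝ} (hx₀ : x₀ ∈ Icc 0 L) {V : ℝ → ℝ}
    (hV : ContDiffOn ℝ ∞ V (Ici 0)) (j : ℕ) :
    ContDiffOn ℝ ∞ (sideFun L u0 d x₀ V j) (Ici 0) := by
  induction j with
  | zero => exact hV
  | succ j ih =>
    exact ((contDiffOn_dHalf ih 2).neg.add ((smooth_potential hu).mul ih)).sub
      (smooth_slice ((smooth_source hu hF).dx_iterate hL _) hx₀)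

/-- Multiplied by `u0` the recursion has the form of the corner conditions, so the Leibniz
expansions of the two can be compared term by term. -/
theorem sideFun_equation {L : ℝ} {u0 : ℝ → ℝ} (hu : IsShearFlow u0) (d : LayerData)
    (x₀ : ℝ) (V : ℝ → ℝ) (j : ℕ) {Y : ℝ} (hY : 0 ≤ Y) :
    u0 Y * (sideFun L u0 d x₀ V (j + 1) Y + dHalf 2 (sideFun L u0 d x₀ V j) Y) =
      dHalf 2 u0 Y * sideFun L u0 d x₀ V j Y - (dx L)^[2 * j] (d.F L) (x₀, Y) := by
  have h0 := (hu.pos hY).ne'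
  simp only [sideFun, dx_iterate_source, potential]
  field_simp
  ring

/-- The compatibility conditions make the side and bottom data of all the differentiated problems
agree at the corners. -/
theorem sideFun_corner {L : ℝ} (hL : 0 < L) {u0 : ℝ → ℝ} {d : LayerData} (hu : IsShearFlow u0)
    (hF : SmoothStrip L (d.F L)) {x₀ : ℝ} (hx₀ : x₀ ∈ Icc 0 L) {V : ℝ → ℝ}
    (hV : ContDiffOn ℝ ∞ V (Ici 0)) (hw : ∀ n, WellPreparedAt L u0 d.a V (d.F L) x₀ n) (j : ℕ) :
    sideFun L u0 d x₀ V j 0 = -iteratedDerivWithin (2 * j) d.a (Icc 0 L) x₀ := by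
  obtain ⟨c, hc1, hc2, hc3⟩ := hw j
  -- The differentiated equation determines `c (2 * i + 2) q` from lower values because `u0 0 ≠ 0`,
  -- and the Y-derivatives of `sideFun` at 0 obey the same recursion. The induction is on i and then
  -- strongly on q.
  have key : ∀ i q, 2 * i + q ≤ 2 * j → c (2 * i) q = dHalf q (sideFun L u0 d x₀ V i) 0 := by
    intro i
    induction i with
    | zero => exact fun q hq => hc1 q (by omega)
    | succ i ihi =>
      intro q
      induction q using Nat.strong_induction_on with
      | _ q ihq =>
        intro hq
        set s := sideFun L u0 d x₀ V with hs
        have hsm : ∀ i, ContDiffOn ℝ ∞ (s i) (Ici 0) := smooth_sideFun hL hu hF hx₀ hV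
        have hG := smooth_slice (hF.dx_iterate hL (2 * i)) hx₀
        have e1 := dHalf_congr (u := fun Y => u0 Y * (s (i + 1) Y + dHalf 2 (s i) Y))
          (v := fun Y => dHalf 2 u0 Y * s i Y - (dx L)^[2 * i] (d.F L) (x₀, Y))
          (fun Y hY => sideFun_equation hu d x₀ V i hY) q le_rfl
        rw [dHalf_mul hu.smooth ((hsm (i + 1)).add (contDiffOn_dHalf (hsm i) 2)) q le_rfl,
          dHalf_sub ((contDiffOn_dHalf hu.smooth 2).mul (hsm i)) hG q le_rfl,
          dHalf_mul (contDiffOn_dHalf hu.smooth 2) (hsm i) q le_rfl] at e1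
        have e2 : dHalf q (fun Y => (dx L)^[2 * i] (d.F L) (x₀, Y)) 0 =
            (dx L)^[2 * i] (dY^[q] (d.F L)) (x₀, 0) := by
          rw [← hF.dY_iterate_dx_iterate hL (2 * i) q
            (show (x₀, (0 : ℝ)) ∈ closedStrip L from ⟨hx₀, mem_Ici.2 le_rfl⟩),
            dY_iterate_eq_iteratedDerivWithin]
          rfl
        rw [e2, ← hc3 (2 * i) q (by omega), eq_sub_iff_add_eq, ← Finset.sum_add_distrib] at e1
        have e3 : ∑ r ∈ Finset.range (q + 1), (q.choose r : ℝ) * dHalf r u0 0 *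
            (dHalf (q - r) (s (i + 1)) 0 - c (2 * (i + 1)) (q - r)) = 0 := by
          refine Eq.trans ?_ (sub_eq_zero.2 e1)
          rw [← Finset.sum_sub_distrib]
          refine Finset.sum_congr rfl fun r hr => ?_
          have hr' : r ≤ q := Nat.lt_succ_iff.1 (Finset.mem_range.1 hr)
          rw [dHalf_add (hsm (i + 1)) (contDiffOn_dHalf (hsm i) 2) (q - r) le_rfl, dHalf_dHalf,
            dHalf_dHalf, ihi (q - r + 2) (by omega), ihi (q - r) (by omega),
            show 2 * i + 2 = 2 * (i + 1) by ring]
          ring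
        -- In all terms but the one of index 0 fewer than q derivatives fall on the unknown, so
        -- these vanish by induction.
        rw [Finset.sum_range_succ', Finset.sum_eq_zero, zero_add] at e3
        · simp only [Nat.choose_zero_right, Nat.cast_one, one_mul, dHalf_zero, Nat.sub_zero] at e3
          have := (mul_eq_zero.1 e3).resolve_left (hu.pos le_rfl).ne'
          linarith
        · intro r hr
          have hr' := Finset.mem_range.1 hr
          rw [ihq (q - (r + 1)) (by omega) (by omega), sub_self, mul_zero]
  have h1 := key j 0 (by omega)
  rw [hc2 (2 * j) le_rfl, dHalf_zero] at h1
  exact h1.symm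

/-! ### Uniform bounds for the data -/

section Family

variable {Θ : Type*} {Λ : Θ → ℝ} {dat : Θ → LayerData} {κ : WeightKind} {m l : ℝ} {B : ℕ → ℝ}
  {u0 : ℝ → ℝ}

theorem inv_weight_le {a b : ℝ} (hab : b ≤ a) {Y : ℝ} (hY : 0 ≤ Y) :
    (weight κ a Y)⁻¹ ≤ weight κ (-b) Y := by
  rw [← weight_neg κ a hY]
  exact weight_mono_exponent κ (neg_le_neg hab) hY

theorem bound_inv_weight {a b x C : ℝ} (hab : b ≤ a) {Y : ℝ} (hY : 0 ≤ Y)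
    (h : |x| ≤ C * (weight κ a Y)⁻¹) : |x| ≤ |C| * weight κ (-b) Y := by
  have h1 := inv_weight_le (κ := κ) hab hY
  have h2 := weight_pos κ a hY
  calc |x| ≤ C * (weight κ a Y)⁻¹ := h
    _ ≤ |C| * (weight κ a Y)⁻¹ := mul_le_mul_of_nonneg_right (le_abs_self _) (by positivity)
    _ ≤ _ := mul_le_mul_of_nonneg_left h1 (abs_nonneg _)

theorem tame_u0 (hΛ : ∀ θ, 0 < Λ θ) (hu : IsShearFlow u0) :
    Tame Λ (fun _ => 1) (fun _ => 1) (fun _ p => u0 p.2) := by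
  refine Tame.of_snd (u := fun _ => u0) hΛ (fun _ => hu.smooth) fun k => ?_
  rcases Nat.eq_zero_or_pos k with rfl | hk
  · obtain ⟨c₀, C₀, h0, h⟩ := hu.bounds
    refine ⟨C₀, fun _ Y hY => ?_⟩
    rw [dHalf_zero, abs_of_pos (hu.pos hY), mul_one, mul_one]
    exact (h Y hY).2
  · obtain ⟨C, hC⟩ := hu.decay k hk 0
    exact ⟨C, fun _ Y hY => by simpa using hC Y hY⟩

theorem tame_inv_u0 (hΛ : ∀ θ, 0 < Λ θ) (hu : IsShearFlow u0) :
    Tame Λ (fun _ => 1) (fun _ => 1) (fun _ p => (u0 p.2)⁻¹) := by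
  obtain ⟨c₀, C₀, h0, h⟩ := hu.bounds
  exact (tame_u0 hΛ hu).inv hΛ h0 fun θ p hp => (h p.2 hp.2).1

theorem tame_potential (hΛ : ∀ θ, 0 < Λ θ) (hu : IsShearFlow u0) :
    Tame Λ (fun _ => 1) (fun _ => 1) (fun _ p => potential u0 p.2) := by
  have h := (tame_inv_u0 hΛ hu).coef_mul hΛ ((tame_u0 hΛ hu).dY_iterate hΛ 2)
  simp only [dY_iterate_snd] at h
  exact h

theorem tame_F (hΛ : ∀ θ, 0 < Λ θ) (hadm : ∀ θ, Admissible κ m l B (Λ θ) u0 (dat θ)) :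
    Tame Λ (fun _ => 1) (weight κ (-min m l)) (fun θ => (dat θ).F (Λ θ)) := by
  refine Tame.of_iterate hΛ (fun θ => smooth_F (hΛ θ) (hadm θ)) fun j k => ?_
  refine ⟨|B (j + k)|, fun θ p hp => ?_⟩
  rw [one_mul]
  exact bound_inv_weight (min_le_right m l) hp.2 ((hadm θ).decay_F j k p hp)

theorem tame_source (hΛ : ∀ θ, 0 < Λ θ) (hu : IsShearFlow u0)
    (hadm : ∀ θ, Admissible κ m l B (Λ θ) u0 (dat θ)) :
    Tame Λ (fun _ => 1) (weight κ (-min m l)) (fun θ => source (Λ θ) u0 (dat θ)) :=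
  (tame_inv_u0 hΛ hu).coef_mul hΛ (tame_F hΛ hadm)

theorem tame_V₀ (hΛ : ∀ θ, 0 < Λ θ) (hadm : ∀ θ, Admissible κ m l B (Λ θ) u0 (dat θ)) :
    Tame Λ (fun _ => 1) (weight κ (-min m l)) (fun θ p => (dat θ).V₀ p.2) :=
  Tame.of_snd hΛ (fun θ => (hadm θ).smooth_V₀) fun k => ⟨|B k|, fun θ Y hY => by
    rw [one_mul]; exact bound_inv_weight (min_le_left m l) hY ((hadm θ).decay_V₀ k Y hY)⟩

theorem tame_V₁ (hΛ : ∀ θ, 0 < Λ θ) (hadm : ∀ θ, Admissible κ m l B (Λ θ) u0 (dat θ)) :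
    Tame Λ (fun _ => 1) (weight κ (-min m l)) (fun θ p => (dat θ).V₁ p.2) :=
  Tame.of_snd hΛ (fun θ => (hadm θ).smooth_V₁) fun k => ⟨|B k|, fun θ Y hY => by
    rw [one_mul]; exact bound_inv_weight (min_le_left m l) hY ((hadm θ).decay_V₁ k Y hY)⟩

theorem tame_U (hΛ : ∀ θ, 0 < Λ θ) (hadm : ∀ θ, Admissible κ m l B (Λ θ) u0 (dat θ)) :
    Tame Λ (fun _ => 1) (weight κ (-min m l)) (fun θ p => (dat θ).U p.2) :=
  Tame.of_snd hΛ (fun θ => (hadm θ).smooth_U) fun k => ⟨|B k|, fun θ Y hY => by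
    rw [one_mul]; exact bound_inv_weight le_rfl hY ((hadm θ).decay_U k Y hY)⟩

theorem tame_V₀_sub_V₁ (hΛ : ∀ θ, 0 < Λ θ) (hadm : ∀ θ, Admissible κ m l B (Λ θ) u0 (dat θ)) :
    Tame Λ Λ (weight κ (-min m l)) (fun θ p => (dat θ).V₀ p.2 - (dat θ).V₁ p.2) := by
  refine Tame.of_snd (u := fun θ Y => (dat θ).V₀ Y - (dat θ).V₁ Y) hΛ
    (fun θ => (hadm θ).smooth_V₀.sub (hadm θ).smooth_V₁) fun k => ⟨|B k|, fun θ Y hY => ?_⟩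
  rw [dHalf_sub (hadm θ).smooth_V₀ (hadm θ).smooth_V₁ k hY]
  refine (bound_inv_weight (κ := κ) le_rfl hY ((hadm θ).close k Y hY)).trans_eq ?_
  rw [abs_mul, abs_of_pos (hΛ θ), mul_assoc]

theorem tame_sideFun (hΛ : ∀ θ, 0 < Λ θ) (hu : IsShearFlow u0)
    (hadm : ∀ θ, Admissible κ m l B (Λ θ) u0 (dat θ)) {x₀ : Θ → ℝ}
    (hx₀ : ∀ θ, x₀ θ ∈ Icc 0 (Λ θ)) {V : Θ → ℝ → ℝ}
    (hV : Tame Λ (fun _ => 1) (weight κ (-min m l)) (fun θ p => V θ p.2)) (j : ℕ) :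
    Tame Λ (fun _ => 1) (weight κ (-min m l))
      (fun θ p => sideFun (Λ θ) u0 (dat θ) (x₀ θ) (V θ) j p.2) := by
  induction j with
  | zero => exact hV
  | succ j ih =>
    have h := (((ih.dY_iterate hΛ 2).neg hΛ).add hΛ ((tame_potential hΛ hu).coef_mul hΛ ih)).sub hΛ
      (((tame_source hΛ hu hadm).dx_iterate hΛ (2 * j)).trace hΛ hx₀)
    simp only [dY_iterate_snd] at h
    exact h

/-- The recursion is linear with the same coefficients on both sides; only the traces of the source
differ, and these by `O(Λ)`. -/
theorem tame_sideFun_sub (hΛ : ∀ θ, 0 < Λ θ) (hu : IsShearFlow u0)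
    (hadm : ∀ θ, Admissible κ m l B (Λ θ) u0 (dat θ)) (j : ℕ) :
    Tame Λ Λ (weight κ (-min m l)) (fun θ p => sideFun (Λ θ) u0 (dat θ) 0 (dat θ).V₀ j p.2 -
      sideFun (Λ θ) u0 (dat θ) (Λ θ) (dat θ).V₁ j p.2) := by
  induction j with
  | zero => exact tame_V₀_sub_V₁ hΛ hadm
  | succ j ih =>
    have ht := ((tame_source hΛ hu hadm).dx_iterate hΛ (2 * j)).trace_sub_trace hΛ
    simp only [one_mul] at ht
    have h := (((ih.dY_iterate hΛ 2).neg hΛ).add hΛ ((tame_potential hΛ hu).coef_mul hΛ ih)).sub hΛ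
      ht
    refine h.congr fun θ p hp => ?_
    have m0 : (0 : ℝ) ∈ Icc 0 (Λ θ) := ⟨le_rfl, (hΛ θ).le⟩
    have m1 : Λ θ ∈ Icc 0 (Λ θ) := ⟨(hΛ θ).le, le_rfl⟩
    have s0 := smooth_sideFun (hΛ θ) hu (smooth_F (hΛ θ) (hadm θ)) m0 (hadm θ).smooth_V₀ j
    have s1 := smooth_sideFun (hΛ θ) hu (smooth_F (hΛ θ) (hadm θ)) m1 (hadm θ).smooth_V₁ j
    have e := congrFun (dY_iterate_snd (fun Y => sideFun (Λ θ) u0 (dat θ) 0 (dat θ).V₀ j Y -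
      sideFun (Λ θ) u0 (dat θ) (Λ θ) (dat θ).V₁ j Y) 2) p
    simp only [e, dHalf_sub s0 s1 2 hp.2, sideFun]
    ring

end Family

/-! ### Existence for the data of an Euler layer -/

/-- The bottom datum of the `j`-th differentiated problem. -/
def bottomFun (L : ℝ) (d : LayerData) (j : ℕ) (x : ℝ) : ℝ :=
  -iteratedDerivWithin (2 * j) d.a (Icc 0 L) x

/-- Projection to `[0, L]`. -/
def clampX (L x : ℝ) : ℝ := max 0 (min x L)

theorem clampX_mem {L : ℝ} (hL : 0 < L) (x : ℝ) : clampX L x ∈ Icc 0 L :=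
  ⟨le_max_left _ _, max_le hL.le (min_le_right _ _)⟩

theorem clampX_of_mem {L x : ℝ} (hx : x ∈ Icc 0 L) : clampX L x = x := by
  rw [clampX, min_eq_left hx.2, max_eq_right hx.1]

theorem continuous_clampX (L : ℝ) : Continuous (clampX L) := by unfold clampX; fun_prop

theorem continuous_comp_clampX {L : ℝ} (hL : 0 < L) {g : ℝ → ℝ} (hg : ContinuousOn g (Icc 0 L)) :
    Continuous fun x => g (clampX L x) :=
  hg.comp_continuous (continuous_clampX L) fun x => clampX_mem hL x

theorem continuous_comp_max {g : ℝ → ℝ} (hg : ContinuousOn g (Ici 0)) :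
    Continuous fun Y => g (max Y 0) :=
  hg.comp_continuous (by fun_prop) fun _ => mem_Ici.2 (le_max_right _ _)

theorem continuous_comp_clamp {L : ℝ} (hL : 0 < L) {f : ℝ × ℝ → ℝ}
    (hf : ContinuousOn f (closedStrip L)) :
    Continuous fun p : ℝ × ℝ => f (clampX L p.1, max p.2 0) := by
  have := continuous_clampX L
  exact hf.comp_continuous (by fun_prop) fun p =>
    ⟨clampX_mem hL _, mem_Ici.2 (le_max_right _ _)⟩

/-- Existence for the tower of Dirichlet problems of an Euler layer on a thin strip. -/
theorem exists_towerSolution {κ : WeightKind} {m l L K Q : ℝ} {B : ℕ → ℝ} {u0 : ℝ → ℝ}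
    {d : LayerData} (hm : 0 < m) (hl : 0 < l) (hL : 0 < L) (hK : Q < K) (hKL : K * L ^ 2 ≤ 1)
    (hu : IsShearFlow u0) (hq : ∀ Y, 0 ≤ Y → |potential u0 Y| ≤ Q)
    (hadm : Admissible κ m l B L u0 d) :
    ∃ E X D M : ℕ → ℝ × ℝ → ℝ, IsTowerSolution L (potential u0)
      (fun j => (dx L)^[2 * j] (source L u0 d)) (fun j => (dx L)^[2 * j + 1] (source L u0 d))
      (bottomFun L d) (sideFun L u0 d 0 d.V₀) (sideFun L u0 d L d.V₁) E X D M := by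
  have hF := smooth_F hL hadm
  have m0 : (0 : ℝ) ∈ Icc 0 L := ⟨le_rfl, hL.le⟩
  have m1 : L ∈ Icc 0 L := ⟨hL.le, le_rfl⟩
  have hsrc := smooth_source hu hF
  have s0 := smooth_sideFun hL hu hF m0 hadm.smooth_V₀
  have s1 := smooth_sideFun hL hu hF m1 hadm.smooth_V₁
  have hΛ : ∀ _ : Unit, 0 < L := fun _ => hL
  have hadm' : ∀ _ : Unit, Admissible κ m l B L u0 d := fun _ => hadm
  -- Positivity of `m` and `l` enters here: decaying data are bounded, as the series construction
  -- requires.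
  have hW : ∀ Y, 0 ≤ Y → weight κ (-min m l) Y ≤ 1 := fun Y hY => by
    have := weight_antitone κ (m := -min m l) (by simp [hm.le, hl.le]) le_rfl hY
    rwa [weight_zero] at this
  have hbd : ∀ {g : ℝ × ℝ → ℝ}, Tame (fun _ : Unit => L) (fun _ => 1) (weight κ (-min m l))
      (fun _ => g) → ∃ C, ∀ p ∈ closedStrip L, |g p| ≤ C := by
    intro g hg
    obtain ⟨C, hC⟩ := hg.bound 0
    refine ⟨|C|, fun p hp => (hC () p hp).trans ?_⟩
    have h1 := hW p.2 hp.2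
    have h2 := (weight_pos κ (-min m l) hp.2).le
    rw [one_mul]
    exact (mul_le_mul_of_nonneg_right (le_abs_self C) h2).trans
      (mul_le_of_le_one_right (abs_nonneg _) h1)
  have hside : ∀ {V : ℝ → ℝ}, ContDiffOn ℝ ∞ V (Ici 0) → ∃ V' : ℝ → ℝ,
      (∀ Y, 0 ≤ Y → HasDerivWithinAt (fun Y => V (max Y 0)) (V' Y) (Ici 0) Y) ∧
      ∀ Y, 0 ≤ Y → HasDerivWithinAt V' (dHalf 2 V Y) (Ici 0) Y := by
    intro V hV
    refine ⟨dHalf 1 V, fun Y hY => ?_, fun Y hY => hasDerivWithinAt_dHalf hV 1 hY⟩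
    have := hasDerivWithinAt_dHalf hV 0 hY
    rw [dHalf_zero] at this
    exact this.congr (fun Z hZ => by rw [max_eq_left hZ]) (by rw [max_eq_left hY])
  have hbcont : ∀ k, ContinuousOn (iteratedDerivWithin k d.a (Icc 0 L)) (Icc 0 L) := fun k =>
    hadm.smooth_a.continuousOn_iteratedDerivWithin (WithTop.coe_le_coe.2 le_top)
      (uniqueDiffOn_Icc hL)
  have hbder : ∀ k, ∀ x ∈ Icc 0 L, HasDerivWithinAt (iteratedDerivWithin k d.a (Icc 0 L))
      (iteratedDerivWithin (k + 1) d.a (Icc 0 L) x) (Icc 0 L) x := by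
    intro k x hx
    rw [iteratedDerivWithin_succ]
    exact ((hadm.smooth_a.differentiableOn_iteratedDerivWithin
      (WithTop.coe_lt_coe.2 (ENat.natCast_lt_top k)) (uniqueDiffOn_Icc hL)) x hx).hasDerivWithinAt
  have hfeq : ∀ j, EqOn (fun p : ℝ × ℝ => (dx L)^[j] (source L u0 d) (clampX L p.1, max p.2 0))
      ((dx L)^[j] (source L u0 d)) (closedStrip L) := fun j p hp => by
    simp only [clampX_of_mem hp.1, max_eq_left (show (0 : ℝ) ≤ p.2 from hp.2)]
  have hdx : ∀ j, HasDx L ((dx L)^[j] (source L u0 d)) ((dx L)^[j + 1] (source L u0 d)) := by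
    intro j
    rw [Function.iterate_succ_apply']
    exact (hsrc.dx_iterate hL j).hasDx hL
  -- The tower asks for functions continuous and bounded on the whole line or plane, so all data are
  -- extended by projection onto the closed strip; nothing changes on the strip itself.
  have T : IsDirichletTower L Q (fun Y => potential u0 (max Y 0))
      (fun j p => (dx L)^[2 * j] (source L u0 d) (clampX L p.1, max p.2 0))
      (fun j => (dx L)^[2 * j + 1] (source L u0 d)) (fun j x => bottomFun L d j (clampX L x))
      (fun j Y => sideFun L u0 d 0 d.V₀ j (max Y 0))
      (fun j Y => sideFun L u0 d L d.V₁ j (max Y 0)) := by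
    refine ⟨continuous_comp_max (smooth_potential hu).continuousOn,
      fun Y => hq _ (le_max_right _ _),
      fun j => continuous_comp_clamp hL (hsrc.dx_iterate hL _).continuousOn, fun j => ?_,
      fun j => (hdx (2 * j)).congr (hfeq _) fun _ _ => rfl,
      fun j => (hdx (2 * j + 1)).congr (fun _ _ => rfl) (hfeq (2 * (j + 1))),
      fun j => (continuous_comp_clampX hL (hbcont _)).neg, fun j => ?_,
      fun j => continuous_comp_max (s0 j).continuousOn,
      fun j => continuous_comp_max (s1 j).continuousOn, fun j => ?_, fun j => ?_, fun j => ?_,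
      fun j => ?_, fun j => ?_, fun j => ?_⟩
    · obtain ⟨C, hC⟩ := hbd ((tame_source hΛ hu hadm').dx_iterate hΛ (2 * j))
      exact ⟨C, fun p => hC _ ⟨clampX_mem hL _, mem_Ici.2 (le_max_right _ _)⟩⟩
    · refine ⟨fun x => -iteratedDerivWithin (2 * j + 1) d.a (Icc 0 L) x, fun x hx => ?_,
        fun x hx => ?_⟩
      · exact (hbder (2 * j) x hx).neg.congr (fun y hy => by rw [clampX_of_mem hy]; rfl)
          (by rw [clampX_of_mem hx]; rfl)
      · rw [clampX_of_mem hx]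
        exact (hbder (2 * j + 1) x hx).neg
    · obtain ⟨C, hC⟩ := hbd (tame_sideFun hΛ hu hadm' (fun _ => m0) (tame_V₀ hΛ hadm') j)
      exact ⟨C, fun Y => hC (0, max Y 0) ⟨m0, mem_Ici.2 (le_max_right _ _)⟩⟩
    · obtain ⟨C, hC⟩ := hbd (tame_sideFun hΛ hu hadm' (fun _ => m1) (tame_V₁ hΛ hadm') j)
      exact ⟨C, fun Y => hC (0, max Y 0) ⟨m0, mem_Ici.2 (le_max_right _ _)⟩⟩
    · obtain ⟨V', h1, h2⟩ := hside (s0 j)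
      refine ⟨V', h1, fun Y hY => (h2 Y hY).congr_deriv ?_⟩
      simp only [max_eq_left hY, clampX_of_mem m0, sideFun]
      ring
    · obtain ⟨V', h1, h2⟩ := hside (s1 j)
      refine ⟨V', h1, fun Y hY => (h2 Y hY).congr_deriv ?_⟩
      simp only [max_eq_left hY, clampX_of_mem m1, sideFun]
      ring
    · simp only [max_self, clampX_of_mem m0]
      exact sideFun_corner hL hu hF m0 hadm.smooth_V₀ hadm.corner_left j
    · simp only [max_self, clampX_of_mem m1]
      exact sideFun_corner hL hu hF m1 hadm.smooth_V₁ hadm.corner_right j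
  obtain ⟨E, X, D, M, S⟩ := T.exists_solution hL hK hKL
  refine ⟨E, X, D, M, S.bounded, fun j Y hY => ?_, fun j Y hY => ?_, fun j x hx => ?_, S.contE,
    S.contX, S.contD, S.contM, S.E_dx, S.X_dx, S.D_dx, S.M_dx, S.E_dY, S.X_dY,
    fun j => (S.D_dY j).congr (fun _ _ => rfl) fun p hp => ?_,
    fun j => (S.M_dY j).congr (fun _ _ => rfl) fun p hp => ?_⟩
  · rw [S.left j Y hY, max_eq_left hY]
  · rw [S.right j Y hY, max_eq_left hY]
  · rw [S.bottom j x hx, clampX_of_mem hx]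
  · simp only [clampX_of_mem hp.1, max_eq_left (show (0 : ℝ) ≤ p.2 from hp.2)]
  · simp only [max_eq_left (show (0 : ℝ) ≤ p.2 from hp.2)]

/-! ### Uniform weighted estimates -/

section Estimates

variable {Θ : Type*} {Λ : Θ → ℝ} {W : ℝ → ℝ}

theorem UnifBound.exists_nonneg {g : Θ → ℝ × ℝ → ℝ} (hW : ∀ Y, 0 ≤ Y → 0 ≤ W Y)
    (hg : UnifBound Λ (fun _ => 1) W g) :
    ∃ C, 0 ≤ C ∧ ∀ θ, ∀ p ∈ closedStrip (Λ θ), |g θ p| ≤ C * W p.2 := by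
  obtain ⟨C, hC⟩ := hg
  refine ⟨|C|, abs_nonneg C, fun θ p hp => (hC θ p hp).trans ?_⟩
  rw [one_mul]
  exact mul_le_mul_of_nonneg_right (le_abs_self C) (hW _ hp.2)

theorem UnifBound.coef_mul {g h : Θ → ℝ × ℝ → ℝ} (hg : UnifBound Λ (fun _ => 1) (fun _ => 1) g)
    (hh : UnifBound Λ (fun _ => 1) W h) :
    UnifBound Λ (fun _ => 1) W (fun θ p => g θ p * h θ p) := by
  simpa only [one_mul] using hg.mul hh

/-- Interpolation in `x`: a family with bounded second `x`-derivative whose side values differ by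
`O(L)` has a bounded first `x`-derivative. -/
theorem unifBound_of_second_dx (hΛ : ∀ θ, 0 < Λ θ) (hΛ1 : ∀ θ, Λ θ ≤ 1)
    (hW : ∀ Y, 0 ≤ Y → 0 ≤ W Y) {g g' g'' : Θ → ℝ × ℝ → ℝ}
    (h1 : ∀ θ, HasDx (Λ θ) (g θ) (g' θ)) (h2 : ∀ θ, HasDx (Λ θ) (g' θ) (g'' θ))
    (hs : UnifBound Λ Λ W (fun θ p => g θ (0, p.2) - g θ (Λ θ, p.2)))
    (hb : UnifBound Λ (fun _ => 1) W g'') : UnifBound Λ (fun _ => 1) W g' := by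
  obtain ⟨C, hC⟩ := hs
  obtain ⟨D, hD0, hD⟩ := hb.exists_nonneg hW
  refine ⟨C + D, fun θ p hp => ?_⟩
  have key := abs_deriv_le_of_second_deriv (A₁ := C * W p.2) (A₂ := D * W p.2) (g := fun x => g θ (x, p.2))
    (g' := fun x => g' θ (x, p.2)) (g'' := fun x => g'' θ (x, p.2)) (hΛ θ)
    (fun x hx => h1 θ (x, p.2) ⟨hx, hp.2⟩) (fun x hx => h2 θ (x, p.2) ⟨hx, hp.2⟩)
    (by
      rw [abs_sub_comm, sub_zero]
      exact (hC θ p hp).trans_eq (by ring))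
    (fun x hx => hD θ (x, p.2) ⟨hx, hp.2⟩) hp.1
  rw [sub_zero] at key
  have h3 : 0 ≤ D * W p.2 := mul_nonneg hD0 (hW _ hp.2)
  calc _ ≤ C * W p.2 + D * W p.2 * Λ θ := key
    _ ≤ C * W p.2 + D * W p.2 * 1 := by gcongr; exact hΛ1 θ
    _ = _ := by ring

/-- Interpolation in `Y` on unit intervals. -/
theorem unifBound_of_second_dY (hW : ∀ Y, 0 ≤ Y → 0 ≤ W Y)
    (hanti : ∀ Y Z, 0 ≤ Y → Y ≤ Z → W Z ≤ W Y) {g g' g'' : Θ → ℝ × ℝ → ℝ}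
    (h1 : ∀ θ, HasDY (Λ θ) (g θ) (g' θ)) (h2 : ∀ θ, HasDY (Λ θ) (g' θ) (g'' θ))
    (hg : UnifBound Λ (fun _ => 1) W g) (hb : UnifBound Λ (fun _ => 1) W g'') :
    UnifBound Λ (fun _ => 1) W g' := by
  obtain ⟨C, hC0, hC⟩ := hg.exists_nonneg hW
  obtain ⟨D, hD0, hD⟩ := hb.exists_nonneg hW
  refine ⟨2 * C + D, fun θ p hp => ?_⟩
  have hp2 : (0 : ℝ) ≤ p.2 := hp.2
  have hsub : Icc p.2 (p.2 + 1) ⊆ Ici 0 := fun z hz => mem_Ici.2 (hp2.trans hz.1)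
  have hWle : ∀ z, p.2 ≤ z → W z ≤ W p.2 := fun z hz => hanti _ _ hp2 hz
  have key := abs_deriv_le_of_second_deriv (A₁ := 2 * C * W p.2) (A₂ := D * W p.2)
    (g := fun x => g θ (p.1, x)) (g' := fun x => g' θ (p.1, x)) (g'' := fun x => g'' θ (p.1, x))
    (lt_add_one p.2)
    (fun x hx => (h1 θ (p.1, x) ⟨hp.1, hsub hx⟩).mono hsub)
    (fun x hx => (h2 θ (p.1, x) ⟨hp.1, hsub hx⟩).mono hsub)
    (by
      have e1 := hC θ (p.1, p.2 + 1) ⟨hp.1, hsub ⟨by linarith, le_rfl⟩⟩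
      have e2 := hC θ p hp
      have e3 := mul_le_mul_of_nonneg_left (hWle (p.2 + 1) (by linarith)) hC0
      have e4 := abs_sub (g θ (p.1, p.2 + 1)) (g θ (p.1, p.2))
      simp only [Prod.mk.eta] at e1 e2 e4 ⊢
      rw [add_sub_cancel_left, mul_one]
      linarith)
    (fun x hx => (hD θ (p.1, x) ⟨hp.1, hsub hx⟩).trans
      (mul_le_mul_of_nonneg_left (hWle x hx.1) hD0))
    (x := p.2) ⟨le_rfl, by linarith⟩
  exact key.trans_eq (by ring)

/-- Uniform weighted bounds for all the derivatives of solutions of towers of Dirichlet problems on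
thin strips. -/
theorem tame_of_isTowerSolution {κ : WeightKind} {r Q K : ℝ} (hr : 0 ≤ r) (hQ : 0 ≤ Q)
    (hK : Q + |-r * κ.lower (-r)| + 1 ≤ K) (hΛ : ∀ θ, 0 < Λ θ) (hΛ1 : ∀ θ, Λ θ ≤ 1)
    (hKL : ∀ θ, K * Λ θ ^ 2 ≤ 1) {q : ℝ → ℝ} (hq : ∀ Y, 0 ≤ Y → |q Y| ≤ Q)
    (hqs : ContDiffOn ℝ ∞ q (Ici 0)) {f fx : Θ → ℕ → ℝ × ℝ → ℝ} {b V₀ V₁ : Θ → ℕ → ℝ → ℝ}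
    {E X D M : Θ → ℕ → ℝ × ℝ → ℝ}
    (S : ∀ θ, IsTowerSolution (Λ θ) q (f θ) (fx θ) (b θ) (V₀ θ) (V₁ θ) (E θ) (X θ) (D θ) (M θ))
    (tq : Tame Λ (fun _ => 1) (fun _ => 1) (fun _ p => q p.2))
    (tf : ∀ j, Tame Λ (fun _ => 1) (weight κ (-r)) (fun θ => f θ j))
    (tfx : ∀ j, Tame Λ (fun _ => 1) (weight κ (-r)) (fun θ => fx θ j))
    (hb : ∀ j, ∃ C, ∀ θ, ∀ x ∈ Icc 0 (Λ θ), |b θ j x| ≤ C)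
    (tV₀ : ∀ j, Tame Λ (fun _ => 1) (weight κ (-r)) (fun θ p => V₀ θ j p.2))
    (tV₁ : ∀ j, Tame Λ (fun _ => 1) (weight κ (-r)) (fun θ p => V₁ θ j p.2))
    (tV : ∀ j, Tame Λ Λ (weight κ (-r)) (fun θ p => V₀ θ j p.2 - V₁ θ j p.2)) :
    Tame Λ (fun _ => 1) (weight κ (-r)) (fun θ => E θ 0) := by
  have hW0 : ∀ Y, 0 ≤ Y → 0 < weight κ (-r) Y := fun Y hY => weight_pos κ _ hY
  have hW : ∀ Y, 0 ≤ Y → 0 ≤ weight κ (-r) Y := fun Y hY => (hW0 Y hY).le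
  have m0 : ∀ θ, (0 : ℝ) ∈ Icc 0 (Λ θ) := fun θ => ⟨le_rfl, (hΛ θ).le⟩
  have m1 : ∀ θ, Λ θ ∈ Icc 0 (Λ θ) := fun θ => ⟨(hΛ θ).le, le_rfl⟩
  -- The maximum principle is applied to each level separately: `E θ (j + 1)` occurs in both pure
  -- second derivatives and cancels in the Laplacian.
  have bE : ∀ j, UnifBound Λ (fun _ => 1) (weight κ (-r)) (fun θ => E θ j) := by
    intro j
    obtain ⟨C₁, n1, h1⟩ := UnifBound.exists_nonneg hW ((tf j).bound 0)
    obtain ⟨C₂, n2, h2⟩ := UnifBound.exists_nonneg hW ((tV₀ j).bound 0)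
    obtain ⟨C₃, n3, h3⟩ := UnifBound.exists_nonneg hW ((tV₁ j).bound 0)
    obtain ⟨C₄, h4⟩ := hb j
    set A := C₁ + C₂ + C₃ + |C₄| with hA
    have n4 := abs_nonneg C₄
    have hle : ∀ {C : ℝ}, C ≤ A → ∀ {Y : ℝ}, 0 ≤ Y →
        C * weight κ (-r) Y ≤ A * weight κ (-r) Y := fun h _ hY =>
      mul_le_mul_of_nonneg_right h (hW _ hY)
    refine ⟨2 * A, fun θ p hp => ?_⟩
    rw [one_mul]
    refine abs_le_of_weighted_bounds hQ (abs_nonneg _) hK (hKL θ) hq hW0 (continuousOn_weight κ _)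
      (fun Y hY => hasD2At_weight κ _ hY) (fun Y hY => weight_second_deriv_le κ _ hY)
      (A := A) (by positivity) ((S θ).contE j) ((S θ).bounded j) (vxx := E θ (j + 1))
      (vyy := fun p => -E θ (j + 1) p + q p.2 * E θ j p - f θ j p)
      (fun p hp => ?_) (fun p hp => ?_) (fun p hp => ?_) (fun x hx => ?_) (fun Y hY => ?_)
      (fun Y hY => ?_) p hp
    · have hp' := strip_subset_closedStrip _ hp
      exact HasD2At.of_hasDerivWithinAt (s := Icc 0 (Λ θ)) (g'' := fun s => E θ (j + 1) (s, p.2))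
        (fun z hz => (S θ).E_dx j (z, p.2) ⟨hz, hp'.2⟩)
        (fun z hz => (S θ).X_dx j (z, p.2) ⟨hz, hp'.2⟩) (Icc_mem_nhds hp.1.1 hp.1.2)
    · have hp' := strip_subset_closedStrip _ hp
      exact HasD2At.of_hasDerivWithinAt (s := Ici 0)
        (g'' := fun t => -E θ (j + 1) (p.1, t) + q t * E θ j (p.1, t) - f θ j (p.1, t))
        (fun z hz => (S θ).E_dY j (p.1, z) ⟨hp'.1, hz⟩)
        (fun z hz => (S θ).D_dY j (p.1, z) ⟨hp'.1, hz⟩) (Ici_mem_nhds hp.2)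
    · have hp' := strip_subset_closedStrip _ hp
      have e : -(E θ (j + 1) p + (-E θ (j + 1) p + q p.2 * E θ j p - f θ j p)) + q p.2 * E θ j p
          = f θ j p := by ring
      rw [e]
      exact (h1 θ p hp').trans (hle (by linarith) hp'.2)
    · rw [(S θ).bottom j x hx, weight_zero, mul_one]
      exact (h4 θ x hx).trans ((le_abs_self _).trans (by linarith))
    · rw [(S θ).left j Y hY]
      exact (h2 θ (0, Y) ⟨m0 θ, hY⟩).trans (hle (by linarith) hY)
    · rw [(S θ).right j Y hY]
      exact (h3 θ (0, Y) ⟨m0 θ, hY⟩).trans (hle (by linarith) hY)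
  have hs : ∀ θ j Y, 0 ≤ Y → E θ j (0, Y) - E θ j (Λ θ, Y) = V₀ θ j Y - V₁ θ j Y :=
    fun θ j Y hY => by rw [(S θ).left j Y hY, (S θ).right j Y hY]
  -- Side values that differ by `O(Λ)` keep the chord slope bounded as the width tends to 0.
  have bX : ∀ j, UnifBound Λ (fun _ => 1) (weight κ (-r)) (fun θ => X θ j) := fun j =>
    unifBound_of_second_dx hΛ hΛ1 hW (fun θ => (S θ).E_dx j) (fun θ => (S θ).X_dx j)
      (UnifBound.congr ((tV j).bound 0) fun θ p hp => hs θ j p.2 hp.2) (bE (j + 1))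
  have bDY : ∀ j, UnifBound Λ (fun _ => 1) (weight κ (-r))
      (fun θ p => -E θ (j + 1) p + q p.2 * E θ j p - f θ j p) := fun j => by
    simp only [sub_eq_add_neg]
    exact ((bE (j + 1)).neg.add (UnifBound.coef_mul (tq.bound 0) (bE j))).add
      (UnifBound.neg ((tf j).bound 0))
  have bD : ∀ j, UnifBound Λ (fun _ => 1) (weight κ (-r)) (fun θ => D θ j) := fun j =>
    unifBound_of_second_dY hW (fun Y Z hY hYZ => weight_antitone κ (by linarith) hY hYZ)
      (fun θ => (S θ).E_dY j) (fun θ => (S θ).D_dY j) (bE j) (bDY j)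
  have hsD : ∀ θ j Y, 0 ≤ Y → D θ j (0, Y) - D θ j (Λ θ, Y) =
      dY (fun p => V₀ θ j p.2 - V₁ θ j p.2) (0, Y) := fun θ j Y hY => by
    have h0 := (S θ).E_dY j (0, Y) ⟨m0 θ, hY⟩
    have h1 := (S θ).E_dY j (Λ θ, Y) ⟨m1 θ, hY⟩
    have h2 := (h0.sub h1).congr (f₁ := fun t => V₀ θ j t - V₁ θ j t)
      (fun t ht => (hs θ j t ht).symm) (hs θ j Y hY).symm
    exact (h2.derivWithin (uniqueDiffOn_Ici 0 _ hY)).symm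
  have bM : ∀ j, UnifBound Λ (fun _ => 1) (weight κ (-r)) (fun θ => M θ j) := fun j =>
    unifBound_of_second_dx hΛ hΛ1 hW (fun θ => (S θ).D_dx j) (fun θ => (S θ).M_dx j)
      (UnifBound.congr (((tV j).dY hΛ).bound 0) fun θ p hp => hsD θ j p.2 hp.2) (bD (j + 1))
  have hsm := fun θ j => (S θ).smooth (hΛ θ) hqs (fun j => (tf j).smooth θ)
    (fun j => (tfx j).smooth θ) j
  have sE := fun j θ => (hsm θ j).1
  have sX := fun j θ => (hsm θ j).2.1
  -- The same closed system as in `IsTowerSolution.smooth` now propagates bounds, starting from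
  -- those of order zero above.
  have key : ∀ n : ℕ, ∀ j, UnifBoundUpTo Λ (fun _ => 1) (weight κ (-r)) n (fun θ => E θ j) ∧
      UnifBoundUpTo Λ (fun _ => 1) (weight κ (-r)) n (fun θ => X θ j) ∧
      UnifBoundUpTo Λ (fun _ => 1) (weight κ (-r)) n (fun θ => D θ j) ∧
      UnifBoundUpTo Λ (fun _ => 1) (weight κ (-r)) n (fun θ => M θ j) := by
    intro n
    induction n with
    | zero => exact fun j => ⟨bE j, bX j, bD j, bM j⟩
    | succ n ih =>
      intro j
      have comb : ∀ {e e' φ : Θ → ℝ × ℝ → ℝ}, (∀ θ, SmoothStrip (Λ θ) (e θ)) →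
          (∀ θ, SmoothStrip (Λ θ) (e' θ)) →
          UnifBoundUpTo Λ (fun _ => 1) (weight κ (-r)) n e →
          UnifBoundUpTo Λ (fun _ => 1) (weight κ (-r)) n e' →
          Tame Λ (fun _ => 1) (weight κ (-r)) φ →
          UnifBoundUpTo Λ (fun _ => 1) (weight κ (-r)) n
            (fun θ p => -e' θ p + q p.2 * e θ p - φ θ p) := by
        intro e e' φ se se' be be' tφ
        have h1 := (tq.bound n).mul hΛ tq.smooth se be
        simp only [one_mul] at h1
        have sq := fun θ => (tq.smooth θ).mul (se θ)
        have sn := fun θ => (se' θ).neg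
        simp only [sub_eq_add_neg]
        exact ((be'.neg hΛ se').add hΛ sn sq h1).add hΛ (fun θ => (sn θ).add (sq θ))
          (fun θ => (tφ.smooth θ).neg) ((tφ.bound n).neg hΛ tφ.smooth)
      exact ⟨.of_partials hΛ (bE j) (fun θ => (S θ).E_dx j) (fun θ => (S θ).E_dY j) (ih j).2.1
          (ih j).2.2.1,
        .of_partials hΛ (bX j) (fun θ => (S θ).X_dx j) (fun θ => (S θ).X_dY j) (ih (j + 1)).1
          (ih j).2.2.2,
        .of_partials hΛ (bD j) (fun θ => (S θ).D_dx j) (fun θ => (S θ).D_dY j) (ih j).2.2.2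
          (comb (sE j) (sE (j + 1)) (ih j).1 (ih (j + 1)).1 (tf j)),
        .of_partials hΛ (bM j) (fun θ => (S θ).M_dx j) (fun θ => (S θ).M_dY j) (ih (j + 1)).2.2.1
          (comb (sX j) (sX (j + 1)) (ih j).2.1 (ih (j + 1)).2.1 (tfx j))⟩
  exact ⟨sE 0, fun n => (key n 0).1⟩

end Estimates

/-! ### Uniqueness of bounded solutions -/

/-- Lets the maximum principle apply to a competing solution that is only C² in the open strip,
where one-sided and ordinary derivatives agree. -/
theorem hasD2At_derivWithin {g : ℝ → ℝ} {U s : Set ℝ} (hU : IsOpen U) (hUs : U ⊆ s)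
    (hg : ContDiffOn ℝ 2 g U) {x : ℝ} (hx : x ∈ U) :
    HasD2At g (derivWithin (derivWithin g s) s x) x := by
  have hs : ∀ z ∈ U, s ∈ 𝓝 z := fun z hz => mem_of_superset (hU.mem_nhds hz) hUs
  have he : ∀ z ∈ U, derivWithin g s z = deriv g z := fun z hz => derivWithin_of_mem_nhds (hs z hz)
  refine ⟨derivWithin g s, ?_, ?_⟩
  · filter_upwards [hU.mem_nhds hx] with z hz
    rw [he z hz]
    exact ((hg.differentiableOn (by simp)).differentiableAt (hU.mem_nhds hz)).hasDerivAt
  · rw [derivWithin_of_mem_nhds (hs x hx)]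
    have h1 : ContDiffOn ℝ 1 (deriv g) U := hg.deriv_of_isOpen hU (by norm_num)
    have h2 := (h1.differentiableOn (by simp)).differentiableAt (hU.mem_nhds hx)
    exact (h2.congr_of_eventuallyEq
      (by filter_upwards [hU.mem_nhds hx] with z hz using he z hz)).hasDerivAt

theorem hasD2At_dx {L : ℝ} {v : ℝ × ℝ → ℝ} (hv : ContDiffOn ℝ 2 v (strip L)) {p : ℝ × ℝ}
    (hp : p ∈ strip L) : HasD2At (fun s => v (s, p.2)) (dx L (dx L v) p) p.1 :=
  hasD2At_derivWithin isOpen_Ioo Ioo_subset_Icc_self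
    (hv.comp (contDiffOn_id.prodMk contDiffOn_const) fun _ hs => ⟨hs, hp.2⟩) hp.1

theorem hasD2At_dY {L : ℝ} {v : ℝ × ℝ → ℝ} (hv : ContDiffOn ℝ 2 v (strip L)) {p : ℝ × ℝ}
    (hp : p ∈ strip L) : HasD2At (fun t => v (p.1, t)) (dY (dY v) p) p.2 :=
  hasD2At_derivWithin isOpen_Ioi Ioi_subset_Ici_self
    (hv.comp (contDiffOn_const.prodMk contDiffOn_id) fun _ hs => ⟨hp.1, hs⟩) hp.2

/-- Bounded solutions of the Dirichlet problem on a thin strip are unique. -/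
theorem IsVorticitySolution.eqOn {L K Q : ℝ} {u0 : ℝ → ℝ} {d : LayerData} {v v' : ℝ × ℝ → ℝ}
    (hu : IsShearFlow u0) (hQ : 0 ≤ Q) (hK : Q < K) (hKL : K * L ^ 2 ≤ 1)
    (hq : ∀ Y, 0 ≤ Y → |potential u0 Y| ≤ Q) (h' : IsVorticitySolution L u0 d v')
    (h : IsVorticitySolution L u0 d v) : EqOn v' v (closedStrip L) := by
  obtain ⟨C', hC'⟩ := h'.bounded
  obtain ⟨C, hC⟩ := h.bounded
  intro p hp
  refine sub_eq_zero.1 (eq_zero_of_homogeneous hQ hK hKL hq (h := fun p => v' p - v p)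
    (h'.cont.sub h.cont)
    ⟨C' + C, fun p hp => (abs_sub _ _).trans (add_le_add (hC' p hp) (hC p hp))⟩
    (fun p hp => (hasD2At_dx h'.regular hp).sub (hasD2At_dx h.regular hp))
    (fun p hp => (hasD2At_dY h'.regular hp).sub (hasD2At_dY h.regular hp)) (fun p hp => ?_)
    (fun x hx => by rw [h'.bottom x hx, h.bottom x hx, sub_self])
    (fun Y hY => by rw [h'.left Y hY, h.left Y hY, sub_self])
    (fun Y hY => by rw [h'.right Y hY, h.right Y hY, sub_self]) p hp)
  have e' := h'.equation p hp
  have e := h.equation p hp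
  have h0 := (hu.pos (mem_Ioi.1 hp.2).le).ne'
  simp only [laplacian] at e e'
  refine mul_left_cancel₀ h0 ?_
  simp only [potential]
  field_simp
  linarith

/-! ### Recovery of the velocity and the pressure -/

section Tower

variable {κ : WeightKind} {m l L : ℝ} {B : ℕ → ℝ} {u0 : ℝ → ℝ} {d : LayerData}

/-- The solution of the tower solves the vorticity equation up to the boundary. -/
theorem IsTowerSolution.vorticity_eq {b V₀ V₁ : ℕ → ℝ → ℝ} {fx E X D M : ℕ → ℝ × ℝ → ℝ}
    (hL : 0 < L) (hu : IsShearFlow u0)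
    (S : IsTowerSolution L (potential u0) (fun j => (dx L)^[2 * j] (source L u0 d)) fx b V₀ V₁
      E X D M) {p : ℝ × ℝ} (hp : p ∈ closedStrip L) :
    -u0 p.2 * laplacian L (E 0) p + dHalf 2 u0 p.2 * E 0 p = d.F L p := by
  have h1 : dx L (dx L (E 0)) p = E 1 p :=
    ((S.X_dx 0).congr (fun _ hr => (S.E_dx 0).eq hL hr) fun _ _ => rfl).eq hL hp
  have h2 : dY (dY (E 0)) p = -E 1 p + potential u0 p.2 * E 0 p - source L u0 d p :=
    ((S.D_dY 0).congr (fun _ hr => (S.E_dY 0).eq hr) fun _ _ => rfl).eq hp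
  have h0 := (hu.pos hp.2).ne'
  rw [laplacian, h1, h2, potential, source]
  field_simp
  ring

theorem IsTowerSolution.isVorticitySolution {fx E X D M : ℕ → ℝ × ℝ → ℝ}
    (hL : 0 < L) (hu : IsShearFlow u0)
    (S : IsTowerSolution L (potential u0) (fun j => (dx L)^[2 * j] (source L u0 d)) fx
      (bottomFun L d) (sideFun L u0 d 0 d.V₀) (sideFun L u0 d L d.V₁) E X D M)
    (hE : SmoothStrip L (E 0)) : IsVorticitySolution L u0 d (E 0) where
  regular := (ContDiffOn.of_le hE (WithTop.coe_le_coe.2 le_top)).mono (strip_subset_closedStrip L)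
  cont := S.contE 0
  bounded := S.bounded 0
  equation _ hp := S.vorticity_eq hL hu (strip_subset_closedStrip L hp)
  bottom x hx := by
    rw [S.bottom 0 x hx, bottomFun, mul_zero, iteratedDerivWithin_zero]
  left Y hY := S.left 0 Y hY
  right Y hY := S.right 0 Y hY

theorem hasDx_recoveredU (hL : 0 < L) (U : ℝ → ℝ) {v : ℝ × ℝ → ℝ} (hv : SmoothStrip L v) :
    HasDx L (recoveredU U v) (fun p => -dY v p) := fun p hp =>
  ((hasDx_snd L U p hp).sub (hasDx_integral hL (hv.dY hL).continuousOn p hp)).congr_deriv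
    (zero_sub _)

/-- A closed smooth differential form on the closed strip has a smooth potential. -/
theorem exists_smooth_potential {G₁ G₂ : ℝ × ℝ → ℝ} (hL : 0 < L) (h1 : SmoothStrip L G₁)
    (h2 : SmoothStrip L G₂) (hclosed : EqOn (dY G₁) (dx L G₂) (closedStrip L)) :
    ∃ P, SmoothStrip L P ∧ HasDx L P G₁ ∧ HasDY L P G₂ := by
  have m0 : (0 : ℝ) ∈ Icc 0 L := ⟨le_rfl, hL.le⟩
  have hc : Continuous fun t => G₂ (0, max t 0) :=
    continuous_comp_max (continuousOn_vertical h2.continuousOn m0)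
  -- The form is integrated up the side `x = 0` and then along a horizontal segment. By closedness
  -- the Y-derivative of the horizontal part is the difference of the values of `G₂` at the ends of
  -- the segment.
  have hx : HasDx L (fun p => (∫ s in (0 : ℝ)..p.1, G₁ (s, p.2)) +
      ∫ t in (0 : ℝ)..p.2, G₂ (0, max t 0)) G₁ := fun p hp =>
    (hasDx_integral hL h1.continuousOn p hp).add_const (∫ t in (0 : ℝ)..p.2, G₂ (0, max t 0))
  have hy : HasDY L (fun p => (∫ s in (0 : ℝ)..p.1, G₁ (s, p.2)) +
      ∫ t in (0 : ℝ)..p.2, G₂ (0, max t 0)) G₂ := by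
    intro p hp
    refine ((hasDY_integral hL h1 p hp).add
      (hasDerivAt_primitive hc p.2).hasDerivWithinAt).congr_deriv ?_
    have hsub : Icc 0 p.1 ⊆ Icc 0 L := Icc_subset_Icc_right hp.1.2
    have e : ∫ s in (0 : ℝ)..p.1, dY G₁ (s, p.2) = ∫ s in (0 : ℝ)..p.1, dx L G₂ (s, p.2) :=
      intervalIntegral.integral_congr fun s hs => by
        rw [uIcc_of_le hp.1.1] at hs
        exact hclosed ⟨hsub hs, hp.2⟩
    have hFTC := intervalIntegral.integral_eq_sub_of_hasDerivAt_of_le hp.1.1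
      (f := fun s => G₂ (s, p.2)) (f' := fun s => dx L G₂ (s, p.2))
      ((continuousOn_horizontal h2.continuousOn hp.2).mono hsub)
      (fun s hs => (h2.hasDx hL (s, p.2) ⟨hsub (Ioo_subset_Icc_self hs), hp.2⟩).hasDerivAt
        (Icc_mem_nhds hs.1 (hs.2.trans_le hp.1.2)))
      (((continuousOn_horizontal (h2.dx hL).continuousOn hp.2).mono
        (by rw [uIcc_of_le hp.1.1]; exact hsub)).intervalIntegrable)
    simp only [e, hFTC, max_eq_left (mem_Ici.1 hp.2), sub_add_cancel]
  exact ⟨_, smoothStrip_of_partials hL hx hy h1 h2, hx, hy⟩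

theorem exists_solvesEulerLayer {v : ℝ × ℝ → ℝ} (hL : 0 < L) (hu : IsShearFlow u0)
    (hadm : Admissible κ m l B L u0 d) (hsol : IsVorticitySolution L u0 d v)
    (hv : SmoothStrip L v) (hU : SmoothStrip L (recoveredU d.U v))
    (heq : ∀ p ∈ closedStrip L,
      -u0 p.2 * laplacian L v p + dHalf 2 u0 p.2 * v p = d.F L p) :
    ∃ P, SolvesEulerLayer L u0 d (recoveredU d.U v) v P := by
  have s0 : SmoothStrip L (fun p => u0 p.2) := smoothStrip_snd hu.smooth
  have s1 : SmoothStrip L (fun p => dHalf 1 u0 p.2) := smoothStrip_snd (contDiffOn_dHalf hu.smooth 1)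
  have f1 : SmoothStrip L d.f₁ := hadm.smooth_f₁
  have f2 : SmoothStrip L d.f₂ := hadm.smooth_f₂
  have d0 : HasDY L (fun p => u0 p.2) (fun p => dHalf 1 u0 p.2) :=
    hasDY_snd L fun Y hY => by
      have := hasDerivWithinAt_dHalf hu.smooth 0 hY
      rwa [dHalf_zero] at this
  have d1 : HasDY L (fun p => dHalf 1 u0 p.2) (fun p => dHalf 2 u0 p.2) :=
    hasDY_snd L fun Y hY => hasDerivWithinAt_dHalf hu.smooth 1 hY
  -- These are the pressure derivatives prescribed by the momentum equations with `∂ₓ u = -∂_Y v`.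
  -- In the closedness condition the terms `u⁰' ∂_Y v` cancel, and the vorticity equation remains.
  obtain ⟨P, sP, hPx, hPY⟩ := exists_smooth_potential (L := L)
    (G₁ := fun p => d.f₁ p + u0 p.2 * dY v p - dHalf 1 u0 p.2 * v p)
    (G₂ := fun p => d.f₂ p - u0 p.2 * dx L v p) hL
    ((f1.add (s0.mul (hv.dY hL))).sub (s1.mul hv)) (f2.sub (s0.mul (hv.dx hL))) fun p hp => by
      rw [((f1.hasDY.add (d0.mul (hv.dY hL).hasDY)).sub (d1.mul hv.hasDY)).eq hp,
        ((f2.hasDx hL).sub ((hasDx_snd L u0).mul ((hv.dx hL).hasDx hL))).eq hL hp]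
      have := heq p hp
      simp only [laplacian, LayerData.F] at this
      linarith
  have hux := hasDx_recoveredU hL d.U hv
  refine ⟨P, hU, hv, sP, fun p hp => ?_, fun p hp => ?_, fun p hp => ?_, hsol.bottom, hsol.left,
    hsol.right, fun Y _ => ?_⟩
  · rw [hux.eq hL hp, hPx.eq hL hp]; ring
  · rw [hPY.eq hp]; ring
  · rw [hux.eq hL hp]; ring
  · simp [recoveredU]

end Tower

/-! ### From pointwise weighted bounds to weighted Sobolev norms -/

theorem tame_recoveredU {Θ : Type*} {Λ : Θ → ℝ} {W : ℝ → ℝ} {U : Θ → ℝ → ℝ}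
    {v : Θ → ℝ × ℝ → ℝ} (hΛ : ∀ θ, 0 < Λ θ) {A : ℝ} (hA : ∀ θ, Λ θ ≤ A)
    (hU : Tame Λ (fun _ => 1) W (fun θ p => U θ p.2)) (hv : Tame Λ (fun _ => 1) W v) :
    Tame Λ (fun _ => 1) W (fun θ => recoveredU (U θ) (v θ)) :=
  hU.sub hΛ ((hv.dY hΛ).integral hΛ hA)

theorem contDiffOn_weight (κ : WeightKind) (m : ℝ) : ContDiffOn ℝ ∞ (weight κ m) (Ici 0) := by
  cases κ
  · intro Y hY
    have h0 : (0 : ℝ) ≤ Y := hY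
    exact ContDiffWithinAt.rpow_const_of_ne (by fun_prop) (by linarith)
  · exact (Real.contDiff_exp.comp (contDiff_const.mul contDiff_id)).contDiffOn

theorem exists_dHalf_weight (κ : WeightKind) (m : ℝ) (k : ℕ) :
    ∃ c r : ℝ, r ≤ m ∧ ∀ Y, 0 ≤ Y → dHalf k (weight κ m) Y = c * weight κ r Y := by
  induction k with
  | zero => exact ⟨1, m, le_rfl, fun Y _ => by rw [dHalf_zero, one_mul]⟩
  | succ k ih =>
    obtain ⟨c, r, hr, h⟩ := ih
    refine ⟨c * r, κ.lower r, (κ.lower_le r).trans hr, fun Y hY => ?_⟩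
    have h1 := ((hasDerivAt_weight κ r (by linarith : -1 < Y)).const_mul c).hasDerivWithinAt
      (s := Ici 0)
    rw [dHalf_succ, mul_assoc]
    exact (h1.congr h (h Y hY)).derivWithin (uniqueDiffOn_Ici 0 Y hY)

theorem tame_weight {Θ : Type*} {Λ : Θ → ℝ} (hΛ : ∀ θ, 0 < Λ θ) (κ : WeightKind) (m : ℝ) :
    Tame Λ (fun _ => 1) (weight κ m) (fun _ p => weight κ m p.2) := by
  refine Tame.of_snd (u := fun _ => weight κ m) hΛ (fun _ => contDiffOn_weight κ m) fun k => ?_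
  obtain ⟨c, r, hr, h⟩ := exists_dHalf_weight κ m k
  refine ⟨|c|, fun _ Y hY => ?_⟩
  rw [h Y hY, abs_mul, abs_of_pos (weight_pos κ r hY), one_mul]
  exact mul_le_mul_of_nonneg_left (weight_mono_exponent κ hr hY) (abs_nonneg c)

theorem weight_neg_one_le (κ : WeightKind) {Y : ℝ} (hY : 0 ≤ Y) :
    weight κ (-1) Y ≤ (1 + |Y|)⁻¹ := by
  rw [abs_of_nonneg hY, weight_neg κ 1 hY]
  refine inv_anti₀ (by linarith) ?_
  cases κ
  · simp [weight]
  · simp only [weight, one_mul]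
    linarith [Real.add_one_le_exp Y]

theorem memLp_strip_one : MemLp (fun p : ℝ × ℝ => (1 + |p.2|)⁻¹) 2 (volume.restrict (strip 1)) := by
  have h1 : Integrable (fun Y : ℝ => (1 + ‖Y‖) ^ (-2 : ℝ)) (volume.restrict (Ioi 0)) :=
    (integrable_one_add_norm (by simp)).restrict
  have h2 := h1.comp_snd (volume.restrict (Ioo (0 : ℝ) 1))
  rw [Measure.prod_restrict] at h2
  refine (memLp_two_iff_integrable_sq ?_).2 (h2.congr (Eventually.of_forall fun p => ?_))
  · exact (Measurable.aestronglyMeasurable (by fun_prop))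
  · have : (0 : ℝ) ≤ 1 + |p.2| := by positivity
    simp only [Real.norm_eq_abs]
    rw [Real.rpow_neg this, inv_pow]
    norm_cast

/-- Families that decay at a square integrable rate have uniformly bounded `L²` norms. -/
theorem UnifBound.exists_eLpNorm_le {Θ : Type*} {Λ : Θ → ℝ} (hΛ1 : ∀ θ, Λ θ ≤ 1) {κ : WeightKind}
    {g : Θ → ℝ × ℝ → ℝ} (hg : UnifBound Λ (fun _ => 1) (weight κ (-1)) g) :
    ∃ A : ℝ≥0∞, A ≠ ⊤ ∧ ∀ θ, eLpNorm (g θ) 2 (volume.restrict (strip (Λ θ))) ≤ A := by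
  obtain ⟨C, hC0, hC⟩ := hg.exists_nonneg fun Y hY => (weight_pos κ _ hY).le
  refine ⟨_, (memLp_strip_one.const_mul C).2.ne, fun θ => ?_⟩
  calc _ ≤ eLpNorm (fun p : ℝ × ℝ => C * (1 + |p.2|)⁻¹) 2 (volume.restrict (strip (Λ θ))) := by
        refine eLpNorm_mono_ae_real ?_
        filter_upwards [ae_restrict_mem (isOpen_strip _).measurableSet] with p hp
        have hp' := strip_subset_closedStrip _ hp
        exact (hC θ p hp').trans
          (mul_le_mul_of_nonneg_left (weight_neg_one_le κ hp'.2) hC0)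
    _ ≤ _ := eLpNorm_mono_measure _ (Measure.restrict_mono
        (prod_mono (Ioo_subset_Ioo_right (hΛ1 θ)) le_rfl) le_rfl)

theorem Tame.exists_hkNorm_le {Θ : Type*} {Λ : Θ → ℝ} (hΛ : ∀ θ, 0 < Λ θ) (hΛ1 : ∀ θ, Λ θ ≤ 1)
    {κ : WeightKind} {g : Θ → ℝ × ℝ → ℝ} (hg : Tame Λ (fun _ => 1) (weight κ (-1)) g) (k : ℕ) :
    ∃ A : ℝ≥0∞, A ≠ ⊤ ∧ ∀ θ, hkNorm (Λ θ) k (g θ) ≤ A := by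
  choose A hA hle using fun j i => (hg.unifBound_iterate hΛ j i).exists_eLpNorm_le hΛ1
  refine ⟨(∑ j ∈ Finset.range (k + 1), ∑ i ∈ Finset.range (k + 1 - j), A j i ^ 2) ^ (1 / 2 : ℝ),
    ENNReal.rpow_ne_top_of_nonneg (by norm_num) (ENNReal.sum_ne_top.2 fun j _ =>
      ENNReal.sum_ne_top.2 fun i _ => ENNReal.pow_ne_top (hA j i)), fun θ => ?_⟩
  refine ENNReal.rpow_le_rpow ?_ (by norm_num)
  gcongr with j _ i _
  exact hle j i θ

/-- After multiplication by the weight of exponent `M`, decay at rate at least 1 remains, which is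
square integrable on a strip of width at most 1. This is the only loss of decay in the argument. -/
theorem Tame.exists_hkNorm_mul_weight_le {Θ : Type*} {Λ : Θ → ℝ} (hΛ : ∀ θ, 0 < Λ θ)
    (hΛ1 : ∀ θ, Λ θ ≤ 1) {κ : WeightKind} {g : Θ → ℝ × ℝ → ℝ} {r M : ℝ}
    (hg : Tame Λ (fun _ => 1) (weight κ (-r)) g) (hM : M ≤ r - 1) (k : ℕ) :
    ∃ A : ℝ≥0∞, A ≠ ⊤ ∧ ∀ θ, hkNorm (Λ θ) k (fun p => g θ p * weight κ M p.2) ≤ A := by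
  refine Tame.exists_hkNorm_le hΛ hΛ1 (κ := κ) ?_ k
  refine (hg.mul hΛ (tame_weight hΛ κ M)).mono (fun _ => by norm_num)
    (fun Y hY => (mul_pos (weight_pos κ _ hY) (weight_pos κ _ hY)).le) 1 fun _ Y hY => ?_
  rw [← weight_add κ _ _ hY, one_mul, one_mul, one_mul, one_mul]
  exact weight_mono_exponent κ (by linarith) hY

end EulerLayer

end

/-! ### The main theorem -/

theorem proposition3p3 :
    ∃ n₀ : ℝ, 0 < n₀ ∧
      ∀ (κ : WeightKind) (u0 : ℝ → ℝ), IsShearFlow u0 → ∀ m l : ℝ, 0 < m → 0 < l →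
        ∃ L₀ : ℝ, 0 < L₀ ∧ ∀ B : ℕ → ℝ, ∃ C : ℕ → ℝ → ℝ,
          ∀ L : ℝ, 0 < L → L < L₀ → ∀ d : LayerData, Admissible κ m l B L u0 d →
            ∃ v : ℝ × ℝ → ℝ,
              IsVorticitySolution L u0 d v ∧
              (∀ v' : ℝ × ℝ → ℝ, IsVorticitySolution L u0 d v' → EqOn v' v (closedStrip L)) ∧
              (∃ P : ℝ × ℝ → ℝ, SolvesEulerLayer L u0 d (recoveredU d.U v) v P) ∧
              ∀ (k : ℕ) (M : ℝ), M ≤ min m l - n₀ →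
                hkNorm L k (fun p => recoveredU d.U v p * weight κ M p.2) +
                  hkNorm L k (fun p => v p * weight κ M p.2) ≤ ENNReal.ofReal (C k M) := by
  refine ⟨1, one_pos, fun κ u0 hu m l hm hl => ?_⟩
  obtain ⟨Q', hQ'⟩ := (tame_potential (Θ := Unit) (Λ := fun _ => 1) (fun _ => one_pos) hu).bound 0
  set Q := |Q'| with hQdef
  have hQ : 0 ≤ Q := abs_nonneg _
  have hq : ∀ Y, 0 ≤ Y → |potential u0 Y| ≤ Q := fun Y hY =>
    (hQ' () (0, Y) ⟨⟨le_rfl, zero_le_one⟩, hY⟩).trans (by simpa using le_abs_self Q')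
  set r := min m l with hr
  have hr0 : 0 ≤ r := le_min hm.le hl.le
  -- The least value allowed by the weighted maximum principle for the decaying weight; it depends
  -- on the flow and the weights, but not on `B`.
  set K := Q + |-r * κ.lower (-r)| + 1 with hKdef
  have hc0 := abs_nonneg (-r * κ.lower (-r))
  have hK1 : 1 ≤ K := by linarith
  have hQK : Q < K := by linarith
  -- As `K ≥ 1`, the condition `L < K⁻¹` gives both `L ≤ 1` and `K L² ≤ 1`.
  refine ⟨K⁻¹, by positivity, fun B => ?_⟩
  -- All admissible pairs of a width and data form one family, so tame bounds over it are constants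
  -- independent of both.
  let Θ := {θ : ℝ × LayerData // 0 < θ.1 ∧ θ.1 < K⁻¹ ∧ Admissible κ m l B θ.1 u0 θ.2}
  let Λ : Θ → ℝ := fun θ => θ.1.1
  let dat : Θ → LayerData := fun θ => θ.1.2
  have hΛ : ∀ θ, 0 < Λ θ := fun θ => θ.2.1
  have hadm : ∀ θ, Admissible κ m l B (Λ θ) u0 (dat θ) := fun θ => θ.2.2.2
  have hΛ1 : ∀ θ, Λ θ ≤ 1 := fun θ => θ.2.2.1.le.trans (inv_le_one_of_one_le₀ hK1)
  have hKL : ∀ θ, K * Λ θ ^ 2 ≤ 1 := fun θ => by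
    have h1 : K * Λ θ ≤ 1 := by
      have := mul_le_mul_of_nonneg_left θ.2.2.1.le (zero_le_one.trans hK1)
      rwa [mul_inv_cancel₀ (by positivity)] at this
    nlinarith [hΛ θ, hΛ1 θ]
  choose E X D M S using fun θ =>
    exists_towerSolution hm hl (hΛ θ) hQK (hKL θ) hu hq (hadm θ)
  have m0 : ∀ θ, (0 : ℝ) ∈ Icc 0 (Λ θ) := fun θ => ⟨le_rfl, (hΛ θ).le⟩
  have m1 : ∀ θ, Λ θ ∈ Icc 0 (Λ θ) := fun θ => ⟨(hΛ θ).le, le_rfl⟩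
  have tE : Tame Λ (fun _ => 1) (weight κ (-r)) (fun θ => E θ 0) :=
    tame_of_isTowerSolution hr0 hQ le_rfl hΛ hΛ1 hKL hq (smooth_potential hu) S
      (tame_potential hΛ hu) (fun j => (tame_source hΛ hu hadm).dx_iterate hΛ _)
      (fun j => (tame_source hΛ hu hadm).dx_iterate hΛ _)
      (fun j => ⟨B (2 * j), fun θ x hx => by
        rw [bottomFun, abs_neg]; exact (hadm θ).bound_a (2 * j) x hx⟩)
      (tame_sideFun hΛ hu hadm m0 (tame_V₀ hΛ hadm)) (tame_sideFun hΛ hu hadm m1 (tame_V₁ hΛ hadm))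
      (tame_sideFun_sub hΛ hu hadm)
  have tU : Tame Λ (fun _ => 1) (weight κ (-r)) (fun θ => recoveredU (dat θ).U (E θ 0)) :=
    tame_recoveredU hΛ hΛ1 (tame_U hΛ hadm) tE
  -- The restriction on `N` stands inside the existential so that a constant can be chosen for every
  -- real `N`.
  have hbound : ∀ (k : ℕ) (N : ℝ), ∃ C : ℝ, N ≤ r - 1 → ∀ θ,
      hkNorm (Λ θ) k (fun p => recoveredU (dat θ).U (E θ 0) p * weight κ N p.2) +
        hkNorm (Λ θ) k (fun p => E θ 0 p * weight κ N p.2) ≤ ENNReal.ofReal C := by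
    intro k N
    by_cases hN : N ≤ r - 1
    · obtain ⟨A₁, hA₁, h1⟩ := tU.exists_hkNorm_mul_weight_le hΛ hΛ1 hN k
      obtain ⟨A₂, hA₂, h2⟩ := tE.exists_hkNorm_mul_weight_le hΛ hΛ1 hN k
      refine ⟨(A₁ + A₂).toReal, fun _ θ => ?_⟩
      rw [ENNReal.ofReal_toReal (ENNReal.add_ne_top.2 ⟨hA₁, hA₂⟩)]
      exact add_le_add (h1 θ) (h2 θ)
    · exact ⟨0, fun h => absurd h hN⟩
  choose C hC using hbound
  refine ⟨C, fun L hL hL' d hd => ?_⟩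
  let θ : Θ := ⟨(L, d), hL, hL', hd⟩
  have hsol := (S θ).isVorticitySolution hL hu (tE.smooth θ)
  exact ⟨E θ 0, hsol, fun v' h' => h'.eqOn hu hQ hQK (hKL θ) hq hsol,
    exists_solvesEulerLayer hL hu hd hsol (tE.smooth θ) (tU.smooth θ)
      (fun p hp => (S θ).vorticity_eq hL hu hp), fun k N hN => hC k N hN θ⟩
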